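/- **Theorem (Global solvability for the IST equation – part 2).** Let $\chi=\chi_R+i\chi_I:\mathbb R\times\mathbb R\to\mathbb C$, $(\xi,\lambda)\mapsto\chi(\xi,\lambda)$, satisfy: 1. $\chi$ and $\partial_\xi\chi$ are well-defined continuous functions on $\mathbb R^2$; 2. $|\partial_\xi\chi_R(\xi,\lambda)|\le\frac14\tan\frac\pi8$ and $|\partial_\xi\chi_I(\xi,\lambda)|\le\frac14\tan\frac\pi8$ for all $\xi,\lambda$; 3. there is a constant $C$ with $|\chi(\xi,\lambda)|\le\frac{C}{1+|\lambda|}$ for all $\xi,\lambda$; 4. the derivatives $\partial_\xi^n\chi$ ($n\le 3$) and $\partial_\xi^n\partial_\lambda\chi$ ($n\le1$) exist everywhere, and there is a constant $C$ such that for all $\xi,\lambda$ $$|\partial_\xi^n\chi(\xi,\lambda)|\le\frac{C}{1+|\lambda|^{2+n}}\quad(n=0,1,2,3),\qquad |\partial_\xi^n\partial_\lambda\chi(\xi,\lambda)|\le\frac{C}{1+|\lambda|^{3+n}}\quad(n=0,1).$$ Then for all $x,y\in\mathbb R$ and $t\ge0$ there is a unique $\omega(x,y,t,\cdot)\in L^2(\mathbb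 R,d\lambda)$ (real-valued) such that $\psi=x-\lambda y-\lambda^2t+\omega$ satisfies, for almost every $\lambda$, $$\psi(x,y,t,\lambda)+\chi_R(\psi(x,y,t,\lambda),\lambda)=x-\lambda y-\lambda^2t-\frac1\pi\,\mathrm{p.v.}\!\int_{\mathbb R}\frac{\chi_I(\psi(x,y,t,\zeta),\zeta)}{\zeta-\lambda}\,d\zeta ,$$ where the principal value exists for almost every $\lambda$. Moreover: 1. For all $x,y\in\mathbb R$, $t\ge0$, the function $\omega(x,y,t,\cdot)$ lies in $H^1(d\lambda)$ and depends continuously on $(x,y,t)\in\mathbb R\times\mathbb R\times[0,\infty)$ as an element of $L^2(d\lambda)\cap L^\infty(d\lambda)$. Its $L^2(d\lambda)$-norm is bounded uniformly in $x,y,t$. 2. The derivatives $\partial_x\omega,\ \partial_y\omega,\ \partial_t\omega,\ \partial_x^2\omega,\ \partial_y^2\omega,\ \partial_x\partial_y\omega,\ \partial_t\partial_x\omega$ of the $L^2(d\lambda)$-valued function $\omega$ exist (the $t$-derivatives at $t=0$ being one-sided), depend continuously on $(x,y,t)\in\mathbb R\times\mathbb R\times[0,\infty)$ as elements of $L^2(d\lambda)$,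 and have $L^2(d\lambda)$-norms bounded uniformly on $\mathbb R\times\mathbb R\times[0,\infty)$. Moreover $\psi(x,y,0,\lambda)=\varphi(x,y,\lambda)$ for almost every $\lambda$, where $\varphi$ is the solution, with $\varphi-(x-\lambda y)\in L^2(d\lambda)$, of $$\varphi(x,y,\lambda)+\chi_R(\varphi(x,y,\lambda),\lambda)=x-\lambda y-\frac1\pi\,\mathrm{p.v.}\!\int_{\mathbb R}\frac{\chi_I(\varphi(x,y,\zeta),\zeta)}{\zeta-\lambda}\,d\zeta .$$ -/

import Mathlib

open MeasureTheory Filter Topology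
open scoped ENNReal

namespace Pavlov

/-- The real Hilbert space `L²(ℝ, dλ)`. -/
abbrev L2 : Type := Lp ℝ 2 (volume : Measure ℝ)

/-- The `n`-th partial derivative in `ξ` of a function `χ (ξ, l)`. -/
noncomputable def dXi (n : ℕ) (χ : ℝ → ℝ → ℂ) (ξ l : ℝ) : ℂ :=
  iteratedDeriv n (fun s => χ s l) ξ

/-- The partial derivative in `l` of a function `χ (ξ, l)`. -/
noncomputable def dLam (χ : ℝ → ℝ → ℂ) (ξ l : ℝ) : ℂ :=
  deriv (fun m => χ ξ m) l

/-- For every fixed `l`, the function `ξ ↦ χ (ξ, l)` is `n` times differentiable (the last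
derivative need not be continuous). -/
def DiffXi (n : ℕ) (χ : ℝ → ℝ → ℂ) : Prop :=
  ∀ k < n, ∀ l : ℝ, Differentiable ℝ (fun ξ => dXi k χ ξ l)

/-- For every fixed `ξ`, the function `l ↦ χ (ξ, l)` is differentiable. -/
def DiffLam (χ : ℝ → ℝ → ℂ) : Prop :=
  ∀ ξ : ℝ, Differentiable ℝ (fun l => χ ξ l)

/-- The Cauchy principal value integral of `f ζ / (ζ - l)` over `ℝ` exists and equals `p`. -/
def HasPrincipalValue (f : ℝ → ℝ) (l p : ℝ) : Prop :=
  (∀ ε : ℝ, 0 < ε → IntegrableOn (fun ζ => f ζ / (ζ - l)) {ζ | ε < |ζ - l|}) ∧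
    Tendsto (fun ε : ℝ => ∫ ζ in {ζ | ε < |ζ - l|}, f ζ / (ζ - l)) (𝓝[>] 0) (𝓝 p)

/-- The nonlinear integral equation of the inverse problem at the point `(x, y, t)`, for a function
`ψ` of the spectral parameter:
`ψ(l) + χ_R(ψ(l), l) = x - l y - l² t - (1/π) p.v. ∫ χ_I(ψ(ζ), ζ) / (ζ - l) dζ`
for almost every `l`. -/
def SolvesIST (χ : ℝ → ℝ → ℂ) (x y t : ℝ) (ψ : ℝ → ℝ) : Prop :=
  ∀ᵐ l : ℝ, ∃ p : ℝ, HasPrincipalValue (fun ζ => (χ (ψ ζ) ζ).im) l p ∧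
    ψ l + (χ (ψ l) l).re = x - l * y - l ^ 2 * t - 1 / Real.pi * p

/-- The stationary equation at `(x, y)`:
`φ(l) + χ_R(φ(l), l) = x - l y - (1/π) p.v. ∫ χ_I(φ(ζ), ζ) / (ζ - l) dζ` for almost every `l`. -/
def SolvesStationaryIST (χ : ℝ → ℝ → ℂ) (x y : ℝ) (φ : ℝ → ℝ) : Prop :=
  ∀ᵐ l : ℝ, ∃ p : ℝ, HasPrincipalValue (fun ζ => (χ (φ ζ) ζ).im) l p ∧
    φ l + (χ (φ l) l).re = x - l * y - 1 / Real.pi * p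

/-- The function `ψ(l) = x - l y - l² t + w(l)`. -/
noncomputable def psi (x y t : ℝ) (w : ℝ → ℝ) (l : ℝ) : ℝ :=
  x - l * y - l ^ 2 * t + w l

/-- `w ∈ H¹(dλ)`: the function `w ∈ L²` has a weak derivative in `L²`. -/
def MemH1 (w : L2) : Prop :=
  ∃ g : L2, ∀ φ : ℝ → ℝ, ContDiff ℝ (⊤ : ℕ∞) φ → HasCompactSupport φ →
    ∫ l, w l * deriv φ l = -∫ l, g l * φ l

/-- The closed half-space `{(x, y, t) : t ≥ 0}`. -/
def Dom : Set (ℝ × ℝ × ℝ) := {p | 0 ≤ p.2.2}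

/-- `F` depends continuously on `(x, y, t)`, `t ≥ 0`, as an element of `L²(dλ)`. -/
def ContL2 (F : ℝ → ℝ → ℝ → L2) : Prop :=
  ContinuousOn (fun p : ℝ × ℝ × ℝ => F p.1 p.2.1 p.2.2) Dom

/-- For `t ≥ 0`, the functions `F(x, y, t)` lie in `L^∞(dλ)` and depend continuously on
`(x, y, t)` in the norm of `L^∞(dλ)`. -/
def ContLInfty (F : ℝ → ℝ → ℝ → L2) : Prop :=
  (∀ x y t : ℝ, 0 ≤ t → MemLp (F x y t) ∞ volume) ∧
  ∀ q ∈ Dom, Tendsto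
    (fun p : ℝ × ℝ × ℝ => eLpNorm (F p.1 p.2.1 p.2.2 - F q.1 q.2.1 q.2.2 : L2) ∞ volume)
    (𝓝[Dom] q) (𝓝 0)

/-- The `L²(dλ)`-norm of `F(x, y, t)` is bounded uniformly in `x`, `y` and `t ≥ 0`. -/
def BddL2 (F : ℝ → ℝ → ℝ → L2) : Prop :=
  ∃ M : ℝ, ∀ x y t : ℝ, 0 ≤ t → ‖F x y t‖ ≤ M

/-- `G = ∂ₓ F` for `t ≥ 0`, as the derivative of an `L²(dλ)`-valued function. -/
def HasDx (F G : ℝ → ℝ → ℝ → L2) : Prop :=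
  ∀ x y t : ℝ, 0 ≤ t → HasDerivAt (fun s => F s y t) (G x y t) x

/-- `G = ∂_y F` for `t ≥ 0`, as the derivative of an `L²(dλ)`-valued function. -/
def HasDy (F G : ℝ → ℝ → ℝ → L2) : Prop :=
  ∀ x y t : ℝ, 0 ≤ t → HasDerivAt (fun s => F x s t) (G x y t) y

/-- `G = ∂_t F` for `t ≥ 0`, as the derivative of an `L²(dλ)`-valued function (one-sided at
`t = 0`). -/
def HasDt (F G : ℝ → ℝ → ℝ → L2) : Prop :=
  ∀ x y t : ℝ, 0 ≤ t → HasDerivWithinAt (fun s => F x y s) (G x y t) (Set.Ici 0) t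

end Pavlov

namespace Pavlov

open ProbabilityTheory

/-- The standard Cauchy distribution. -/
noncomputable abbrev cauchyLaw : Measure ℝ := cauchyMeasure 0 1

/-- The average of the translates `f (l + ε u)` against `k(u) du / π`. -/
noncomputable def kernelAvg (k : ℝ → ℝ) (ε : ℝ) (f : ℝ → ℝ) (l : ℝ) : ℝ :=
  1 / Real.pi * ∫ u, f (l + ε * u) * k u

lemma lintegral_cauchyLaw {φ : ℝ → ℝ≥0∞} (hφ : Measurable φ) :
    ∫⁻ u, φ u ∂cauchyLaw = ∫⁻ u, ENNReal.ofReal (Real.pi⁻¹ * (1 + u ^ 2)⁻¹) * φ u := by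
  rw [cauchyLaw, cauchyMeasure_of_scale_ne_zero 0 one_ne_zero,
    lintegral_withDensity_eq_lintegral_mul _ (measurable_cauchyPDF 0 1) hφ]
  refine lintegral_congr fun u => ?_
  simp [cauchyPDF, cauchyPDFReal, add_comm]

lemma lintegral_mul_kernel_le {φ : ℝ → ℝ≥0∞} (hφ : Measurable φ) {k : ℝ → ℝ}
    (hk : ∀ u, |k u| ≤ (1 + u ^ 2)⁻¹) :
    ∫⁻ u, φ u * ‖k u‖ₑ ≤ ENNReal.ofReal Real.pi * ∫⁻ u, φ u ∂cauchyLaw := by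
  rw [lintegral_cauchyLaw hφ, ← lintegral_const_mul]
  · refine lintegral_mono fun u => ?_
    rw [mul_comm, ← mul_assoc, ← ENNReal.ofReal_mul Real.pi_pos.le,
      ← mul_assoc, mul_inv_cancel₀ Real.pi_ne_zero, one_mul]
    gcongr
    rw [← ofReal_norm]
    exact ENNReal.ofReal_le_ofReal (hk u)
  · fun_prop

lemma enorm_kernelAvg_le {k : ℝ → ℝ} (hk : ∀ u, |k u| ≤ (1 + u ^ 2)⁻¹) {f : ℝ → ℝ}
    (hf : Measurable f) (ε l : ℝ) :
    ‖kernelAvg k ε f l‖ₑ ≤ ∫⁻ u, ‖f (l + ε * u)‖ₑ ∂cauchyLaw := by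
  have h1 : ‖∫ u, f (l + ε * u) * k u‖ₑ ≤ ∫⁻ u, ‖f (l + ε * u)‖ₑ * ‖k u‖ₑ := by
    refine (enorm_integral_le_lintegral_enorm _).trans (le_of_eq ?_)
    simp
  have h2 := h1.trans (lintegral_mul_kernel_le (φ := fun u => ‖f (l + ε * u)‖ₑ)
    (by fun_prop) hk)
  rw [kernelAvg, enorm_mul]
  calc _ ≤ ‖1 / Real.pi‖ₑ * (ENNReal.ofReal Real.pi * ∫⁻ u, ‖f (l + ε * u)‖ₑ ∂cauchyLaw) := by
        gcongr
    _ = _ := by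
        rw [← mul_assoc, ← ofReal_norm, ← ENNReal.ofReal_mul (norm_nonneg _),
          Real.norm_of_nonneg (by positivity), one_div, inv_mul_cancel₀ Real.pi_ne_zero]
        simp

lemma lintegral_pow_le_of_isProbabilityMeasure {α : Type*} [MeasurableSpace α] (μ : Measure α)
    [IsProbabilityMeasure μ] {φ : α → ℝ≥0∞} (hφ : Measurable φ) {p : ℝ} (hp : 1 ≤ p) :
    (∫⁻ u, φ u ∂μ) ^ p ≤ ∫⁻ u, φ u ^ p ∂μ := by
  have h := eLpNorm'_le_eLpNorm'_of_exponent_le (f := φ) one_pos hp μ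
    hφ.aestronglyMeasurable
  simp only [eLpNorm', enorm_eq_self, ENNReal.rpow_one, div_one] at h
  have := ENNReal.rpow_le_rpow h (zero_le_one.trans hp)
  rwa [← ENNReal.rpow_mul, one_div, inv_mul_cancel₀ (by positivity), ENNReal.rpow_one] at this

/-- Minkowski's inequality for averages over a probability measure. -/
lemma lintegral_rpow_le_of_le_average {α : Type*} [MeasurableSpace α] (μ : Measure α)
    [IsProbabilityMeasure μ] {F : ℝ → α → ℝ≥0∞} (hF : Measurable (Function.uncurry F))
    {g : ℝ → ℝ≥0∞} (hg : ∀ l, g l ≤ ∫⁻ u, F l u ∂μ) {p : ℝ} (hp : 1 ≤ p) :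
    ∫⁻ l, g l ^ p ≤ ∫⁻ u, (∫⁻ l, F l u ^ p) ∂μ := by
  calc ∫⁻ l, g l ^ p ≤ ∫⁻ l, (∫⁻ u, F l u ^ p ∂μ) := by
        refine lintegral_mono fun l => ?_
        refine (ENNReal.rpow_le_rpow (hg l) (by positivity)).trans ?_
        exact lintegral_pow_le_of_isProbabilityMeasure μ (hF.comp measurable_prodMk_left) hp
    _ = _ := lintegral_lintegral_swap (hF.pow_const p).aemeasurable

lemma lintegral_enorm_eq_eLpNorm {f : ℝ → ℝ} {p : ℝ} (hp : 0 < p) :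
    eLpNorm f (ENNReal.ofReal p) volume ^ p = ∫⁻ l, ‖f l‖ₑ ^ p := by
  rw [eLpNorm_eq_lintegral_rpow_enorm_toReal (by simpa using hp) (by simp),
    ENNReal.toReal_ofReal hp.le, ← ENNReal.rpow_mul, one_div, inv_mul_cancel₀ hp.ne',
    ENNReal.rpow_one]

lemma eLpNorm_two_rpow (f : ℝ → ℝ) : eLpNorm f 2 volume ^ (2 : ℝ) = ∫⁻ l, ‖f l‖ₑ ^ (2 : ℝ) := by
  rw [← lintegral_enorm_eq_eLpNorm two_pos, ENNReal.ofReal_ofNat]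

lemma eLpNorm_kernelAvg_le {k : ℝ → ℝ} (hk : ∀ u, |k u| ≤ (1 + u ^ 2)⁻¹) {f : ℝ → ℝ}
    (hf : Measurable f) (ε : ℝ) {p : ℝ} (hp : 1 ≤ p) :
    eLpNorm (kernelAvg k ε f) (ENNReal.ofReal p) ≤ eLpNorm f (ENNReal.ofReal p) := by
  have hp0 : 0 < p := by positivity
  rw [← ENNReal.rpow_le_rpow_iff hp0, lintegral_enorm_eq_eLpNorm hp0,
    lintegral_enorm_eq_eLpNorm hp0]
  refine (lintegral_rpow_le_of_le_average cauchyLaw (F := fun l u => ‖f (l + ε * u)‖ₑ)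
    (by unfold Function.uncurry; fun_prop) (fun l => enorm_kernelAvg_le hk hf ε l) hp).trans ?_
  have : ∀ u : ℝ, ∫⁻ l, ‖f (l + ε * u)‖ₑ ^ p = ∫⁻ l, ‖f l‖ₑ ^ p := fun u =>
    lintegral_add_right_eq_self (fun l => ‖f l‖ₑ ^ p) (ε * u)
  simp [this]

/-- The `L²` modulus of continuity. -/
noncomputable def modulus (f : ℝ → ℝ) (h : ℝ) : ℝ≥0∞ := eLpNorm (fun l => f (l + h) - f l) 2

lemma tendsto_modulus {f : ℝ → ℝ} (hf : MemLp f 2) : Tendsto (modulus f) (𝓝 0) (𝓝 0) := by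
  have hmp : ∀ h : ℝ, MeasurePreserving (fun l : ℝ => l + h) volume volume :=
    fun h => measurePreserving_add_right volume h
  let g : ℝ → C(ℝ, ℝ) := fun h => ⟨fun l => l + h, by fun_prop⟩
  have hg : Continuous g := ContinuousMap.continuous_of_continuous_uncurry _ (by
    simp only [g, ContinuousMap.coe_mk]; fun_prop)
  have key := (tendsto_const_nhds (x := hf.toLp f)).compMeasurePreservingLp (p := 2)
    (hg.tendsto 0) hmp (hmp 0) (by simp)
  rw [tendsto_iff_edist_tendsto_0] at key
  refine key.congr fun h => ?_
  rw [Lp.edist_def, modulus]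
  refine eLpNorm_congr_ae ?_
  have h1 := Lp.coeFn_compMeasurePreserving (hf.toLp f) (hmp h)
  have h2 := Lp.coeFn_compMeasurePreserving (hf.toLp f) (hmp 0)
  have h3 := (hmp h).quasiMeasurePreserving.ae_eq_comp hf.coeFn_toLp
  have h4 := (hmp 0).quasiMeasurePreserving.ae_eq_comp hf.coeFn_toLp
  filter_upwards [h1, h2, h3, h4] with l h1 h2 h3 h4
  simp only [Pi.sub_apply, g, ContinuousMap.coe_mk]
  rw [h1, h2, h3, h4]
  simp

lemma modulus_le {f : ℝ → ℝ} (hf : MemLp f 2) (h : ℝ) :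
    modulus f h ≤ 2 * eLpNorm f 2 := by
  have hmp := measurePreserving_add_right (volume : Measure ℝ) h
  have h1 : eLpNorm (fun l => f (l + h)) 2 = eLpNorm f 2 :=
    eLpNorm_comp_measurePreserving hf.1 hmp
  have h2 : AEStronglyMeasurable (fun l => f (l + h)) volume := hf.1.comp_measurePreserving hmp
  have h3 := eLpNorm_sub_le (p := 2) h2 hf.1 one_le_two
  rw [h1, ← two_mul] at h3
  exact h3

/-- Dilated averages of the oscillation of `f ∈ L²` tend to zero in `L²`. -/
lemma tendsto_lintegral_oscillation {f : ℝ → ℝ} (hfm : Measurable f) (hf : MemLp f 2) :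
    Tendsto (fun ε : ℝ => ∫⁻ u, (∫⁻ l, ‖f (l + ε * u) - f l‖ₑ ^ (2 : ℝ)) ∂cauchyLaw)
      (𝓝 0) (𝓝 0) := by
  have e : ∀ ε u : ℝ, ∫⁻ l, ‖f (l + ε * u) - f l‖ₑ ^ (2 : ℝ) = modulus f (ε * u) ^ (2 : ℝ) := by
    intro ε u
    exact (eLpNorm_two_rpow _).symm
  simp only [e]
  have h0 : Tendsto (fun ε : ℝ => ∫⁻ u, modulus f (ε * u) ^ (2 : ℝ) ∂cauchyLaw) (𝓝 0)
      (𝓝 (∫⁻ _, 0 ∂cauchyLaw)) := by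
    refine tendsto_lintegral_filter_of_dominated_convergence
      (fun _ => (2 * eLpNorm f 2) ^ (2 : ℝ)) ?_ ?_ ?_ ?_
    · refine .of_forall fun ε => ?_
      simp only [← e]
      exact Measurable.lintegral_prod_right (by fun_prop)
    · exact .of_forall fun ε => .of_forall fun u => by gcongr; exact modulus_le hf _
    · simp only [lintegral_const, measure_univ, mul_one]
      exact ENNReal.rpow_ne_top_of_nonneg (by norm_num)
        (ENNReal.mul_ne_top (by simp) hf.2.ne)
    · refine .of_forall fun u => ?_
      have h1 : Tendsto (fun ε : ℝ => ε * u) (𝓝 0) (𝓝 0) := by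
        have : Continuous fun ε : ℝ => ε * u := by fun_prop
        simpa using this.tendsto 0
      have := (ENNReal.continuous_rpow_const (y := 2)).tendsto 0 |>.comp
        ((tendsto_modulus hf).comp h1)
      simpa [Function.comp_def] using this
  simpa using h0

lemma memLp_comp_affine {f : ℝ → ℝ} (hf : MemLp f 2) {ε : ℝ} (hε : ε ≠ 0) (l : ℝ) :
    MemLp (fun u => f (l + ε * u)) 2 := by
  have h1 : MemLp (fun u => f (l + u)) 2 :=
    hf.comp_measurePreserving (measurePreserving_add_left volume l)
  have h2 : MemLp (fun u => f (l + u)) 2 (Measure.map (fun u => ε * u) volume) := by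
    rw [Real.map_volume_mul_left hε]
    exact h1.smul_measure (by simp)
  exact (memLp_map_measure_iff h2.1 (by fun_prop)).1 h2

lemma memLp_kernel {k : ℝ → ℝ} (hkm : Measurable k) (hk : ∀ u, |k u| ≤ (1 + u ^ 2)⁻¹) :
    MemLp k 2 := by
  rw [memLp_two_iff_integrable_sq hkm.aestronglyMeasurable]
  refine integrable_inv_one_add_sq.mono' (by fun_prop) (.of_forall fun u => ?_)
  have h1 : (1 + u ^ 2)⁻¹ ≤ 1 := inv_le_one_of_one_le₀ (by nlinarith)
  have h2 := hk u
  rw [Real.norm_of_nonneg (sq_nonneg _), ← sq_abs]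
  nlinarith [abs_nonneg (k u)]

lemma integrable_kernel {k : ℝ → ℝ} (hkm : Measurable k) (hk : ∀ u, |k u| ≤ (1 + u ^ 2)⁻¹) :
    Integrable k :=
  integrable_inv_one_add_sq.mono' (by fun_prop) (.of_forall hk)

lemma integrable_mul_kernel {k : ℝ → ℝ} (hkm : Measurable k)
    (hk : ∀ u, |k u| ≤ (1 + u ^ 2)⁻¹) {f : ℝ → ℝ} (hf : MemLp f 2) {ε : ℝ} (hε : ε ≠ 0) (l : ℝ) :
    Integrable fun u => f (l + ε * u) * k u :=
  (memLp_comp_affine hf hε l).integrable_mul (memLp_kernel hkm hk)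

lemma enorm_kernelAvg_sub_le {k : ℝ → ℝ} (hkm : Measurable k) (hk : ∀ u, |k u| ≤ (1 + u ^ 2)⁻¹)
    {f : ℝ → ℝ} (hfm : Measurable f) (hf : MemLp f 2) {ε : ℝ} (hε : ε ≠ 0) (l : ℝ) :
    ‖kernelAvg k ε f l - 1 / Real.pi * (∫ u, k u) * f l‖ₑ ≤
      ∫⁻ u, ‖f (l + ε * u) - f l‖ₑ ∂cauchyLaw := by
  have h1 : kernelAvg k ε f l - 1 / Real.pi * (∫ u, k u) * f l
      = 1 / Real.pi * ∫ u, (f (l + ε * u) - f l) * k u := by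
    simp only [sub_mul]
    rw [integral_sub (integrable_mul_kernel hkm hk hf hε l)
      ((integrable_kernel hkm hk).const_mul _), integral_const_mul, kernelAvg]
    ring
  have h2 : 1 / Real.pi * ∫ u, (f (l + ε * u) - f l) * k u
      = kernelAvg k ε (fun s => f s - f l) l := rfl
  rw [h1, h2]
  exact enorm_kernelAvg_le hk (by fun_prop) ε l

lemma tendsto_eLpNorm_kernelAvg_sub {k : ℝ → ℝ} (hkm : Measurable k)
    (hk : ∀ u, |k u| ≤ (1 + u ^ 2)⁻¹) {f : ℝ → ℝ} (hfm : Measurable f) (hf : MemLp f 2) :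
    Tendsto (fun ε : ℝ => eLpNorm
      (fun l => kernelAvg k ε f l - 1 / Real.pi * (∫ u, k u) * f l) 2) (𝓝[≠] 0) (𝓝 0) := by
  have h1 := (tendsto_lintegral_oscillation hfm hf).mono_left
    (nhdsWithin_le_nhds (s := {0}ᶜ))
  have h2 : Tendsto (fun ε : ℝ => eLpNorm
      (fun l => kernelAvg k ε f l - 1 / Real.pi * (∫ u, k u) * f l) 2 ^ (2 : ℝ))
      (𝓝[≠] 0) (𝓝 0) := by
    refine tendsto_of_tendsto_of_tendsto_of_le_of_le' tendsto_const_nhds h1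
      (.of_forall fun _ => zero_le) ?_
    filter_upwards [self_mem_nhdsWithin] with ε hε
    rw [eLpNorm_two_rpow]
    refine lintegral_rpow_le_of_le_average cauchyLaw
      (F := fun l u => ‖f (l + ε * u) - f l‖ₑ)
      (by unfold Function.uncurry; fun_prop)
      (fun l => enorm_kernelAvg_sub_le hkm hk hfm hf hε l) one_le_two
  have h3 := ((ENNReal.continuous_rpow_const (y := 2⁻¹)).tendsto 0).comp h2
  have e : ∀ x : ℝ≥0∞, (x ^ (2 : ℝ)) ^ (2⁻¹ : ℝ) = x := fun x => by
    rw [← ENNReal.rpow_mul]; norm_num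
  simp only [Function.comp_def, e] at h3
  simpa using h3

end Pavlov

namespace Pavlov

open ProbabilityTheory

lemma norm_sq_re_le (x : ℝ) (z : ℂ) (h : z.re = x) : x ^ 2 ≤ ‖z‖ ^ 2 := by
  rw [← h, ← sq_abs]; gcongr; exact Complex.abs_re_le_norm z

lemma continuous_line {g : ℂ → ℂ} (hd : DifferentiableOn ℂ g {z | 0 ≤ z.im}) {b : ℝ}
    (hb : 0 ≤ b) : Continuous fun x : ℝ => g (x + b * Complex.I) := by
  refine hd.continuousOn.comp_continuous (by fun_prop) fun x => ?_
  simpa using hb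

/-- The integral over the real line of a function holomorphic in the closed upper half plane
with quadratic decay vanishes. -/
lemma integral_eq_zero_of_holomorphic_decay {g : ℂ → ℂ}
    (hd : DifferentiableOn ℂ g {z | 0 ≤ z.im}) {K : ℝ}
    (hK : ∀ z : ℂ, 0 ≤ z.im → ‖g z‖ ≤ K / (1 + ‖z‖ ^ 2)) : ∫ x : ℝ, g x = 0 := by
  have hK0 : 0 ≤ K := by
    have := (norm_nonneg _).trans (hK 0 le_rfl)
    simpa using this
  have bound : ∀ (z : ℂ) (R : ℝ), 0 ≤ z.im → R ^ 2 ≤ ‖z‖ ^ 2 → ‖g z‖ ≤ K / (1 + R ^ 2) := by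
    intro z R hz hR
    exact (hK z hz).trans (div_le_div_of_nonneg_left hK0 (by positivity) (by linarith))
  have hint : Integrable fun x : ℝ => g x := by
    refine (integrable_inv_one_add_sq.const_mul K).mono' ?_ (.of_forall fun x => ?_)
    · have := continuous_line hd le_rfl
      simpa using this.aestronglyMeasurable
    · rw [← div_eq_mul_inv]
      exact bound x x (by simp) (norm_sq_re_le x x (by simp))
  have hlim := intervalIntegral_tendsto_integral hint tendsto_neg_atTop_atBot tendsto_id
  refine tendsto_nhds_unique hlim (squeeze_zero_norm' (a := fun R => 4 * K * (R / (1 + R ^ 2))) ?_ ?_)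
  · filter_upwards [eventually_gt_atTop 0] with R hR
    have hrect := Complex.integral_boundary_rect_eq_zero_of_differentiableOn g (-R : ℝ)
      ((R : ℝ) + (R : ℝ) * Complex.I) (hd.mono (by
        rintro z ⟨-, hz⟩
        simp only [Complex.ofReal_im, Complex.add_im, Complex.mul_im, Complex.ofReal_re,
          Complex.I_im, mul_one, Complex.I_re, mul_zero, add_zero, zero_add,
          Set.mem_preimage, Set.uIcc_of_le hR.le] at hz
        exact hz.1))
    simp only [Complex.ofReal_im, Complex.add_im, Complex.mul_im, Complex.ofReal_re,
      Complex.I_im, mul_one, Complex.I_re, mul_zero, add_zero, zero_add, Complex.add_re,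
      Complex.mul_re, sub_self, Complex.ofReal_zero, zero_mul] at hrect
    have h1 : ‖∫ x in (-R)..R, g (x + R * Complex.I)‖ ≤ K / (1 + R ^ 2) * |R - (-R)| := by
      refine intervalIntegral.norm_integral_le_of_norm_le_const fun x _ => ?_
      refine bound _ R (by simpa using hR.le) ?_
      rw [← sq_abs R]
      gcongr
      simpa using Complex.abs_im_le_norm (x + R * Complex.I)
    have hside : ∀ s : ℝ, s ^ 2 = R ^ 2 →
        ‖Complex.I • ∫ y in (0 : ℝ)..R, g (s + y * Complex.I)‖ ≤ K / (1 + R ^ 2) * |R - 0| := by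
      intro s hs
      rw [norm_smul, Complex.norm_I, one_mul]
      refine intervalIntegral.norm_integral_le_of_norm_le_const fun y hy => ?_
      rw [Set.uIoc_of_le hR.le] at hy
      refine bound _ R (by simpa using hy.1.le) ?_
      rw [← hs]
      exact norm_sq_re_le _ _ (by simp)
    have h2 := hside R rfl
    have h3 := hside (-R) (by ring)
    have e : ∫ x in (-R)..R, g x = (∫ x in (-R)..R, g (x + R * Complex.I))
        - (Complex.I • ∫ y in (0 : ℝ)..R, g (R + y * Complex.I))
        + Complex.I • ∫ y in (0 : ℝ)..R, g ((-R : ℝ) + y * Complex.I) := by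
      linear_combination hrect
    simp only [id]
    rw [e]
    refine (norm_add_le_of_le (norm_sub_le_of_le h1 h2) h3).trans (le_of_eq ?_)
    rw [abs_of_pos (by linarith), abs_of_pos (by linarith)]
    ring
  · have h1 : Tendsto (fun R : ℝ => R⁻¹) atTop (𝓝 0) := tendsto_inv_atTop_zero
    have h2 : Tendsto (fun R : ℝ => R / (1 + R ^ 2)) atTop (𝓝 0) := by
      refine squeeze_zero' ?_ ?_ h1
      · filter_upwards [eventually_gt_atTop 0] with R hR
        positivity
      · filter_upwards [eventually_gt_atTop 0] with R hR
        rw [div_le_iff₀ (by positivity)]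
        have : R⁻¹ * (1 + R ^ 2) = R⁻¹ + R := by field_simp
        rw [this]
        have := inv_pos.2 hR
        linarith
    simpa using h2.const_mul (4 * K)

/-- Functions holomorphic in the closed upper half plane which decay like `1 / |z|`. -/
structure HardyDecay (G : ℂ → ℂ) : Prop where
  holo : DifferentiableOn ℂ G {z | 0 ≤ z.im}
  decay : ∃ M, ∀ z : ℂ, 0 ≤ z.im → ‖G z‖ ≤ M / (1 + ‖z‖)

namespace HardyDecay

variable {G : ℂ → ℂ}

lemma sub {G₁ G₂ : ℂ → ℂ} (h₁ : HardyDecay G₁) (h₂ : HardyDecay G₂) :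
    HardyDecay fun z => G₁ z - G₂ z := by
  obtain ⟨M₁, hM₁⟩ := h₁.decay
  obtain ⟨M₂, hM₂⟩ := h₂.decay
  refine ⟨h₁.holo.sub h₂.holo, M₁ + M₂, fun z hz => ?_⟩
  rw [add_div]
  exact norm_sub_le_of_le (hM₁ z hz) (hM₂ z hz)

lemma const_mul (h : HardyDecay G) (c : ℂ) : HardyDecay fun z => c * G z := by
  obtain ⟨M, hM⟩ := h.decay
  refine ⟨h.holo.const_mul c, ‖c‖ * M, fun z hz => ?_⟩
  rw [norm_mul, mul_div_assoc]
  gcongr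
  exact hM z hz

lemma exists_sq_decay (h : HardyDecay G) :
    ∃ M, 0 ≤ M ∧ ∀ z : ℂ, 0 ≤ z.im → ‖G z‖ ≤ M ∧ ‖G z‖ ^ 2 ≤ M / (1 + ‖z‖ ^ 2) := by
  obtain ⟨M, hM⟩ := h.decay
  have hM0 : 0 ≤ M := by simpa using (norm_nonneg _).trans (hM 0 le_rfl)
  refine ⟨M + M ^ 2, by positivity, fun z hz => ⟨?_, ?_⟩⟩
  · refine (hM z hz).trans ((div_le_self hM0 (by simp)).trans ?_)
    nlinarith
  · have h1 : ‖G z‖ ^ 2 ≤ (M / (1 + ‖z‖)) ^ 2 := by gcongr; exact hM z hz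
    refine h1.trans ?_
    rw [div_pow]
    gcongr
    · linarith
    · nlinarith [norm_nonneg z]

lemma continuous (h : HardyDecay G) : Continuous fun x : ℝ => G x := by
  simpa using continuous_line h.holo le_rfl

lemma integral_pow (h : HardyDecay G) (n : ℕ) : ∫ x : ℝ, G x ^ (n + 2) = 0 := by
  obtain ⟨M, hM0, hM⟩ := h.exists_sq_decay
  refine integral_eq_zero_of_holomorphic_decay (g := fun z => G z ^ (n + 2)) (h.holo.pow _)
    (K := M ^ n * M) fun z hz => ?_
  rw [norm_pow, pow_add, mul_div_assoc]
  exact mul_le_mul (pow_le_pow_left₀ (norm_nonneg _) (hM z hz).1 n) (hM z hz).2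
    (by positivity) (by positivity)

lemma integrable_norm_pow (h : HardyDecay G) (n : ℕ) :
    Integrable fun x : ℝ => ‖G x‖ ^ (n + 2) := by
  obtain ⟨M, hM0, hM⟩ := h.exists_sq_decay
  refine (integrable_inv_one_add_sq.const_mul (M ^ n * M)).mono'
    (h.continuous.norm.pow _).aestronglyMeasurable (.of_forall fun x => ?_)
  rw [Real.norm_of_nonneg (by positivity), pow_add, mul_assoc, ← div_eq_mul_inv]
  have := hM x (by simp)
  refine mul_le_mul (pow_le_pow_left₀ (norm_nonneg _) this.1 n) ?_
    (by positivity) (by positivity)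
  simpa using this.2

lemma integrable_of_abs_le (h : HardyDecay G) (n : ℕ) {φ : ℝ → ℝ} (hφ : Continuous φ)
    (hle : ∀ x : ℝ, |φ x| ≤ ‖G x‖ ^ (n + 2)) : Integrable φ :=
  (h.integrable_norm_pow n).mono' hφ.aestronglyMeasurable (.of_forall hle)

lemma continuous_re (h : HardyDecay G) : Continuous fun x : ℝ => (G x).re :=
  Complex.continuous_re.comp h.continuous

lemma continuous_im (h : HardyDecay G) : Continuous fun x : ℝ => (G x).im :=
  Complex.continuous_im.comp h.continuous

lemma integral_re_sq (h : HardyDecay G) :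
    ∫ x : ℝ, (G x).re ^ 2 = ∫ x : ℝ, (G x).im ^ 2 := by
  have h0 := h.integral_pow 0
  have hc := h.continuous
  have hi : Integrable fun x : ℝ => G x ^ (0 + 2) :=
    (integrable_norm_iff (hc.pow _).aestronglyMeasurable).1
      (by simpa using h.integrable_norm_pow 0)
  have h1 : (∫ x : ℝ, (G x ^ (0 + 2)).re) = 0 := by
    have := integral_re hi
    simp only [h0, RCLike.re_eq_complex_re, Complex.zero_re] at this
    exact this
  have e : ∀ x : ℝ, (G x ^ (0 + 2)).re = (G x).re ^ 2 - (G x).im ^ 2 := fun x => by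
    simp [sq, Complex.mul_re]
  simp only [e] at h1
  have hre : Integrable fun x : ℝ => (G x).re ^ 2 :=
    h.integrable_of_abs_le 0 (h.continuous_re.pow 2) fun x => by
      rw [abs_pow]; gcongr; exact Complex.abs_re_le_norm _
  have him : Integrable fun x : ℝ => (G x).im ^ 2 :=
    h.integrable_of_abs_le 0 (h.continuous_im.pow 2) fun x => by
      rw [abs_pow]; gcongr; exact Complex.abs_im_le_norm _
  rw [integral_sub hre him] at h1
  linarith

lemma integral_re_pow_four_le (h : HardyDecay G) :
    ∫ x : ℝ, (G x).re ^ 4 ≤ 34 * ∫ x : ℝ, (G x).im ^ 4 := by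
  have h0 := h.integral_pow 2
  have hc := h.continuous
  have hi : Integrable fun x : ℝ => G x ^ (2 + 2) :=
    (integrable_norm_iff (hc.pow _).aestronglyMeasurable).1
      (by simpa using h.integrable_norm_pow 2)
  have h1 : (∫ x : ℝ, (G x ^ (2 + 2)).re) = 0 := by
    have := integral_re hi
    simp only [h0, RCLike.re_eq_complex_re, Complex.zero_re] at this
    exact this
  have hire : Integrable fun x : ℝ => (G x ^ (2 + 2)).re := hi.re
  have e : ∀ x : ℝ, (G x ^ (2 + 2)).re
      = (G x).re ^ 4 - 6 * (G x).re ^ 2 * (G x).im ^ 2 + (G x).im ^ 4 := fun x => by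
    simp only [pow_succ, pow_zero, one_mul, Complex.mul_re, Complex.mul_im]; ring
  have hre : Integrable fun x : ℝ => (G x).re ^ 4 :=
    h.integrable_of_abs_le 2 (h.continuous_re.pow 4) fun x => by
      rw [abs_pow]; gcongr; exact Complex.abs_re_le_norm _
  have him : Integrable fun x : ℝ => (G x).im ^ 4 :=
    h.integrable_of_abs_le 2 (h.continuous_im.pow 4) fun x => by
      rw [abs_pow]; gcongr; exact Complex.abs_im_le_norm _
  have h2 : ∫ x : ℝ, ((G x).re ^ 4 - 34 * (G x).im ^ 4) ≤ ∫ x : ℝ, 2 * (G x ^ (2 + 2)).re := by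
    refine integral_mono (hre.sub (him.const_mul _)) (hire.const_mul _) fun x => ?_
    simp only [e]
    nlinarith [sq_nonneg ((G x).re ^ 2 - 6 * (G x).im ^ 2)]
  rw [integral_const_mul, h1, integral_sub hre (him.const_mul _), integral_const_mul] at h2
  linarith

end HardyDecay

lemma eLpNorm_natCast_pow {φ : ℝ → ℝ} {n : ℕ} (hn : n ≠ 0) (he : Even n)
    (hi : Integrable fun x => φ x ^ n) :
    eLpNorm φ n volume ^ n = ENNReal.ofReal (∫ x, φ x ^ n) := by
  rw [ofReal_integral_eq_lintegral_ofReal hi (.of_forall fun x => he.pow_nonneg _),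
    ← ENNReal.ofReal_natCast n, ← ENNReal.rpow_natCast,
    lintegral_enorm_eq_eLpNorm (by positivity)]
  refine lintegral_congr fun x => ?_
  rw [ENNReal.rpow_natCast, ← he.pow_abs, ENNReal.ofReal_pow (abs_nonneg _),
    Real.enorm_eq_ofReal_abs]

namespace HardyDecay

variable {G : ℂ → ℂ}

lemma eLpNorm_re_two (h : HardyDecay G) :
    eLpNorm (fun x : ℝ => (G x).re) 2 = eLpNorm (fun x : ℝ => (G x).im) 2 := by
  have hre : Integrable fun x : ℝ => (G x).re ^ 2 :=
    h.integrable_of_abs_le 0 (h.continuous_re.pow 2) fun x => by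
      rw [abs_pow]; gcongr; exact Complex.abs_re_le_norm _
  have him : Integrable fun x : ℝ => (G x).im ^ 2 :=
    h.integrable_of_abs_le 0 (h.continuous_im.pow 2) fun x => by
      rw [abs_pow]; gcongr; exact Complex.abs_im_le_norm _
  have h1 := eLpNorm_natCast_pow two_ne_zero even_two hre
  have h2 := eLpNorm_natCast_pow two_ne_zero even_two him
  rw [h.integral_re_sq, ← h2] at h1
  exact (ENNReal.pow_right_strictMono two_ne_zero).injective (by exact_mod_cast h1)

lemma eLpNorm_re_four_le (h : HardyDecay G) :
    eLpNorm (fun x : ℝ => (G x).re) 4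
      ≤ ENNReal.ofReal (5 / 2) * eLpNorm (fun x : ℝ => (G x).im) 4 := by
  have hre : Integrable fun x : ℝ => (G x).re ^ 4 :=
    h.integrable_of_abs_le 2 (h.continuous_re.pow 4) fun x => by
      rw [abs_pow]; gcongr; exact Complex.abs_re_le_norm _
  have him : Integrable fun x : ℝ => (G x).im ^ 4 :=
    h.integrable_of_abs_le 2 (h.continuous_im.pow 4) fun x => by
      rw [abs_pow]; gcongr; exact Complex.abs_im_le_norm _
  have h4 : Even 4 := by decide
  have h1 := eLpNorm_natCast_pow four_ne_zero h4 hre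
  have h2 := eLpNorm_natCast_pow four_ne_zero h4 him
  have h3 : eLpNorm (fun x : ℝ => (G x).re) (4 : ℕ) ^ 4
      ≤ (ENNReal.ofReal (5 / 2) * eLpNorm (fun x : ℝ => (G x).im) (4 : ℕ)) ^ 4 := by
    rw [mul_pow, h1, h2, ← ENNReal.ofReal_pow (by norm_num), ← ENNReal.ofReal_mul (by positivity)]
    refine ENNReal.ofReal_le_ofReal (h.integral_re_pow_four_le.trans ?_)
    gcongr
    norm_num
  exact (ENNReal.pow_right_strictMono four_ne_zero).le_iff_le.1 (by exact_mod_cast h3)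

end HardyDecay

end Pavlov

namespace Pavlov

open ProbabilityTheory

/-- The Cauchy transform `∫ f(ζ) / (ζ - z) dζ`. -/
noncomputable def cauchyTransform (f : ℝ → ℝ) (z : ℂ) : ℂ := ∫ ζ : ℝ, (f ζ : ℂ) / (ζ - z)

/-- The Poisson kernel at height one (up to `1/π`). -/
noncomputable def poissonKernel (u : ℝ) : ℝ := (1 + u ^ 2)⁻¹

/-- The conjugate Poisson kernel at height one (up to `1/π`). -/
noncomputable def conjKernel (u : ℝ) : ℝ := u * (1 + u ^ 2)⁻¹

lemma abs_poissonKernel_le (u : ℝ) : |poissonKernel u| ≤ (1 + u ^ 2)⁻¹ :=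
  (abs_of_nonneg (by unfold poissonKernel; positivity)).le

@[fun_prop]
lemma measurable_poissonKernel : Measurable poissonKernel := by unfold poissonKernel; fun_prop

@[fun_prop]
lemma measurable_conjKernel : Measurable conjKernel := by unfold conjKernel; fun_prop

lemma memLp_conjKernel : MemLp conjKernel 2 := by
  rw [memLp_two_iff_integrable_sq measurable_conjKernel.aestronglyMeasurable]
  refine integrable_inv_one_add_sq.mono' (by fun_prop) (.of_forall fun u => ?_)
  rw [Real.norm_of_nonneg (sq_nonneg _), conjKernel, mul_pow, inv_pow, ← div_eq_mul_inv,
    div_le_iff₀ (by positivity), sq (1 + u ^ 2), ← mul_assoc, inv_mul_cancel₀ (by positivity)]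
  linarith

lemma integrable_mul_conjKernel {f : ℝ → ℝ} (hf : MemLp f 2) {ε : ℝ} (hε : ε ≠ 0) (l : ℝ) :
    Integrable fun u => f (l + ε * u) * conjKernel u :=
  (memLp_comp_affine hf hε l).integrable_mul memLp_conjKernel

lemma cauchyTransform_eq {f : ℝ → ℝ} (hf : MemLp f 2) {ε : ℝ} (hε : 0 < ε) (l : ℝ) :
    (1 / Real.pi : ℂ) * cauchyTransform f (l + ε * Complex.I)
      = kernelAvg conjKernel ε f l + kernelAvg poissonKernel ε f l * Complex.I := by
  have h1 : cauchyTransform f (l + ε * Complex.I)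
      = ∫ u : ℝ, ε • ((f (l + ε * u) : ℂ) / ((l + ε * u : ℝ) - (l + ε * Complex.I))) := by
    have e1 := integral_add_left_eq_self (μ := volume)
      (fun ζ : ℝ => (f ζ : ℂ) / (ζ - (l + ε * Complex.I))) l
    have e2 := Measure.integral_comp_mul_left
      (fun ζ : ℝ => (f (l + ζ) : ℂ) / ((l + ζ : ℝ) - (l + ε * Complex.I))) ε
    rw [cauchyTransform, ← e1, integral_smul, e2, smul_smul, abs_of_pos (by positivity),
      mul_inv_cancel₀ hε.ne', one_smul]
  have h2 : ∀ u : ℝ, ε • ((f (l + ε * u) : ℂ) / ((l + ε * u : ℝ) - (l + ε * Complex.I)))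
      = ((f (l + ε * u) * conjKernel u : ℝ) : ℂ)
        + ((f (l + ε * u) * poissonKernel u : ℝ) : ℂ) * Complex.I := by
    intro u
    have h3 : (ε : ℂ) ≠ 0 := by exact_mod_cast hε.ne'
    have h4 : (u : ℂ) - Complex.I ≠ 0 := fun h => by
      have := congrArg Complex.im h
      simp at this
    have h5 : (1 + (u : ℂ) ^ 2) ≠ 0 := by
      have : (1 + u ^ 2 : ℝ) ≠ 0 := by positivity
      exact_mod_cast this
    have h6 : ((l + ε * u : ℝ) : ℂ) - (l + ε * Complex.I) = ε * (u - Complex.I) := by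
      push_cast; ring
    rw [h6, conjKernel, poissonKernel, Complex.real_smul]
    push_cast
    field_simp
    ring_nf
    rw [Complex.I_sq]
    ring
  rw [h1]
  simp only [h2]
  rw [integral_add (integrable_mul_conjKernel hf hε.ne' l).ofReal
    ((integrable_mul_kernel measurable_poissonKernel abs_poissonKernel_le hf hε.ne' l).ofReal.mul_const _),
    integral_mul_const, integral_complex_ofReal, integral_complex_ofReal, kernelAvg, kernelAvg]
  push_cast
  ring

lemma norm_div_sub_le {ζ : ℝ} {z : ℂ} {δ : ℝ} (hδ : 0 < δ) (hz : δ ≤ z.im) (a : ℝ) :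
    ‖(a : ℂ) / (ζ - z)‖ ≤ |a| / δ := by
  rw [norm_div, Complex.norm_real, Real.norm_eq_abs]
  refine div_le_div_of_nonneg_left (abs_nonneg _) hδ (hz.trans ?_)
  have := Complex.abs_im_le_norm ((ζ : ℂ) - z)
  simp only [Complex.sub_im, Complex.ofReal_im, zero_sub, abs_neg] at this
  exact (le_abs_self _).trans this

lemma hasDerivAt_cauchyTransform {f : ℝ → ℝ} (hf : Integrable f) {z : ℂ} (hz : 0 < z.im) :
    ∃ d, HasDerivAt (cauchyTransform f) d z := by
  have hne : ∀ (ζ : ℝ) (w : ℂ), z.im / 2 < w.im → (ζ : ℂ) - w ≠ 0 := by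
    intro ζ w hw h
    have := congrArg Complex.im h
    simp at this
    linarith
  have hmeas : ∀ w : ℂ, AEStronglyMeasurable (fun ζ : ℝ => (f ζ : ℂ) / (ζ - w)) volume := by
    intro w
    have h1 : AEMeasurable (fun ζ : ℝ => (f ζ : ℂ)) volume :=
      Complex.measurable_ofReal.comp_aemeasurable hf.aemeasurable
    exact (h1.div (by fun_prop)).aestronglyMeasurable
  have hopen : {w : ℂ | z.im / 2 < w.im} ∈ 𝓝 z :=
    (isOpen_lt continuous_const Complex.continuous_im).mem_nhds (by simpa using hz)
  refine ⟨_, (hasDerivAt_integral_of_dominated_loc_of_deriv_le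
    (F := fun w ζ => (f ζ : ℂ) / (ζ - w)) (F' := fun w ζ => (f ζ : ℂ) / (ζ - w) ^ 2)
    (bound := fun ζ => |f ζ| / (z.im / 2) ^ 2) hopen (.of_forall hmeas) ?_ ?_ ?_ ?_ ?_).2⟩
  · exact (hf.abs.div_const z.im).mono' (hmeas z)
      (.of_forall fun ζ => norm_div_sub_le hz le_rfl (f ζ))
  · have h1 : AEMeasurable (fun ζ : ℝ => (f ζ : ℂ)) volume :=
      Complex.measurable_ofReal.comp_aemeasurable hf.aemeasurable
    exact (h1.div (by fun_prop)).aestronglyMeasurable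
  · refine .of_forall fun ζ w hw => ?_
    have h1 := norm_div_sub_le (ζ := ζ) (half_pos hz) (le_of_lt hw) 1
    rw [div_eq_mul_one_div, norm_mul, Complex.norm_real, Real.norm_eq_abs,
      div_eq_mul_one_div |f ζ|, ← one_div_pow, ← one_div_pow, norm_pow]
    gcongr
    simpa using h1
  · exact hf.abs.div_const _
  · refine .of_forall fun ζ w hw => ?_
    have h1 := ((hasDerivAt_id w).const_sub (ζ : ℂ)).inv (hne ζ w hw)
    have h2 := h1.const_mul (f ζ : ℂ)
    simp only [id, neg_neg, ← div_eq_mul_one_div] at h2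
    exact h2

lemma hardyDecay_cauchyTransform {f : ℝ → ℝ} (hf : Integrable f) {L : ℝ}
    (hL : ∀ ζ, L < |ζ| → f ζ = 0) {ε : ℝ} (hε : 0 < ε) :
    HardyDecay fun z => cauchyTransform f (z + ε * Complex.I) := by
  constructor
  · intro z hz
    have hz' : (0 : ℝ) < (z + ε * Complex.I).im := by
      simp only [Complex.add_im, Complex.mul_im, Complex.ofReal_re, Complex.I_im, mul_one,
        Complex.ofReal_im, Complex.I_re, mul_zero, add_zero]
      have : 0 ≤ z.im := hz
      linarith
    obtain ⟨d, hd⟩ := hasDerivAt_cauchyTransform hf hz'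
    exact (hd.comp_add_const z (ε * Complex.I)).differentiableAt.differentiableWithinAt
  · set c : ℝ := ε / (1 + 2 * ε + |L|) with hc
    have hc0 : 0 < c := by positivity
    refine ⟨(∫ ζ, |f ζ|) / c, fun z hz => ?_⟩
    have key : ∀ ζ : ℝ, ‖(f ζ : ℂ) / (ζ - (z + ε * Complex.I))‖
        ≤ |f ζ| * (1 / (c * (1 + ‖z‖))) := by
      intro ζ
      rcases lt_or_ge L |ζ| with h | h
      · simp [hL ζ h]
      rw [norm_div, Complex.norm_real, Real.norm_eq_abs, div_eq_mul_one_div]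
      refine mul_le_mul_of_nonneg_left (one_div_le_one_div_of_le (by positivity) ?_) (abs_nonneg _)
      set w : ℂ := (ζ : ℂ) - (z + ε * Complex.I) with hw
      have h1 : ε ≤ ‖w‖ := by
        have := Complex.abs_im_le_norm w
        simp only [hw, Complex.sub_im, Complex.ofReal_im, Complex.add_im, Complex.mul_im,
          Complex.ofReal_re, Complex.I_im, mul_one, Complex.I_re, mul_zero, add_zero, zero_sub,
          abs_neg] at this
        have h3 := le_abs_self (z.im + ε)
        have h4 : 0 ≤ z.im := hz
        linarith
      have h2 : ‖z‖ ≤ ‖w‖ + |L| + ε := by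
        have e : z = ζ - ε * Complex.I - w := by rw [hw]; ring
        have h5 : ‖(ζ : ℂ) - ε * Complex.I - w‖ ≤ ‖(ζ : ℂ)‖ + ‖ε * Complex.I‖ + ‖w‖ :=
          (norm_sub_le _ _).trans (by gcongr; exact norm_sub_le _ _)
        rw [← e] at h5
        simp only [Complex.norm_real, Real.norm_eq_abs, norm_mul, Complex.norm_I, mul_one,
          abs_of_pos hε] at h5
        have := h.trans (le_abs_self L)
        linarith
      rw [hc, div_mul_eq_mul_div, div_le_iff₀ (by positivity)]
      have h6 := mul_le_mul_of_nonneg_left h2 hε.le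
      have h7 := mul_le_mul_of_nonneg_right h1 (abs_nonneg L)
      have h8 := mul_le_mul_of_nonneg_right h1 hε.le
      linarith
    have h1 := norm_integral_le_of_norm_le (hf.abs.mul_const _) (.of_forall key)
    rw [integral_mul_const] at h1
    refine h1.trans (le_of_eq ?_)
    field_simp

section CompactSupport

variable {f : ℝ → ℝ} {L : ℝ}

lemma eq_zero_memLp_integrable (hf : MemLp f 2) (hL : ∀ ζ, L < |ζ| → f ζ = 0) : Integrable f := by
  have h1 : f = (Set.Icc (-L) L).indicator f := by
    ext ζ
    by_cases h : ζ ∈ Set.Icc (-L) L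
    · simp [h]
    · rw [Set.indicator_of_notMem h]
      refine hL ζ ?_
      by_contra h2
      exact h (abs_le.1 (not_lt.1 h2))
  rw [h1, integrable_indicator_iff measurableSet_Icc]
  have : IsFiniteMeasure (volume.restrict (Set.Icc (-L) L)) := ⟨by simp⟩
  exact (hf.restrict _).integrable one_le_two

lemma hardyDecay_of_support (hf : MemLp f 2) (hL : ∀ ζ, L < |ζ| → f ζ = 0) {ε : ℝ} (hε : 0 < ε) :
    HardyDecay fun z => (1 / Real.pi : ℂ) * cauchyTransform f (z + ε * Complex.I) :=
  (hardyDecay_cauchyTransform (eq_zero_memLp_integrable hf hL) hL hε).const_mul _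

lemma re_cauchyTransform (hf : MemLp f 2) {ε : ℝ} (hε : 0 < ε) (l : ℝ) :
    ((1 / Real.pi : ℂ) * cauchyTransform f (l + ε * Complex.I)).re = kernelAvg conjKernel ε f l := by
  rw [cauchyTransform_eq hf hε]
  simp

lemma im_cauchyTransform (hf : MemLp f 2) {ε : ℝ} (hε : 0 < ε) (l : ℝ) :
    ((1 / Real.pi : ℂ) * cauchyTransform f (l + ε * Complex.I)).im
      = kernelAvg poissonKernel ε f l := by
  rw [cauchyTransform_eq hf hε]
  simp

lemma eLpNorm_conj_two_of_support (hf : MemLp f 2) (hL : ∀ ζ, L < |ζ| → f ζ = 0) {ε : ℝ}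
    (hε : 0 < ε) :
    eLpNorm (kernelAvg conjKernel ε f) 2 = eLpNorm (kernelAvg poissonKernel ε f) 2 := by
  have := (hardyDecay_of_support hf hL hε).eLpNorm_re_two
  simpa only [re_cauchyTransform hf hε, im_cauchyTransform hf hε] using this

lemma eLpNorm_conj_four_of_support (hf : MemLp f 2) (hL : ∀ ζ, L < |ζ| → f ζ = 0) {ε : ℝ}
    (hε : 0 < ε) :
    eLpNorm (kernelAvg conjKernel ε f) 4
      ≤ ENNReal.ofReal (5 / 2) * eLpNorm (kernelAvg poissonKernel ε f) 4 := by
  have := (hardyDecay_of_support hf hL hε).eLpNorm_re_four_le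
  simpa only [re_cauchyTransform hf hε, im_cauchyTransform hf hε] using this

lemma eLpNorm_conj_sub_of_support (hf : MemLp f 2) (hL : ∀ ζ, L < |ζ| → f ζ = 0) {ε δ : ℝ}
    (hε : 0 < ε) (hδ : 0 < δ) :
    eLpNorm (fun l => kernelAvg conjKernel ε f l - kernelAvg conjKernel δ f l) 2
      = eLpNorm (fun l => kernelAvg poissonKernel ε f l - kernelAvg poissonKernel δ f l) 2 := by
  have := ((hardyDecay_of_support hf hL hε).sub (hardyDecay_of_support hf hL hδ)).eLpNorm_re_two
  simpa only [Complex.sub_re, Complex.sub_im, re_cauchyTransform hf hε, im_cauchyTransform hf hε,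
    re_cauchyTransform hf hδ, im_cauchyTransform hf hδ] using this

end CompactSupport

end Pavlov

namespace Pavlov

open ProbabilityTheory

lemma measurable_kernelAvg {k f : ℝ → ℝ} (hk : Measurable k) (hf : Measurable f) (ε : ℝ) :
    Measurable (kernelAvg k ε f) := by
  have h : StronglyMeasurable fun q : ℝ × ℝ => f (q.1 + ε * q.2) * k q.2 :=
    Measurable.stronglyMeasurable (by fun_prop)
  exact (h.integral_prod_right').measurable.const_mul _

lemma kernelAvg_congr {k f g : ℝ → ℝ} (hfg : f =ᵐ[volume] g) {ε : ℝ} (hε : ε ≠ 0) :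
    kernelAvg k ε f = kernelAvg k ε g := by
  ext l
  unfold kernelAvg
  congr 1
  refine integral_congr_ae ?_
  have hq : Measure.QuasiMeasurePreserving (fun u : ℝ => l + ε * u) volume volume := by
    refine (measurePreserving_add_left volume l).quasiMeasurePreserving.comp
      ⟨by fun_prop, ?_⟩
    rw [Real.map_volume_mul_left hε]
    exact Measure.smul_absolutelyContinuous
  filter_upwards [hq.ae_eq_comp hfg] with u hu
  simp only [Function.comp_apply] at hu
  rw [hu]

lemma kernelAvg_add {k f g : ℝ → ℝ} (hk : MemLp k 2) (hf : MemLp f 2) (hg : MemLp g 2) {ε : ℝ}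
    (hε : ε ≠ 0) : kernelAvg k ε (f + g) = kernelAvg k ε f + kernelAvg k ε g := by
  ext l
  have h1 : Integrable fun u => f (l + ε * u) * k u := (memLp_comp_affine hf hε l).integrable_mul hk
  have h2 : Integrable fun u => g (l + ε * u) * k u := (memLp_comp_affine hg hε l).integrable_mul hk
  simp only [kernelAvg, Pi.add_apply, add_mul]
  rw [integral_add h1 h2, mul_add]

lemma kernelAvg_smul (k f : ℝ → ℝ) (ε c : ℝ) :
    kernelAvg k ε (c • f) = c • kernelAvg k ε f := by
  ext l
  simp only [kernelAvg, Pi.smul_apply, smul_eq_mul, mul_assoc, integral_const_mul]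
  ring

lemma kernelAvg_translate (k f : ℝ → ℝ) (ε h : ℝ) :
    kernelAvg k ε (fun l => f (l + h)) = fun l => kernelAvg k ε f (l + h) := by
  ext l
  simp only [kernelAvg]
  congr 2
  ext u
  congr 2
  ring

/-- The truncation of `f` to `[-n, n]`. -/
noncomputable def trunc (n : ℕ) (f : ℝ → ℝ) : ℝ → ℝ := {ζ : ℝ | |ζ| ≤ (n : ℝ)}.indicator f

lemma measurableSet_abs_le (n : ℕ) : MeasurableSet {ζ : ℝ | |ζ| ≤ n} :=
  measurableSet_le (by fun_prop) measurable_const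

lemma norm_trunc_le (n : ℕ) (f : ℝ → ℝ) (ζ : ℝ) : ‖trunc n f ζ‖ ≤ ‖f ζ‖ :=
  norm_indicator_le_norm_self _ _

lemma memLp_trunc {f : ℝ → ℝ} (hf : MemLp f 2) (n : ℕ) : MemLp (trunc n f) 2 :=
  hf.indicator (measurableSet_abs_le n)

lemma measurable_trunc {f : ℝ → ℝ} (hf : Measurable f) (n : ℕ) : Measurable (trunc n f) :=
  hf.indicator (measurableSet_abs_le n)

lemma trunc_eq_zero (n : ℕ) (f : ℝ → ℝ) (ζ : ℝ) (h : (n : ℝ) < |ζ|) : trunc n f ζ = 0 :=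
  Set.indicator_of_notMem (by simpa using h) _

lemma eLpNorm_trunc_le (n : ℕ) (f : ℝ → ℝ) (p : ℝ≥0∞) : eLpNorm (trunc n f) p ≤ eLpNorm f p :=
  eLpNorm_mono (norm_trunc_le n f)

lemma tendsto_trunc (f : ℝ → ℝ) (ζ : ℝ) : Tendsto (fun n => trunc n f ζ) atTop (𝓝 (f ζ)) := by
  refine tendsto_const_nhds.congr' ?_
  obtain ⟨N, hN⟩ := exists_nat_ge |ζ|
  filter_upwards [eventually_ge_atTop N] with n hn
  rw [trunc, Set.indicator_of_mem]
  exact hN.trans (by exact_mod_cast hn)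

lemma tendsto_kernelAvg_trunc {k f : ℝ → ℝ} (hkm : Measurable k) (hk : MemLp k 2)
    (hfm : Measurable f) (hf : MemLp f 2) {ε : ℝ} (hε : ε ≠ 0) (l : ℝ) :
    Tendsto (fun n => kernelAvg k ε (trunc n f) l) atTop (𝓝 (kernelAvg k ε f l)) := by
  refine Tendsto.const_mul _ (tendsto_integral_of_dominated_convergence
    (fun u => ‖f (l + ε * u) * k u‖) ?_ ?_ ?_ ?_)
  · intro n
    have := measurable_trunc hfm n
    exact Measurable.aestronglyMeasurable (by fun_prop)
  · exact ((memLp_comp_affine hf hε l).integrable_mul hk).norm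
  · intro n
    refine .of_forall fun u => ?_
    rw [norm_mul, norm_mul]
    gcongr
    exact norm_trunc_le n f _
  · exact .of_forall fun u => (tendsto_trunc f _).mul_const _

lemma eLpNorm_conj_le_of_trunc {f : ℝ → ℝ} (hfm : Measurable f) (hf : MemLp f 2) {ε : ℝ}
    (hε : 0 < ε) {p B : ℝ≥0∞}
    (h : ∀ n, eLpNorm (kernelAvg conjKernel ε (trunc n f)) p ≤ B) :
    eLpNorm (kernelAvg conjKernel ε f) p ≤ B := by
  refine (Lp.eLpNorm_lim_le_liminf_eLpNorm (f := fun n => kernelAvg conjKernel ε (trunc n f))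
    (fun n => (measurable_kernelAvg measurable_conjKernel
      (measurable_trunc hfm n) ε).aestronglyMeasurable) _ (.of_forall fun l =>
    tendsto_kernelAvg_trunc measurable_conjKernel memLp_conjKernel hfm hf hε.ne' l)).trans ?_
  exact liminf_le_of_le (by isBoundedDefault) fun b hb => by
    obtain ⟨n, hn⟩ := hb.exists
    exact hn.trans (h n)

lemma eLpNorm_conj_two_le {f : ℝ → ℝ} (hfm : Measurable f) (hf : MemLp f 2) {ε : ℝ}
    (hε : 0 < ε) : eLpNorm (kernelAvg conjKernel ε f) 2 ≤ eLpNorm f 2 := by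
  refine eLpNorm_conj_le_of_trunc hfm hf hε fun n => ?_
  rw [eLpNorm_conj_two_of_support (memLp_trunc hf n) (trunc_eq_zero n f) hε]
  have := eLpNorm_kernelAvg_le abs_poissonKernel_le (measurable_trunc hfm n) ε one_le_two
  rw [ENNReal.ofReal_ofNat] at this
  exact this.trans (eLpNorm_trunc_le n f 2)

lemma eLpNorm_conj_four_le {f : ℝ → ℝ} (hfm : Measurable f) (hf : MemLp f 2) {ε : ℝ}
    (hε : 0 < ε) :
    eLpNorm (kernelAvg conjKernel ε f) 4 ≤ ENNReal.ofReal (5 / 2) * eLpNorm f 4 := by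
  refine eLpNorm_conj_le_of_trunc hfm hf hε fun n => ?_
  refine (eLpNorm_conj_four_of_support (memLp_trunc hf n) (trunc_eq_zero n f) hε).trans ?_
  have := eLpNorm_kernelAvg_le abs_poissonKernel_le (measurable_trunc hfm n) ε
    (p := 4) (by norm_num)
  rw [ENNReal.ofReal_ofNat] at this
  gcongr
  exact this.trans (eLpNorm_trunc_le n f 4)

lemma memLp_kernelAvg {k : ℝ → ℝ} (hkm : Measurable k) {ε : ℝ}
    (hb : ∀ f, Measurable f → MemLp f 2 → eLpNorm (kernelAvg k ε f) 2 ≤ eLpNorm f 2) (f : L2) :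
    MemLp (kernelAvg k ε f) 2 :=
  ⟨(measurable_kernelAvg hkm (Lp.stronglyMeasurable f).measurable ε).aestronglyMeasurable,
    (hb _ (Lp.stronglyMeasurable f).measurable (Lp.memLp f)).trans_lt (Lp.memLp f).2⟩

/-- A contractive averaging operator as an operator on `L²`. -/
noncomputable def kernelOp (k : ℝ → ℝ) (hkm : Measurable k) (hk : MemLp k 2) {ε : ℝ} (hε : ε ≠ 0)
    (hb : ∀ f, Measurable f → MemLp f 2 → eLpNorm (kernelAvg k ε f) 2 ≤ eLpNorm f 2) :
    L2 →L[ℝ] L2 :=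
  LinearMap.mkContinuous
    { toFun := fun f => (memLp_kernelAvg hkm hb f).toLp _
      map_add' := fun f g => by
        rw [← MemLp.toLp_add, MemLp.toLp_eq_toLp_iff, kernelAvg_congr (Lp.coeFn_add f g) hε,
          kernelAvg_add hk (Lp.memLp f) (Lp.memLp g) hε]
      map_smul' := fun c f => by
        rw [RingHom.id_apply, ← MemLp.toLp_const_smul, MemLp.toLp_eq_toLp_iff,
          kernelAvg_congr (Lp.coeFn_smul c f) hε, kernelAvg_smul] }
    1 fun f => by
      simp only [LinearMap.coe_mk, AddHom.coe_mk, one_mul]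
      rw [Lp.norm_toLp, Lp.norm_def]
      exact ENNReal.toReal_mono (Lp.memLp f).2.ne
        (hb _ (Lp.stronglyMeasurable f).measurable (Lp.memLp f))

lemma coeFn_kernelOp {k : ℝ → ℝ} (hkm : Measurable k) (hk : MemLp k 2) {ε : ℝ} (hε : ε ≠ 0)
    (hb : ∀ f, Measurable f → MemLp f 2 → eLpNorm (kernelAvg k ε f) 2 ≤ eLpNorm f 2) (f : L2) :
    kernelOp k hkm hk hε hb f =ᵐ[volume] kernelAvg k ε f :=
  MemLp.coeFn_toLp (memLp_kernelAvg hkm hb f)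

/-- The conjugate Poisson operator at height `ε > 0`. -/
noncomputable def conjOp (ε : ℝ) (hε : 0 < ε) : L2 →L[ℝ] L2 :=
  kernelOp conjKernel measurable_conjKernel memLp_conjKernel hε.ne'
    fun _ hfm hf => eLpNorm_conj_two_le hfm hf hε

/-- The Poisson operator at height `ε > 0`. -/
noncomputable def poissonOp (ε : ℝ) (hε : 0 < ε) : L2 →L[ℝ] L2 :=
  kernelOp poissonKernel measurable_poissonKernel
    (memLp_kernel measurable_poissonKernel abs_poissonKernel_le) hε.ne'
    fun f hfm _ => by
      have := eLpNorm_kernelAvg_le abs_poissonKernel_le hfm ε one_le_two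
      rwa [ENNReal.ofReal_ofNat] at this

lemma coeFn_conjOp {ε : ℝ} (hε : 0 < ε) (f : L2) :
    conjOp ε hε f =ᵐ[volume] kernelAvg conjKernel ε f := coeFn_kernelOp ..

lemma coeFn_poissonOp {ε : ℝ} (hε : 0 < ε) (f : L2) :
    poissonOp ε hε f =ᵐ[volume] kernelAvg poissonKernel ε f := coeFn_kernelOp ..

lemma norm_conjOp_le {ε : ℝ} (hε : 0 < ε) (f : L2) : ‖conjOp ε hε f‖ ≤ ‖f‖ := by
  rw [Lp.norm_def, Lp.norm_def, eLpNorm_congr_ae (coeFn_conjOp hε f)]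
  exact ENNReal.toReal_mono (Lp.memLp f).2.ne
    (eLpNorm_conj_two_le (Lp.stronglyMeasurable f).measurable (Lp.memLp f) hε)

lemma dense_support : Dense {f : L2 | ∃ L, ∃ g : ℝ → ℝ, f =ᵐ[volume] g ∧ ∀ ζ, L < |ζ| → g ζ = 0} := by
  rw [Metric.dense_iff]
  intro f r hr
  obtain ⟨g, hg, hle, -, hg2⟩ := (Lp.memLp f).exists_hasCompactSupport_eLpNorm_sub_le (by simp)
    (ε := ENNReal.ofReal (r / 2)) (by simpa using hr)
  refine ⟨hg2.toLp g, ?_, ?_⟩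
  · rw [Metric.mem_ball, dist_comm, dist_edist, Lp.edist_def,
      eLpNorm_congr_ae (Filter.EventuallyEq.sub (ae_eq_refl _) hg2.coeFn_toLp)]
    refine (ENNReal.toReal_mono (by simp) hle).trans_lt ?_
    rw [ENNReal.toReal_ofReal (by positivity)]
    linarith
  · obtain ⟨L, hL⟩ := hg.isCompact.isBounded.subset_closedBall 0
    refine ⟨L, g, hg2.coeFn_toLp, fun ζ hζ => ?_⟩
    by_contra h
    have := hL (subset_tsupport g h)
    simp only [Metric.mem_closedBall, dist_zero_right, Real.norm_eq_abs] at this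
    linarith

lemma norm_conjOp_sub_le {ε δ : ℝ} (hε : 0 < ε) (hδ : 0 < δ) (f : L2) :
    ‖conjOp ε hε f - conjOp δ hδ f‖ ≤ ‖poissonOp ε hε f - poissonOp δ hδ f‖ := by
  refine dense_support.induction (P := fun f => ‖conjOp ε hε f - conjOp δ hδ f‖ ≤
    ‖poissonOp ε hε f - poissonOp δ hδ f‖) ?_ (isClosed_le (by fun_prop) (by fun_prop)) f
  rintro f ⟨L, g, hfg, hL⟩
  have hg : MemLp g 2 := (Lp.memLp f).ae_eq hfg
  have h1 : ∀ x y : L2, ‖x - y‖ = (eLpNorm (fun l => x l - y l) 2).toReal := fun x y => by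
    rw [Lp.norm_def, eLpNorm_congr_ae (Lp.coeFn_sub x y)]; rfl
  rw [h1, h1]
  have e1 := (coeFn_conjOp hε f).sub (coeFn_conjOp hδ f)
  have e2 := (coeFn_poissonOp hε f).sub (coeFn_poissonOp hδ f)
  simp only [kernelAvg_congr hfg hε.ne', kernelAvg_congr hfg hδ.ne'] at e1 e2
  have e3 : eLpNorm (fun l => conjOp ε hε f l - conjOp δ hδ f l) 2 = _ := eLpNorm_congr_ae e1
  have e4 : eLpNorm (fun l => poissonOp ε hε f l - poissonOp δ hδ f l) 2 = _ := eLpNorm_congr_ae e2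
  rw [e3, e4]
  exact (congrArg _ (eLpNorm_conj_sub_of_support hg hL hε hδ)).le

lemma tendsto_poissonOp (f : L2) :
    Tendsto (fun n : ℕ => poissonOp (1 / ((n : ℝ) + 1)) (by positivity) f) atTop (𝓝 f) := by
  have h1 := tendsto_eLpNorm_kernelAvg_sub measurable_poissonKernel abs_poissonKernel_le
    (Lp.stronglyMeasurable f).measurable (Lp.memLp f)
  have h2 : Tendsto (fun n : ℕ => 1 / ((n : ℝ) + 1)) atTop (𝓝[≠] 0) :=
    tendsto_nhdsWithin_iff.2 ⟨tendsto_one_div_add_atTop_nhds_zero_nat,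
      .of_forall fun n => by simp only [Set.mem_compl_iff, Set.mem_singleton_iff]; positivity⟩
  have h3 := h1.comp h2
  rw [tendsto_iff_edist_tendsto_0]
  refine h3.congr fun n => ?_
  rw [Lp.edist_def, Function.comp_apply]
  refine eLpNorm_congr_ae ?_
  filter_upwards [coeFn_poissonOp (ε := 1 / ((n : ℝ) + 1)) (by positivity) f] with l hl
  have : ∫ u, poissonKernel u = Real.pi := integral_univ_inv_one_add_sq
  rw [Pi.sub_apply, hl, this, one_div_mul_cancel Real.pi_ne_zero, one_mul]

lemma cauchySeq_conjOp (f : L2) :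
    CauchySeq fun n : ℕ => conjOp (1 / ((n : ℝ) + 1)) (by positivity) f := by
  have h := (tendsto_poissonOp f).cauchySeq
  rw [Metric.cauchySeq_iff] at h ⊢
  intro r hr
  obtain ⟨N, hN⟩ := h r hr
  refine ⟨N, fun m hm n hn => ?_⟩
  rw [dist_eq_norm]
  refine (norm_conjOp_sub_le _ _ f).trans_lt ?_
  rw [← dist_eq_norm]
  exact hN m hm n hn

/-- The Hilbert transform on `L²(ℝ)`, with kernel `1 / (π (ζ - λ))`. -/
noncomputable def hilbert : L2 →L[ℝ] L2 :=
  continuousLinearMapOfTendsto (fun n : ℕ => conjOp (1 / ((n : ℝ) + 1)) (by positivity))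
    (f := fun f => (cauchySeq_tendsto_of_complete (cauchySeq_conjOp f)).choose)
    (tendsto_pi_nhds.2 fun f => (cauchySeq_tendsto_of_complete (cauchySeq_conjOp f)).choose_spec)

lemma tendsto_conjOp (f : L2) :
    Tendsto (fun n : ℕ => conjOp (1 / ((n : ℝ) + 1)) (by positivity) f) atTop (𝓝 (hilbert f)) :=
  (cauchySeq_tendsto_of_complete (cauchySeq_conjOp f)).choose_spec

lemma norm_hilbert_le (f : L2) : ‖hilbert f‖ ≤ ‖f‖ :=
  le_of_tendsto (tendsto_conjOp f).norm (.of_forall fun _ => norm_conjOp_le _ f)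

lemma exists_subseq_tendsto_ae {u : ℕ → L2} {v : L2} (h : Tendsto u atTop (𝓝 v)) :
    ∃ ns : ℕ → ℕ, StrictMono ns ∧ ∀ᵐ l, Tendsto (fun i => u (ns i) l) atTop (𝓝 (v l)) :=
  (tendstoInMeasure_of_tendsto_Lp h).exists_seq_tendsto_ae

lemma eLpNorm_le_of_tendsto {u : ℕ → L2} {v : L2} (h : Tendsto u atTop (𝓝 v)) {p B : ℝ≥0∞}
    (hB : ∀ n, eLpNorm (u n) p ≤ B) : eLpNorm v p ≤ B := by
  obtain ⟨ns, -, hns⟩ := exists_subseq_tendsto_ae h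
  refine (Lp.eLpNorm_lim_le_liminf_eLpNorm (f := fun i => u (ns i))
    (fun i => (Lp.aestronglyMeasurable _)) _ hns).trans ?_
  exact liminf_le_of_le (by isBoundedDefault) fun b hb => by
    obtain ⟨n, hn⟩ := hb.exists
    exact hn.trans (hB _)

lemma eLpNorm_hilbert_four_le (f : L2) :
    eLpNorm (hilbert f) 4 ≤ ENNReal.ofReal (5 / 2) * eLpNorm f 4 := by
  refine eLpNorm_le_of_tendsto (tendsto_conjOp f) fun n => ?_
  rw [eLpNorm_congr_ae (coeFn_conjOp _ f)]
  exact eLpNorm_conj_four_le (Lp.stronglyMeasurable f).measurable (Lp.memLp f) (by positivity)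

lemma measurePreserving_add (h : ℝ) :
    MeasurePreserving (fun l : ℝ => l + h) volume volume := measurePreserving_add_right volume h

/-- Translation on `L²`. -/
noncomputable def translate (h : ℝ) : L2 →ₗᵢ[ℝ] L2 :=
  Lp.compMeasurePreservingₗᵢ ℝ (fun l : ℝ => l + h) (measurePreserving_add h)

lemma coeFn_translate (h : ℝ) (f : L2) : translate h f =ᵐ[volume] fun l => f (l + h) :=
  Lp.coeFn_compMeasurePreserving f (measurePreserving_add h)

lemma conjOp_translate {ε : ℝ} (hε : 0 < ε) (h : ℝ) (f : L2) :
    conjOp ε hε (translate h f) = translate h (conjOp ε hε f) := by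
  refine Lp.ext ?_
  filter_upwards [coeFn_conjOp hε (translate h f), coeFn_translate h (conjOp ε hε f),
    (measurePreserving_add h).quasiMeasurePreserving.ae_eq_comp (coeFn_conjOp hε f)]
    with l h1 h2 h3
  simp only [Function.comp_apply] at h3
  rw [h1, h2, h3, kernelAvg_congr (coeFn_translate h f) hε.ne', kernelAvg_translate]

lemma hilbert_translate (h : ℝ) (f : L2) : hilbert (translate h f) = translate h (hilbert f) := by
  refine tendsto_nhds_unique (tendsto_conjOp (translate h f)) ?_
  have := ((translate h).continuous.tendsto _).comp (tendsto_conjOp f)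
  refine this.congr fun n => ?_
  rw [Function.comp_apply, conjOp_translate]

end Pavlov

namespace Pavlov

open ProbabilityTheory

lemma HasPrincipalValue.congr {f g : ℝ → ℝ} (hfg : f =ᵐ[volume] g) {l p : ℝ}
    (h : HasPrincipalValue f l p) : HasPrincipalValue g l p := by
  have e : (fun ζ => f ζ / (ζ - l)) =ᵐ[volume] fun ζ => g ζ / (ζ - l) := by
    filter_upwards [hfg] with ζ hζ
    rw [hζ]
  refine ⟨fun ε hε => (integrableOn_congr_fun_ae (ae_restrict_of_ae e)).1 (h.1 ε hε), ?_⟩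
  refine h.2.congr fun ε => ?_
  exact integral_congr_ae (ae_restrict_of_ae e)

/-- The kernel of the truncated Hilbert transform at scale one. -/
noncomputable def truncKernel : ℝ → ℝ := {u : ℝ | 1 < |u|}.indicator fun u => u⁻¹

/-- The difference between the conjugate Poisson kernel and the truncated kernel. -/
noncomputable def diffKernel (u : ℝ) : ℝ := conjKernel u - truncKernel u

lemma measurableSet_lt_abs (ε : ℝ) : MeasurableSet {u : ℝ | ε < |u|} :=
  measurableSet_lt measurable_const (by fun_prop)

lemma measurable_truncKernel : Measurable truncKernel :=
  measurable_inv.indicator (measurableSet_lt_abs 1)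

lemma measurable_diffKernel : Measurable diffKernel :=
  measurable_conjKernel.sub measurable_truncKernel

lemma abs_diffKernel_le (u : ℝ) : |diffKernel u| ≤ (1 + u ^ 2)⁻¹ := by
  have hpos : 0 < 1 + u ^ 2 := by positivity
  by_cases h : 1 < |u|
  · have hu : u ≠ 0 := by rintro rfl; simp at h; linarith
    have h1 : diffKernel u = -(u⁻¹ * (1 + u ^ 2)⁻¹) := by
      rw [diffKernel, truncKernel, Set.indicator_of_mem (by exact h), conjKernel]
      field_simp
      ring
    rw [h1, abs_neg, abs_mul, abs_inv, abs_of_pos (inv_pos.2 hpos)]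
    exact mul_le_of_le_one_left (by positivity) (inv_le_one_of_one_le₀ h.le)
  · rw [diffKernel, truncKernel, Set.indicator_of_notMem (by exact h), sub_zero, conjKernel,
      abs_mul, abs_of_pos (inv_pos.2 hpos)]
    exact mul_le_of_le_one_left (by positivity) (not_lt.1 h)

lemma integral_eq_zero_of_odd {φ : ℝ → ℝ} (h : ∀ u, φ (-u) = -φ u) : ∫ u, φ u = 0 := by
  have h1 := integral_neg_eq_self φ volume
  simp only [h, integral_neg] at h1
  linarith

lemma diffKernel_neg (u : ℝ) : diffKernel (-u) = -diffKernel u := by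
  simp only [diffKernel, truncKernel, conjKernel, Set.indicator, Set.mem_ofPred_eq, abs_neg, neg_sq]
  split_ifs <;> ring

lemma memLp_truncKernel : MemLp truncKernel 2 := by
  have h := memLp_conjKernel.sub (memLp_kernel measurable_diffKernel abs_diffKernel_le)
  have e : truncKernel = conjKernel - diffKernel := by
    ext u; simp [diffKernel]
  rwa [e]

lemma preimage_truncation {ε : ℝ} (l : ℝ) (φ : ℝ → ℝ) :
    ∫ ζ in {ζ | ε < |ζ - l|}, φ (ζ - l) = ∫ u in {u | ε < |u|}, φ u := by
  have hm : MeasurableSet {ζ : ℝ | ε < |ζ - l|} :=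
    measurableSet_lt measurable_const (by fun_prop)
  rw [← integral_indicator hm, ← integral_indicator (measurableSet_lt_abs ε),
    ← integral_sub_right_eq_self ({u | ε < |u|}.indicator φ) l]
  rfl

lemma truncated_eq_kernelAvg (f : ℝ → ℝ) {ε : ℝ} (hε : 0 < ε) (l : ℝ) :
    ∫ ζ in {ζ | ε < |ζ - l|}, f ζ / (ζ - l) = Real.pi * kernelAvg truncKernel ε f l := by
  have h1 := preimage_truncation (ε := ε) l (fun u => f (l + u) / u)
  simp only [add_sub_cancel] at h1
  rw [h1, kernelAvg, ← mul_assoc, mul_one_div_cancel Real.pi_ne_zero, one_mul,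
    ← integral_indicator (measurableSet_lt_abs ε)]
  have h2 := Measure.integral_comp_mul_left
    ({u : ℝ | ε < |u|}.indicator fun u => f (l + u) / u) ε
  rw [abs_of_pos (inv_pos.2 hε), smul_eq_mul] at h2
  have h3 : ∫ u, f (l + ε * u) * truncKernel u
      = ε * ∫ u, ({u : ℝ | ε < |u|}.indicator fun u => f (l + u) / u) (ε * u) := by
    rw [← integral_const_mul]
    congr 1
    ext u
    have h4 : ε < |ε * u| ↔ 1 < |u| := by
      rw [abs_mul, abs_of_pos hε, lt_mul_iff_one_lt_right hε]
    simp only [truncKernel, Set.indicator, Set.mem_ofPred_eq, h4]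
    split_ifs
    · field_simp
    · simp
  rw [h3, h2, ← mul_assoc, mul_inv_cancel₀ hε.ne', one_mul]

lemma integrableOn_truncated {f : ℝ → ℝ} (hf : MemLp f 2) {ε : ℝ} (hε : 0 < ε) (l : ℝ) :
    IntegrableOn (fun ζ => f ζ / (ζ - l)) {ζ | ε < |ζ - l|} := by
  have hm : MeasurableSet {ζ : ℝ | ε < |ζ - l|} :=
    measurableSet_lt measurable_const (by fun_prop)
  rw [← integrable_indicator_iff hm]
  have h1 : MemLp (fun ζ => truncKernel (-(l / ε) + ε⁻¹ * ζ)) 2 :=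
    memLp_comp_affine memLp_truncKernel (inv_ne_zero hε.ne') _
  refine ((hf.integrable_mul h1).const_mul ε⁻¹).congr (.of_forall fun ζ => ?_)
  have e : -(l / ε) + ε⁻¹ * ζ = ε⁻¹ * (ζ - l) := by field_simp; ring
  have h4 : 1 < |ε⁻¹ * (ζ - l)| ↔ ε < |ζ - l| := by
    rw [abs_mul, abs_of_pos (inv_pos.2 hε), inv_mul_eq_div, one_lt_div hε]
  simp only [Pi.mul_apply, e, truncKernel, Set.indicator, Set.mem_ofPred_eq, h4]
  split_ifs
  · rw [mul_inv, inv_inv]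
    field_simp
  · simp

lemma kernelAvg_diff {f : ℝ → ℝ} (hf : MemLp f 2) {ε : ℝ} (hε : ε ≠ 0) (l : ℝ) :
    kernelAvg diffKernel ε f l = kernelAvg conjKernel ε f l - kernelAvg truncKernel ε f l := by
  have h1 : Integrable fun u => f (l + ε * u) * truncKernel u :=
    (memLp_comp_affine hf hε l).integrable_mul memLp_truncKernel
  simp only [kernelAvg, diffKernel, mul_sub]
  rw [integral_sub (integrable_mul_conjKernel hf hε l) h1, mul_sub]

lemma tendsto_seq_punctured :
    Tendsto (fun n : ℕ => 1 / ((n : ℝ) + 1)) atTop (𝓝[>] 0) :=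
  tendsto_nhdsWithin_iff.2 ⟨tendsto_one_div_add_atTop_nhds_zero_nat,
    .of_forall fun n => by simp only [Set.mem_Ioi]; positivity⟩

/-- Wherever the principal value exists, it is given by the Hilbert transform. -/
lemma principalValue_eq_hilbert (f : L2) :
    ∀ᵐ l, ∀ p, HasPrincipalValue f l p → p = Real.pi * hilbert f l := by
  have hfm := (Lp.stronglyMeasurable f).measurable
  have h1 : Tendsto (fun n : ℕ => eLpNorm (kernelAvg diffKernel (1 / ((n : ℝ) + 1)) f) 2) atTop
      (𝓝 0) := by
    have := (tendsto_eLpNorm_kernelAvg_sub measurable_diffKernel abs_diffKernel_le hfm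
      (Lp.memLp f)).comp (tendsto_seq_punctured.mono_right
        (nhdsWithin_mono _ fun x (hx : 0 < x) => hx.ne'))
    simpa [Function.comp_def, integral_eq_zero_of_odd diffKernel_neg] using this
  have h2 := (tendstoInMeasure_of_tendsto_eLpNorm (g := (0 : ℝ → ℝ)) two_ne_zero
    (fun n : ℕ => (measurable_kernelAvg measurable_diffKernel hfm
      (1 / ((n : ℝ) + 1))).aestronglyMeasurable) aestronglyMeasurable_zero
    (by simpa using h1)).exists_seq_tendsto_ae
  obtain ⟨ns, hns, h2⟩ := h2
  obtain ⟨ms, hms, h3⟩ := exists_subseq_tendsto_ae ((tendsto_conjOp f).comp hns.tendsto_atTop)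
  have h4 : ∀ᵐ l, ∀ n : ℕ, conjOp (1 / ((n : ℝ) + 1)) (by positivity) f l
      = kernelAvg conjKernel (1 / ((n : ℝ) + 1)) f l := ae_all_iff.2 fun n => coeFn_conjOp _ f
  filter_upwards [h2, h3, h4] with l h2 h3 h4 p hp
  have h5 := h3.sub (h2.comp hms.tendsto_atTop)
  simp only [Function.comp_apply, h4, Pi.zero_apply, sub_zero] at h5
  have h6 := (hp.2.comp (tendsto_seq_punctured.comp hns.tendsto_atTop)).comp hms.tendsto_atTop
  refine tendsto_nhds_unique h6 ((h5.const_mul Real.pi).congr fun n => ?_)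
  simp only [Function.comp_apply]
  rw [truncated_eq_kernelAvg _ (by positivity), kernelAvg_diff (Lp.memLp f) (by positivity)]
  ring

lemma modulus_eq (f : L2) (h : ℝ) : modulus f h = ‖translate h f - f‖ₑ := by
  rw [Lp.enorm_def, modulus]
  refine eLpNorm_congr_ae ?_
  filter_upwards [coeFn_translate h f, Lp.coeFn_sub (translate h f) f] with l h1 h2
  rw [h2, Pi.sub_apply, h1]

/-- `f` has a Lipschitz modulus of continuity in `L²`. -/
def L2Lipschitz (C : ℝ) (f : L2) : Prop := ∀ h, |h| ≤ 1 → ‖translate h f - f‖ ≤ C * |h|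

lemma integrable_oscillation {C : ℝ} {f : L2} (hf : L2Lipschitz C f) :
    ∀ᵐ l, IntegrableOn (fun u => (f (l + u) - f l) / u) {u : ℝ | |u| ≤ 1} := by
  have hfm := (Lp.stronglyMeasurable f).measurable
  have hS : MeasurableSet {u : ℝ | |u| ≤ 1} := measurableSet_le (by fun_prop) measurable_const
  set μ := volume.restrict {u : ℝ | |u| ≤ 1} with hμ
  have hset : {u : ℝ | |u| ≤ 1} = Set.Icc (-1) 1 := by ext u; simp [abs_le]
  have hfin : IsFiniteMeasure μ := ⟨by rw [hμ, hset]; simp⟩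
  have hmeas : Measurable fun q : ℝ × ℝ => ‖(f (q.1 + q.2) - f q.1) / q.2‖ₑ ^ (2 : ℝ) := by fun_prop
  have h1 : ∫⁻ l, (∫⁻ u, ‖(f (l + u) - f l) / u‖ₑ ^ (2 : ℝ) ∂μ) ≠ ∞ := by
    rw [lintegral_lintegral_swap hmeas.aemeasurable]
    have h2 : ∀ᵐ u ∂μ, ∫⁻ l, ‖(f (l + u) - f l) / u‖ₑ ^ (2 : ℝ) ≤ ENNReal.ofReal C ^ (2 : ℝ) := by
      filter_upwards [ae_restrict_mem hS, ae_restrict_of_ae (Measure.ae_ne volume 0)] with u hu hu0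
      have h3 : ∀ l, ‖(f (l + u) - f l) / u‖ₑ ^ (2 : ℝ)
          = ‖u⁻¹‖ₑ ^ (2 : ℝ) * ‖f (l + u) - f l‖ₑ ^ (2 : ℝ) := fun l => by
        rw [← ENNReal.mul_rpow_of_nonneg _ _ two_pos.le, ← enorm_mul, div_eq_inv_mul]
      simp only [h3]
      rw [lintegral_const_mul' _ _ (ENNReal.rpow_ne_top_of_nonneg two_pos.le (by simp)),
        ← eLpNorm_two_rpow, ← ENNReal.mul_rpow_of_nonneg _ _ two_pos.le]
      refine ENNReal.rpow_le_rpow ?_ two_pos.le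
      have h4 := modulus_eq f u
      rw [modulus] at h4
      rw [h4, ← ofReal_norm, ← ofReal_norm, ← ENNReal.ofReal_mul (norm_nonneg _)]
      refine ENNReal.ofReal_le_ofReal ?_
      rw [norm_inv, Real.norm_eq_abs, inv_mul_le_iff₀ (abs_pos.2 hu0), mul_comm |u|]
      exact hf u hu
    refine ((lintegral_mono_ae h2).trans_lt ?_).ne
    rw [lintegral_const]
    exact ENNReal.mul_lt_top (ENNReal.rpow_lt_top_of_nonneg two_pos.le (by simp))
      (measure_lt_top _ _)
  have h5 := ae_lt_top' (hmeas.lintegral_prod_right').aemeasurable h1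
  filter_upwards [h5] with l hl
  have h6 : MemLp (fun u => (f (l + u) - f l) / u) 2 μ := by
    refine ⟨Measurable.aestronglyMeasurable (by fun_prop), ?_⟩
    rw [eLpNorm_eq_lintegral_rpow_enorm_toReal (by simp) (by simp)]
    exact ENNReal.rpow_lt_top_of_nonneg (by positivity) (by simpa using hl.ne)
  exact h6.integrable one_le_two

lemma exists_principalValue {C : ℝ} {f : L2} (hf : L2Lipschitz C f) :
    ∀ᵐ l, ∃ p, HasPrincipalValue f l p := by
  filter_upwards [integrable_oscillation hf] with l hl
  have hfm := (Lp.stronglyMeasurable f).measurable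
  have hS : MeasurableSet {u : ℝ | |u| ≤ 1} := measurableSet_le (by fun_prop) measurable_const
  set φ : ℝ → ℝ := fun u => (f (l + u) - {u : ℝ | |u| ≤ 1}.indicator (fun _ => f l) u) / u with hφ
  have hout : IntegrableOn (fun u => f (l + u) / u) {u | 1 < |u|} := by
    have h1 := integrableOn_truncated (f := fun u => f (l + u))
      ((Lp.memLp f).comp_measurePreserving (measurePreserving_add_left volume l)) one_pos 0
    simpa using h1
  have hφi : Integrable φ := by
    have hc : {u : ℝ | |u| ≤ 1}ᶜ = {u | 1 < |u|} := by ext u; simp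
    rw [← integrableOn_univ, ← Set.union_compl_self {u : ℝ | |u| ≤ 1}, integrableOn_union, hc]
    constructor
    · refine hl.congr_fun (fun u hu => ?_) hS
      simp only [hφ, Set.indicator_of_mem hu]
    · refine hout.congr_fun (fun u hu => ?_) (measurableSet_lt_abs 1)
      simp only [hφ]
      rw [Set.indicator_of_notMem (by simpa using hu), sub_zero]
  have key : ∀ ε : ℝ, 0 < ε → ∫ ζ in {ζ | ε < |ζ - l|}, f ζ / (ζ - l)
      = ∫ u, {u : ℝ | ε < |u|}.indicator φ u := by
    intro ε hε
    have h1 := preimage_truncation (ε := ε) l (fun u => f (l + u) / u)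
    simp only [add_sub_cancel] at h1
    have hi : IntegrableOn (fun u => f (l + u) / u) {u | ε < |u|} := by
      have h1 := integrableOn_truncated (f := fun u => f (l + u))
        ((Lp.memLp f).comp_measurePreserving (measurePreserving_add_left volume l)) hε 0
      simpa using h1
    rw [h1, integral_indicator (measurableSet_lt_abs ε)]
    have h2 : ∫ u in {u : ℝ | ε < |u|}, {u : ℝ | |u| ≤ 1}.indicator (fun _ => f l) u / u = 0 := by
      rw [← integral_indicator (measurableSet_lt_abs ε)]
      refine integral_eq_zero_of_odd fun u => ?_
      simp only [Set.indicator, Set.mem_ofPred_eq, abs_neg]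
      split_ifs <;> simp [div_neg]
    have h3 : IntegrableOn (fun u => {u : ℝ | |u| ≤ 1}.indicator (fun _ => f l) u / u)
        {u : ℝ | ε < |u|} := by
      have := hi.sub hφi.integrableOn
      refine this.congr_fun (fun u _ => ?_) (measurableSet_lt_abs ε)
      simp only [hφ, Pi.sub_apply]
      ring
    have h4 : ∀ u, φ u = f (l + u) / u - {u : ℝ | |u| ≤ 1}.indicator (fun _ => f l) u / u :=
      fun u => by simp only [hφ, sub_div]
    simp only [h4]
    rw [integral_sub hi h3, h2, sub_zero]
  refine ⟨∫ u, φ u, fun ε hε => integrableOn_truncated (Lp.memLp f) hε l, ?_⟩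
  have hlim : Tendsto (fun ε : ℝ => ∫ u, {u : ℝ | ε < |u|}.indicator φ u) (𝓝[>] 0)
      (𝓝 (∫ u, φ u)) := by
    refine tendsto_integral_filter_of_dominated_convergence (fun u => ‖φ u‖) ?_ ?_ hφi.norm ?_
    · exact .of_forall fun ε => hφi.1.indicator (measurableSet_lt_abs ε)
    · exact .of_forall fun ε => .of_forall fun u => norm_indicator_le_norm_self _ _
    · filter_upwards [Measure.ae_ne volume 0] with u hu
      refine tendsto_const_nhds.congr' ?_
      have : Set.Iio |u| ∈ 𝓝[>] (0 : ℝ) :=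
        mem_nhdsWithin_of_mem_nhds (Iio_mem_nhds (abs_pos.2 hu))
      filter_upwards [this] with ε hε
      rw [Set.indicator_of_mem (by exact hε)]
  refine hlim.congr' ?_
  filter_upwards [self_mem_nhdsWithin] with ε hε
  exact (key ε hε).symm

end Pavlov

namespace Pavlov

lemma norm_eq_eLpNorm_sub (u v : L2) :
    ‖u - v‖ = (eLpNorm (fun l => u l - v l) 2).toReal := by
  rw [Lp.norm_def, eLpNorm_congr_ae (Lp.coeFn_sub u v)]
  rfl

/-- The square of an `L²` function with Lipschitz modulus has an `L¹`-Lipschitz modulus. -/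
lemma integral_abs_sq_sub_le {C : ℝ} {f : L2} (hf : L2Lipschitz C f) {h : ℝ} (hh : |h| ≤ 1) :
    ∫ l, |f l ^ 2 - f (l + h) ^ 2| ≤ 2 * C * ‖f‖ * |h| := by
  have e : (fun l => |f l ^ 2 - f (l + h) ^ 2|)
      =ᵐ[volume] fun l => ‖(translate h f - f) l‖ * ‖(translate h f + f) l‖ := by
    filter_upwards [Lp.coeFn_sub (translate h f) f, Lp.coeFn_add (translate h f) f,
      coeFn_translate h f] with l h1 h2 h3
    rw [h1, h2, Pi.sub_apply, Pi.add_apply, h3, ← norm_mul, Real.norm_eq_abs, abs_sub_comm]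
    congr 1
    ring
  rw [integral_congr_ae e]
  have h1 := integral_mul_norm_le_Lp_mul_Lq (μ := volume) (f := (translate h f - f : L2))
    (g := (translate h f + f : L2)) Real.HolderConjugate.two_two
    (by simpa using Lp.memLp (translate h f - f)) (by simpa using Lp.memLp (translate h f + f))
  have n : ∀ g : L2, (∫ l, ‖g l‖ ^ (2 : ℝ)) ^ (1 / (2 : ℝ)) = ‖g‖ := by
    intro g
    rw [Lp.norm_def, (Lp.memLp g).eLpNorm_eq_integral_rpow_norm (by simp) (by simp),
      ENNReal.toReal_ofReal (by positivity)]
    norm_num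
  rw [n, n] at h1
  refine h1.trans ?_
  have h2 : ‖translate h f + f‖ ≤ 2 * ‖f‖ := by
    refine (norm_add_le _ _).trans ?_
    rw [(translate h).norm_map]
    linarith
  have h3 := hf h hh
  calc ‖translate h f - f‖ * ‖translate h f + f‖ ≤ (C * |h|) * (2 * ‖f‖) :=
        mul_le_mul h3 h2 (norm_nonneg _) ((norm_nonneg _).trans h3)
    _ = _ := by ring

lemma integrable_sq (f : L2) : Integrable fun l => f l ^ 2 :=
  (Lp.memLp f).integrable_sq

lemma L2Lipschitz.ae_sq_le {C : ℝ} {f : L2} (hf : L2Lipschitz C f) :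
    ∀ᵐ l, f l ^ 2 ≤ 2 * C * ‖f‖ := by
  have hi := integrable_sq f
  have key : ∀ l h : ℝ, 0 < h → h ≤ 1 → ∫ s in l..(l + h), f s ^ 2 ≤ 2 * C * ‖f‖ * h := by
    intro l h hh hh1
    have hi2 : Integrable fun s => f (s + h) ^ 2 := hi.comp_add_right h
    have hi3 : Integrable fun s => f s ^ 2 - f (s + h) ^ 2 := hi.sub hi2
    have h1 : ∫ s in Set.Ioi l, (f s ^ 2 - f (s + h) ^ 2) ≤ 2 * C * ‖f‖ * h := by
      have h2 := integral_abs_sq_sub_le hf (h := h) (by rw [abs_of_pos hh]; exact hh1)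
      rw [abs_of_pos hh] at h2
      calc ∫ s in Set.Ioi l, (f s ^ 2 - f (s + h) ^ 2)
          ≤ ∫ s in Set.Ioi l, |f s ^ 2 - f (s + h) ^ 2| :=
            integral_mono hi3.integrableOn hi3.abs.integrableOn
              fun s => le_abs_self _
        _ ≤ ∫ s, |f s ^ 2 - f (s + h) ^ 2| :=
            setIntegral_le_integral hi3.abs (.of_forall fun s => abs_nonneg _)
        _ ≤ _ := h2
    have h3 : ∫ s in Set.Ioi l, f (s + h) ^ 2 = ∫ s in Set.Ioi (l + h), f s ^ 2 := by
      rw [← integral_indicator measurableSet_Ioi, ← integral_indicator measurableSet_Ioi,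
        ← integral_add_right_eq_self ((Set.Ioi (l + h)).indicator fun s => f s ^ 2) h]
      congr 1
      ext s
      simp [Set.indicator]
    rw [integral_sub hi.integrableOn hi2.integrableOn, h3,
      intervalIntegral.integral_Ioi_sub_Ioi hi.integrableOn (by linarith)] at h1
    exact h1
  filter_upwards [LocallyIntegrable.ae_hasDerivAt_integral hi.locallyIntegrable] with l hl
  have h1 := (hl l).hasDerivWithinAt (s := Set.Ioi l)
  rw [hasDerivWithinAt_iff_tendsto_slope' (by simp)] at h1
  refine le_of_tendsto h1 ?_
  have : Set.Iio (l + 1) ∈ 𝓝[>] l := mem_nhdsWithin_of_mem_nhds (Iio_mem_nhds (by linarith))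
  filter_upwards [self_mem_nhdsWithin, this] with x hx hx1
  have hx : l < x := hx
  have hx1 : x < l + 1 := hx1
  rw [slope_def_field, intervalIntegral.integral_same, sub_zero, div_le_iff₀ (by linarith)]
  have := key l (x - l) (by linarith) (by linarith)
  rwa [add_sub_cancel] at this

lemma L2Lipschitz.memLp_top {C : ℝ} {f : L2} (hf : L2Lipschitz C f) : MemLp f ∞ volume := by
  refine memLp_top_of_bound (Lp.aestronglyMeasurable f) (Real.sqrt (2 * C * ‖f‖)) ?_
  filter_upwards [hf.ae_sq_le] with l hl
  rw [Real.norm_eq_abs]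
  exact Real.abs_le_sqrt hl

lemma inner_eq_integral (f g : L2) : inner ℝ f g = ∫ l, f l * g l := by
  rw [L2.inner_def]
  refine integral_congr_ae (.of_forall fun l => ?_)
  simp [mul_comm]

lemma tendsto_integral_difference_quotient (f : L2) {φ : ℝ → ℝ} (hφ : ContDiff ℝ (⊤ : ℕ∞) φ)
    (hc : HasCompactSupport φ) :
    Tendsto (fun h : ℝ => ∫ l, f l * (h⁻¹ * (φ (l - h) - φ l))) (𝓝[≠] 0)
      (𝓝 (-∫ l, f l * deriv φ l)) := by
  have hd : Differentiable ℝ φ := hφ.differentiable (by simp)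
  have hcd : Continuous (deriv φ) := hφ.continuous_deriv (by simp)
  obtain ⟨M, hM⟩ := hc.deriv.exists_bound_of_continuous hcd
  obtain ⟨R, hR⟩ := hc.isCompact.isBounded.subset_closedBall 0
  have hz : ∀ l, R < |l| → φ l = 0 := by
    intro l hl
    by_contra h
    have := hR (subset_tsupport φ h)
    simp only [Metric.mem_closedBall, dist_zero_right, Real.norm_eq_abs] at this
    linarith
  set B : ℝ → ℝ := (Set.Icc (-(R + 1)) (R + 1)).indicator fun _ => M with hB
  have hBmem : MemLp B 2 := memLp_indicator_const 2 measurableSet_Icc M (.inr (by simp))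
  have hbound : ∀ h : ℝ, h ≠ 0 → |h| ≤ 1 → ∀ l, |h⁻¹ * (φ (l - h) - φ l)| ≤ |B l| := by
    intro h h0 h1 l
    by_cases hl : l ∈ Set.Icc (-(R + 1)) (R + 1)
    · rw [hB, Set.indicator_of_mem hl, abs_mul, abs_inv]
      have := Convex.norm_image_sub_le_of_norm_deriv_le (f := φ) (s := Set.univ) (C := M)
        (fun x _ => hd x) (fun x _ => hM x) convex_univ (x := l) (y := l - h)
        (Set.mem_univ _) (Set.mem_univ _)
      rw [Real.norm_eq_abs, Real.norm_eq_abs, sub_sub_cancel_left, abs_neg] at this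
      rw [inv_mul_le_iff₀ (abs_pos.2 h0)]
      refine this.trans ?_
      rw [mul_comm]
      gcongr
      exact le_abs_self M
    · have h2 : R + 1 < |l| := by
        by_contra h3
        exact hl (abs_le.1 (not_lt.1 h3))
      have h3 : R < |l - h| := by
        have := abs_sub_abs_le_abs_sub l h
        linarith
      rw [hz l (by linarith), hz _ h3]
      simp
  have hint : Integrable fun l => f l * B l := (Lp.memLp f).integrable_mul hBmem
  have hlim := tendsto_integral_filter_of_dominated_convergence (μ := volume) (l := 𝓝[≠] (0 : ℝ))
    (F := fun h l => f l * (h⁻¹ * (φ (l - h) - φ l))) (f := fun l => f l * (-deriv φ l))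
    (fun l => ‖f l * B l‖) ?_ ?_ hint.norm ?_
  · simpa [integral_neg] using hlim
  · refine .of_forall fun h => ?_
    have := (Lp.stronglyMeasurable f).measurable
    have := hφ.continuous.measurable
    exact Measurable.aestronglyMeasurable (by fun_prop)
  · have : Metric.closedBall (0 : ℝ) 1 ∈ 𝓝[≠] (0 : ℝ) :=
      mem_nhdsWithin_of_mem_nhds (Metric.closedBall_mem_nhds _ one_pos)
    filter_upwards [self_mem_nhdsWithin, this] with h h0 h1
    refine .of_forall fun l => ?_
    rw [norm_mul, norm_mul (f l)]
    have h2 : |h| ≤ 1 := by simpa using h1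
    exact mul_le_mul_of_nonneg_left (hbound h h0 h2 l) (norm_nonneg (f l))
  · refine .of_forall fun l => Tendsto.const_mul _ ?_
    have h1 : HasDerivAt (fun h : ℝ => φ (l - h)) (-deriv φ l) 0 := by
      have := (hd (l - 0)).hasDerivAt.comp_const_sub l 0
      simpa using this
    have h2 := hasDerivAt_iff_tendsto_slope.1 h1
    refine h2.congr fun h => ?_
    simp [slope_def_field, div_eq_inv_mul]

/-- A function with Lipschitz modulus of continuity in `L²` belongs to `H¹`. -/
lemma L2Lipschitz.memH1 {C : ℝ} {f : L2} (hf : L2Lipschitz C f) : MemH1 f := by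
  set s : ℕ → ℝ := fun n => 1 / ((n : ℝ) + 1) with hs
  have hs0 : ∀ n, 0 < s n := fun n => by simp only [hs]; positivity
  have hs1 : ∀ n, |s n| ≤ 1 := fun n => by
    rw [abs_of_pos (hs0 n), hs]
    exact div_le_one_of_le₀ (by simp) (by positivity)
  set q : ℕ → L2 := fun n => (s n)⁻¹ • (translate (s n) f - f) with hq
  have hqC : ∀ n, ‖q n‖ ≤ C := fun n => by
    rw [hq, norm_smul, norm_inv, Real.norm_eq_abs, inv_mul_le_iff₀ (abs_pos.2 (hs0 n).ne'),
      mul_comm]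
    exact hf _ (hs1 n)
  set K := WeakDual.toStrongDual (𝕜 := ℝ) (E := L2) ⁻¹' Metric.closedBall 0 C with hK
  have hcomp : IsCompact K := WeakDual.isCompact_closedBall 0 C
  let T : ℕ → WeakDual ℝ L2 := fun n => StrongDual.toWeakDual (InnerProductSpace.toDual ℝ L2 (q n))
  have hT : ∀ n, T n ∈ K := fun n => by
    simp only [hK, T, Set.mem_preimage, Metric.mem_closedBall, dist_zero_right]
    exact ((InnerProductSpace.toDual ℝ L2).norm_map (q n)).trans_le (hqC n)
  obtain ⟨x, -, hx⟩ := hcomp.ultrafilter_le_nhds ((hyperfilter ℕ).map T) (by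
    rw [le_principal_iff]
    exact Filter.mem_map.2 (Filter.univ_mem' hT))
  refine ⟨(InnerProductSpace.toDual ℝ L2).symm (WeakDual.toStrongDual x), fun φ hφ hc => ?_⟩
  have hφ2 : MemLp φ 2 := hφ.continuous.memLp_of_hasCompactSupport hc
  have h1 : Tendsto (fun n => T n (hφ2.toLp φ)) (hyperfilter ℕ) (𝓝 (x (hφ2.toLp φ))) :=
    (WeakDual.eval_continuous (hφ2.toLp φ)).continuousAt.tendsto.comp hx
  have h2 : Tendsto (fun n => T n (hφ2.toLp φ)) atTop (𝓝 (-∫ l, f l * deriv φ l)) := by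
    refine ((tendsto_integral_difference_quotient f hφ hc).comp
      (tendsto_seq_punctured.mono_right
        (nhdsWithin_mono _ fun x (hx : 0 < x) => hx.ne'))).congr fun n => ?_
    have e1 : T n (hφ2.toLp φ) = ∫ l, q n l * φ l := by
      change inner ℝ (q n) (hφ2.toLp φ) = _
      rw [inner_eq_integral]
      refine integral_congr_ae ?_
      filter_upwards [hφ2.coeFn_toLp] with l hl
      rw [hl]
    have e2 : ∫ l, q n l * φ l = ∫ l, (s n)⁻¹ * (f (l + s n) * φ l - f l * φ l) := by
      refine integral_congr_ae ?_
      filter_upwards [Lp.coeFn_smul (s n)⁻¹ (translate (s n) f - f),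
        Lp.coeFn_sub (translate (s n) f) f, coeFn_translate (s n) f] with l h1 h2 h3
      rw [hq, h1, Pi.smul_apply, h2, Pi.sub_apply, h3, smul_eq_mul]
      ring
    have i1 : Integrable fun l => f (l + s n) * φ l :=
      ((Lp.memLp f).comp_measurePreserving (measurePreserving_add (s n))).integrable_mul hφ2
    have i2 : Integrable fun l => f l * φ l := (Lp.memLp f).integrable_mul hφ2
    have i3 : Integrable fun l => f l * φ (l - s n) := by
      have := i1.comp_sub_right (s n)
      simpa using this
    have e3 : ∫ l, f (l + s n) * φ l = ∫ l, f l * φ (l - s n) := by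
      rw [← integral_sub_right_eq_self (fun l => f (l + s n) * φ l) (s n)]
      simp
    have e4 : ∫ l, f l * ((s n)⁻¹ * (φ (l - s n) - φ l))
        = ∫ l, (s n)⁻¹ * (f l * φ (l - s n) - f l * φ l) := by
      congr 1
      ext l
      ring
    rw [Function.comp_apply, e1, e2, e4, integral_const_mul, integral_const_mul,
      integral_sub i1 i2, integral_sub i3 i2, e3]
  have h3 := tendsto_nhds_unique h1 (h2.mono_left (by
    rw [← Nat.cofinite_eq_atTop]; exact hyperfilter_le_cofinite))
  have h4 : x (hφ2.toLp φ) = ∫ l, (InnerProductSpace.toDual ℝ L2).symm (WeakDual.toStrongDual x) l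
      * φ l := by
    have : x (hφ2.toLp φ) = inner ℝ ((InnerProductSpace.toDual ℝ L2).symm
        (WeakDual.toStrongDual x)) (hφ2.toLp φ) := by
      rw [InnerProductSpace.toDual_symm_apply]
      rfl
    rw [this, inner_eq_integral]
    refine integral_congr_ae ?_
    filter_upwards [hφ2.coeFn_toLp] with l hl
    rw [hl]
  rw [← h4, h3, neg_neg]

end Pavlov

namespace Pavlov

/-- The complex space `L²(ℝ, dλ)`. -/
abbrev L2C : Type := Lp ℂ 2 (volume : Measure ℝ)

/-- The real part on `L²`. -/
noncomputable def reL : L2C →L[ℝ] L2 := Complex.reCLM.compLpL 2 volume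

/-- The imaginary part on `L²`. -/
noncomputable def imL : L2C →L[ℝ] L2 := Complex.imCLM.compLpL 2 volume

/-- The operator `f ↦ Re f + H (Im f)`. -/
noncomputable def reHilbert : L2C →L[ℝ] L2 := reL + hilbert.comp imL

lemma coeFn_reL (f : L2C) : reL f =ᵐ[volume] fun l => (f l).re :=
  Complex.reCLM.coeFn_compLp f

lemma coeFn_imL (f : L2C) : imL f =ᵐ[volume] fun l => (f l).im :=
  Complex.imCLM.coeFn_compLp f

lemma reHilbert_apply (f : L2C) : reHilbert f = reL f + hilbert (imL f) := rfl

lemma eLpNorm_hilbert_le {p : ℝ≥0∞} (hp : p = 2 ∨ p = 4) (f : L2) :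
    eLpNorm (hilbert f) p ≤ ENNReal.ofReal (5 / 2) * eLpNorm f p := by
  rcases hp with rfl | rfl
  · have h1 : ‖hilbert f‖ₑ ≤ ‖f‖ₑ := by
      rw [← ofReal_norm, ← ofReal_norm]
      exact ENNReal.ofReal_le_ofReal (norm_hilbert_le f)
    rw [Lp.enorm_def, Lp.enorm_def] at h1
    refine h1.trans (le_mul_of_one_le_left zero_le ?_)
    rw [ENNReal.one_le_ofReal]
    norm_num
  · exact eLpNorm_hilbert_four_le f

lemma one_le_of_two_or_four {p : ℝ≥0∞} (hp : p = 2 ∨ p = 4) : 1 ≤ p := by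
  rcases hp with rfl | rfl <;> norm_num

lemma ne_top_of_two_or_four {p : ℝ≥0∞} (hp : p = 2 ∨ p = 4) : p ≠ ∞ := by
  rcases hp with rfl | rfl <;> simp

lemma ne_zero_of_two_or_four {p : ℝ≥0∞} (hp : p = 2 ∨ p = 4) : p ≠ 0 := by
  rcases hp with rfl | rfl <;> simp

lemma eLpNorm_reHilbert_le {p : ℝ≥0∞} (hp : p = 2 ∨ p = 4) (f : L2C) :
    eLpNorm (reHilbert f) p ≤ ENNReal.ofReal (7 / 2) * eLpNorm f p := by
  have h1 : eLpNorm (reL f) p ≤ eLpNorm f p := by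
    rw [eLpNorm_congr_ae (coeFn_reL f)]
    exact eLpNorm_mono fun l => Complex.abs_re_le_norm _
  have h2 : eLpNorm (imL f) p ≤ eLpNorm f p := by
    rw [eLpNorm_congr_ae (coeFn_imL f)]
    exact eLpNorm_mono fun l => Complex.abs_im_le_norm _
  rw [reHilbert_apply, eLpNorm_congr_ae (Lp.coeFn_add _ _)]
  refine (eLpNorm_add_le (Lp.aestronglyMeasurable _) (Lp.aestronglyMeasurable _)
    (one_le_of_two_or_four hp)).trans ?_
  have h3 := (eLpNorm_hilbert_le hp (imL f)).trans (mul_le_mul_right h2 _)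
  refine (add_le_add h1 h3).trans (le_of_eq ?_)
  have : (7 / 2 : ℝ) = 1 + 5 / 2 := by norm_num
  rw [this, ENNReal.ofReal_add (by norm_num) (by norm_num), add_mul]
  simp

/-- Absorption: if `u = -S f` with `|f| ≤ (3/14) |u| + |r|`, then `u` is controlled by `r`. -/
lemma eLpNorm_le_of_eq_neg_reHilbert {p : ℝ≥0∞} (hp : p = 2 ∨ p = 4) {u : L2} {f : L2C}
    {r : ℝ → ℝ} (hr : AEStronglyMeasurable r volume) (hu : u = -reHilbert f)
    (hf : ∀ᵐ l, ‖f l‖ ≤ 3 / 14 * |u l| + |r l|) (hfin : eLpNorm u p ≠ ∞) :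
    eLpNorm u p ≤ 14 * eLpNorm r p := by
  have h1 : eLpNorm u p ≤ ENNReal.ofReal (7 / 2) * eLpNorm f p := by
    have e : eLpNorm u p = eLpNorm (reHilbert f) p := by
      rw [hu, eLpNorm_congr_ae (Lp.coeFn_neg (reHilbert f)), eLpNorm_neg]
    rw [e]
    exact eLpNorm_reHilbert_le hp f
  have h2 : eLpNorm f p ≤ ENNReal.ofReal (3 / 14) * eLpNorm u p + eLpNorm r p := by
    have e1 : eLpNorm f p ≤ eLpNorm ((fun l => 3 / 14 * ‖u l‖) + fun l => ‖r l‖) p :=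
      eLpNorm_mono_ae_real hf
    have e2 : eLpNorm (fun l => 3 / 14 * ‖u l‖) p ≤ ENNReal.ofReal (3 / 14) * eLpNorm u p := by
      refine eLpNorm_le_mul_eLpNorm_of_ae_le_mul (.of_forall fun l => ?_) p
      rw [norm_mul, norm_norm, Real.norm_of_nonneg (by norm_num)]
    refine e1.trans ((eLpNorm_add_le ((Lp.aestronglyMeasurable u).norm.const_mul _) hr.norm
      (one_le_of_two_or_four hp)).trans (add_le_add e2 ?_))
    rw [eLpNorm_norm]
  have h3 : eLpNorm u p ≤ ENNReal.ofReal (3 / 4) * eLpNorm u p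
      + ENNReal.ofReal (7 / 2) * eLpNorm r p := by
    refine h1.trans ((mul_le_mul_right h2 _).trans (le_of_eq ?_))
    rw [mul_add, ← mul_assoc, ← ENNReal.ofReal_mul (by norm_num)]
    norm_num
  by_cases hr' : eLpNorm r p = ∞
  · rw [hr']; simp
  rw [← ENNReal.ofReal_toReal hfin, ← ENNReal.ofReal_toReal hr'] at h3 ⊢
  rw [← ENNReal.ofReal_mul (by norm_num), ← ENNReal.ofReal_mul (by norm_num),
    ← ENNReal.ofReal_add (by positivity) (by positivity),
    ENNReal.ofReal_le_ofReal_iff (by positivity)] at h3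
  have : (14 : ℝ≥0∞) = ENNReal.ofReal 14 := by simp
  rw [this, ← ENNReal.ofReal_mul (by norm_num)]
  exact ENNReal.ofReal_le_ofReal (by linarith)

/-- A fixed point equation `u = -S (F u)` with `F` Lipschitz with small constant is solvable. -/
lemma exists_eq_neg_reHilbert {F : L2 → L2C}
    (hF : ∀ a b : L2, ∀ᵐ l, ‖F a l - F b l‖ ≤ 3 / 14 * |a l - b l|) :
    ∃ u : L2, u = -reHilbert (F u) := by
  have hc : ContractingWith (3 / 4) fun u : L2 => -reHilbert (F u) := by
    refine ⟨by rw [← NNReal.coe_lt_coe]; norm_num, fun a b => ?_⟩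
    have h1 : eLpNorm (reHilbert (F b - F a)) 2
        ≤ ENNReal.ofReal (7 / 2) * (ENNReal.ofReal (3 / 14) * eLpNorm (a - b : L2) 2) := by
      refine (eLpNorm_reHilbert_le (.inl rfl) _).trans (mul_le_mul_right ?_ _)
      refine eLpNorm_le_mul_eLpNorm_of_ae_le_mul ?_ 2
      filter_upwards [hF a b, Lp.coeFn_sub (F b) (F a), Lp.coeFn_sub a b] with l h1 h2 h3
      rw [h2, h3, Pi.sub_apply, Pi.sub_apply, norm_sub_rev]
      exact h1
    rw [edist_eq_enorm_sub, edist_eq_enorm_sub, neg_sub_neg, ← map_sub, Lp.enorm_def, Lp.enorm_def]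
    refine h1.trans (le_of_eq ?_)
    rw [← mul_assoc, ← ENNReal.ofReal_mul (by norm_num)]
    congr 1
    rw [ENNReal.ofReal, ENNReal.coe_inj]
    ext
    rw [Real.coe_toNNReal _ (by norm_num)]
    norm_num
  exact ⟨hc.fixedPoint, hc.fixedPoint_isFixedPt.symm⟩

/-- Dominated convergence in `Lᵖ`. -/
lemma tendsto_eLpNorm_of_dominated {ι : Type*} {L : Filter ι} [L.IsCountablyGenerated]
    {p : ℝ≥0∞} (hp : p = 2 ∨ p = 4) {r : ι → ℝ → ℝ} {W : ℝ → ℝ}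
    (hr : ∀ᶠ i in L, AEStronglyMeasurable (r i) volume) (hW : MemLp W p)
    (hle : ∀ᶠ i in L, ∀ᵐ l, |r i l| ≤ |W l|)
    (hlim : ∀ᵐ l, Tendsto (fun i => r i l) L (𝓝 0)) :
    Tendsto (fun i => eLpNorm (r i) p) L (𝓝 0) := by
  have hp0 := ne_zero_of_two_or_four hp
  have hpt := ne_top_of_two_or_four hp
  have hpos : 0 < p.toReal := ENNReal.toReal_pos hp0 hpt
  simp only [eLpNorm_eq_lintegral_rpow_enorm_toReal hp0 hpt]
  have h1 : Tendsto (fun i => ∫⁻ l, ‖r i l‖ₑ ^ p.toReal) L (𝓝 (∫⁻ _ : ℝ, 0)) := by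
    refine tendsto_lintegral_filter_of_dominated_convergence' (fun l => ‖W l‖ₑ ^ p.toReal) ?_ ?_ ?_ ?_
    · filter_upwards [hr] with i hi
      exact hi.enorm.pow_const _
    · filter_upwards [hle] with i hi
      filter_upwards [hi] with l hl
      gcongr
      rw [Real.enorm_eq_ofReal_abs, Real.enorm_eq_ofReal_abs]
      exact ENNReal.ofReal_le_ofReal hl
    · exact (lintegral_rpow_enorm_lt_top_of_eLpNorm_lt_top hp0 hpt hW.2).ne
    · filter_upwards [hlim] with l hl
      have h2 := (ENNReal.continuous_rpow_const (y := p.toReal)).tendsto 0 |>.comp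
        ((continuous_enorm (E := ℝ)).tendsto 0 |>.comp hl |> fun h => by simpa using h)
      simpa [Function.comp_def, hpos] using h2
  have h3 := (ENNReal.continuous_rpow_const (y := 1 / p.toReal)).tendsto 0 |>.comp
    (by simpa using h1)
  simpa [Function.comp_def, hpos] using h3

/-- The weight `1 / (1 + |l|)`. -/
noncomputable def wt (l : ℝ) : ℝ := (1 + |l|)⁻¹

lemma wt_pos (l : ℝ) : 0 < wt l := by unfold wt; positivity

lemma wt_le_one (l : ℝ) : wt l ≤ 1 := inv_le_one_of_one_le₀ (by simp)

lemma abs_mul_wt_le (l : ℝ) : |l| * wt l ≤ 1 := by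
  rw [wt, ← div_eq_mul_inv]
  exact div_le_one_of_le₀ (by linarith) (by positivity)

@[fun_prop]
lemma continuous_wt : Continuous wt := by
  unfold wt
  exact Continuous.inv₀ (by fun_prop) fun l => by positivity

lemma wt_sq_le (l : ℝ) : wt l ^ 2 ≤ (1 + l ^ 2)⁻¹ := by
  rw [wt, inv_pow]
  refine inv_anti₀ (by positivity) ?_
  nlinarith [abs_nonneg l, sq_abs l]

lemma memLp_wt {p : ℝ≥0∞} (hp : p = 2 ∨ p = 4) : MemLp wt p := by
  have hp0 := ne_zero_of_two_or_four hp
  have hpt := ne_top_of_two_or_four hp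
  rw [← integrable_norm_rpow_iff continuous_wt.aestronglyMeasurable hp0 hpt]
  refine integrable_inv_one_add_sq.mono' (Continuous.aestronglyMeasurable ?_)
    (.of_forall fun l => ?_)
  · exact continuous_wt.norm.rpow_const fun l => .inr (by positivity)
  · have h1 := wt_pos l
    have h2 := wt_le_one l
    rw [Real.norm_of_nonneg (by positivity), Real.norm_of_nonneg h1.le]
    refine le_trans ?_ (wt_sq_le l)
    rw [← Real.rpow_natCast]
    refine Real.rpow_le_rpow_of_exponent_ge h1 h2 ?_
    rcases hp with rfl | rfl <;> norm_num

lemma wt_add_le {l s : ℝ} (hs : |s| ≤ 1) : wt (l + s) ≤ 2 * wt l := by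
  rw [wt, wt, ← div_eq_mul_inv, inv_eq_one_div, div_le_div_iff₀ (by positivity) (by positivity)]
  have : |l| ≤ |l + s| + |s| := by
    have := abs_sub (l + s) s
    simpa using this
  nlinarith [abs_nonneg (l + s)]

end Pavlov

namespace Pavlov

/-- The function `φ ∈ L²` satisfies `φ = -(Re f + H (Im f))`. -/
def SolvesLinear (φ : ℝ → ℝ) (f : ℝ → ℂ) : Prop :=
  ∃ (hφ : MemLp φ 2) (hf : MemLp f 2), hφ.toLp φ = -reHilbert (hf.toLp f)

namespace SolvesLinear

variable {φ φ₁ φ₂ : ℝ → ℝ} {f f₁ f₂ : ℝ → ℂ}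

lemma sub (h₁ : SolvesLinear φ₁ f₁) (h₂ : SolvesLinear φ₂ f₂) :
    SolvesLinear (fun l => φ₁ l - φ₂ l) fun l => f₁ l - f₂ l := by
  obtain ⟨a₁, b₁, e₁⟩ := h₁
  obtain ⟨a₂, b₂, e₂⟩ := h₂
  refine ⟨a₁.sub a₂, b₁.sub b₂, ?_⟩
  have h3 := MemLp.toLp_sub a₁ a₂
  have h4 := MemLp.toLp_sub b₁ b₂
  refine h3.trans ?_
  rw [e₁, e₂]
  refine Eq.trans ?_ (congrArg (fun z => -reHilbert z) h4.symm)
  rw [map_sub]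
  abel

lemma const_mul (h : SolvesLinear φ f) (c : ℝ) :
    SolvesLinear (fun l => c * φ l) fun l => (c : ℂ) * f l := by
  obtain ⟨a, b, e⟩ := h
  refine ⟨a.const_mul c, b.const_mul (c : ℂ), ?_⟩
  have h3 := MemLp.toLp_const_smul c a
  have h4 := MemLp.toLp_const_smul c b
  refine h3.trans ?_
  rw [e]
  have h5 : (b.const_mul (c : ℂ)).toLp _ = (b.const_smul c).toLp _ := by
    rw [MemLp.toLp_eq_toLp_iff]
    exact .of_forall fun l => (Complex.real_smul).symm
  refine Eq.trans ?_ (congrArg (fun z => -reHilbert z) (h5.trans h4).symm)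
  rw [map_smul, smul_neg]

lemma eLpNorm_le (h : SolvesLinear φ f) {p : ℝ≥0∞} (hp : p = 2 ∨ p = 4) {r : ℝ → ℝ}
    (hr : AEStronglyMeasurable r volume) (hf : ∀ᵐ l, ‖f l‖ ≤ 3 / 14 * |φ l| + |r l|)
    (hfin : eLpNorm φ p ≠ ∞) : eLpNorm φ p ≤ 14 * eLpNorm r p := by
  obtain ⟨a, b, e⟩ := h
  have e1 := a.coeFn_toLp
  rw [← eLpNorm_congr_ae e1] at hfin ⊢
  refine eLpNorm_le_of_eq_neg_reHilbert hp hr e ?_ hfin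
  filter_upwards [hf, e1, b.coeFn_toLp] with l h1 h2 h3
  rwa [h2, h3]

lemma eLpNorm_two_le (h : SolvesLinear φ f) {r : ℝ → ℝ}
    (hr : AEStronglyMeasurable r volume) (hf : ∀ᵐ l, ‖f l‖ ≤ 3 / 14 * |φ l| + |r l|) :
    eLpNorm φ 2 ≤ 14 * eLpNorm r 2 :=
  h.eLpNorm_le (.inl rfl) hr hf h.choose.2.ne

lemma translate (h : SolvesLinear φ f) (s : ℝ) :
    SolvesLinear (fun l => φ (l + s)) fun l => f (l + s) := by
  obtain ⟨a, b, e⟩ := h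
  have hm := measurePreserving_add s
  refine ⟨a.comp_measurePreserving hm, b.comp_measurePreserving hm, ?_⟩
  have h1 : (a.comp_measurePreserving hm).toLp _ = Pavlov.translate s (a.toLp φ) :=
    (Lp.toLp_compMeasurePreserving a hm).symm
  refine h1.trans ?_
  rw [e, map_neg, reHilbert_apply, reHilbert_apply, map_add, ← hilbert_translate]
  have h2 : ∀ (T : L2C →L[ℝ] L2) (τ : ℂ → ℝ), (∀ g : L2C, T g =ᵐ[volume] fun l => τ (g l)) →
      Pavlov.translate s (T (b.toLp f)) = T ((b.comp_measurePreserving hm).toLp _) := by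
    intro T τ hT
    refine Lp.ext ?_
    filter_upwards [coeFn_translate s (T (b.toLp f)), hT ((b.comp_measurePreserving hm).toLp _),
      hm.quasiMeasurePreserving.ae_eq_comp (hT (b.toLp f)),
      hm.quasiMeasurePreserving.ae_eq_comp b.coeFn_toLp,
      (b.comp_measurePreserving hm).coeFn_toLp] with l e1 e2 e3 e4 e5
    simp only [Function.comp_apply] at e3 e4 e5
    rw [e1, e3, e4, e2, e5]
  rw [h2 reL _ coeFn_reL, h2 imL _ coeFn_imL]
  rfl

end SolvesLinear

lemma exists_solvesLinear {f : L2 → ℝ → ℂ} (hf : ∀ u, MemLp (f u) 2)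
    (hlip : ∀ u v : L2, ∀ l, ‖f u l - f v l‖ ≤ 3 / 14 * |u l - v l|) :
    ∃ u : L2, SolvesLinear u (f u) := by
  obtain ⟨u, hu⟩ := exists_eq_neg_reHilbert (F := fun u => (hf u).toLp _) fun a b => by
    filter_upwards [(hf a).coeFn_toLp, (hf b).coeFn_toLp] with l h1 h2
    rw [h1, h2]
    exact hlip a b l
  exact ⟨u, Lp.memLp u, hf u, by rw [Lp.toLp_coeFn]; exact hu⟩

/-- The polynomial phase `x - l y - l² t`. -/
noncomputable def phase (p : ℝ × ℝ × ℝ) (l : ℝ) : ℝ := p.1 - l * p.2.1 - l ^ 2 * p.2.2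

/-- A norm on the parameter space. -/
noncomputable def psize (p : ℝ × ℝ × ℝ) : ℝ := |p.1| + |p.2.1| + |p.2.2|

lemma psize_nonneg (p : ℝ × ℝ × ℝ) : 0 ≤ psize p := by unfold psize; positivity

@[fun_prop]
lemma continuous_phase (p : ℝ × ℝ × ℝ) : Continuous (phase p) := by unfold phase; fun_prop

lemma continuous_psize : Continuous psize := by unfold psize; fun_prop

lemma phase_sub (p q : ℝ × ℝ × ℝ) (l : ℝ) : phase (p - q) l = phase p l - phase q l := by
  simp only [phase, Prod.fst_sub, Prod.snd_sub]; ring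

lemma phase_add_smul (p e : ℝ × ℝ × ℝ) (s l : ℝ) :
    phase (p + s • e) l = phase p l + s * phase e l := by
  simp only [phase, Prod.fst_add, Prod.snd_add, Prod.smul_fst, Prod.smul_snd, smul_eq_mul]; ring

lemma abs_phase_mul_le (p : ℝ × ℝ × ℝ) (l : ℝ) : |phase p l| * wt l ^ 2 ≤ psize p := by
  have h0 := wt_pos l
  have h1 := wt_le_one l
  have h2 := abs_mul_wt_le l
  have h3 : |phase p l| ≤ |p.1| + |l| * |p.2.1| + |l| ^ 2 * |p.2.2| := by
    rw [phase, ← abs_mul, ← abs_pow, ← abs_mul]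
    exact (abs_sub _ _).trans (add_le_add_left (abs_sub _ _) _)
  have h4 : 0 ≤ |l| * wt l := by positivity
  calc |phase p l| * wt l ^ 2 ≤ (|p.1| + |l| * |p.2.1| + |l| ^ 2 * |p.2.2|) * wt l ^ 2 := by gcongr
    _ = |p.1| * wt l ^ 2 + |p.2.1| * (|l| * wt l * wt l) + |p.2.2| * (|l| * wt l) ^ 2 := by ring
    _ ≤ |p.1| * 1 + |p.2.1| * 1 + |p.2.2| * 1 := by
        gcongr
        · exact pow_le_one₀ h0.le h1
        · exact mul_le_one₀ h2 h0.le h1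
        · exact pow_le_one₀ h4 h2
    _ = psize p := by rw [psize]; ring

lemma abs_phase_translate_le (p : ℝ × ℝ × ℝ) {l s : ℝ} (hs : |s| ≤ 1) :
    |phase p (l + s) - phase p l| * wt l ≤ 2 * psize p * |s| := by
  have h0 := wt_pos l
  have h1 : phase p (l + s) - phase p l = -(s * (p.2.1 + (2 * l + s) * p.2.2)) := by
    simp only [phase]; ring
  have h2 : |p.2.1 + (2 * l + s) * p.2.2| ≤ 2 * (1 + |l|) * psize p := by
    have h3 : |2 * l + s| ≤ 2 * |l| + 1 := by
      refine (abs_add_le _ _).trans ?_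
      rw [abs_mul, abs_two]
      linarith
    have h4 : |p.2.1 + (2 * l + s) * p.2.2| ≤ |p.2.1| + |2 * l + s| * |p.2.2| := by
      rw [← abs_mul]; exact abs_add_le _ _
    have h5 := mul_le_mul_of_nonneg_right h3 (abs_nonneg p.2.2)
    rw [psize]
    nlinarith [abs_nonneg l, abs_nonneg p.1, abs_nonneg p.2.1, abs_nonneg p.2.2,
      mul_nonneg (abs_nonneg l) (abs_nonneg p.1), mul_nonneg (abs_nonneg l) (abs_nonneg p.2.1)]
  have h6 : (1 + |l|) * wt l = 1 := mul_inv_cancel₀ (by positivity)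
  rw [h1, abs_neg, abs_mul]
  calc |s| * |p.2.1 + (2 * l + s) * p.2.2| * wt l
      ≤ |s| * (2 * (1 + |l|) * psize p) * wt l := by gcongr
    _ = 2 * psize p * |s| * ((1 + |l|) * wt l) := by ring
    _ = _ := by rw [h6, mul_one]

/-- The quantitative hypotheses on the nonlinearity `χ` and its `ξ`-derivatives `χ₁`, `χ₂`. -/
structure Nonlinearity (χ χ₁ χ₂ : ℝ → ℝ → ℂ) (C : ℝ) : Prop where
  nonneg : 0 ≤ C
  meas : Measurable fun q : ℝ × ℝ => χ q.1 q.2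
  meas₁ : Measurable fun q : ℝ × ℝ => χ₁ q.1 q.2
  meas₂ : Measurable fun q : ℝ × ℝ => χ₂ q.1 q.2
  deriv : ∀ ξ l, HasDerivAt (fun s => χ s l) (χ₁ ξ l) ξ
  deriv₁ : ∀ ξ l, HasDerivAt (fun s => χ₁ s l) (χ₂ ξ l) ξ
  bound : ∀ ξ l, ‖χ ξ l‖ ≤ C * wt l ^ 2
  bound₁ : ∀ ξ l, ‖χ₁ ξ l‖ ≤ C * wt l ^ 3
  bound₂ : ∀ ξ l, ‖χ₂ ξ l‖ ≤ C * wt l ^ 4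
  small : ∀ ξ l, ‖χ₁ ξ l‖ ≤ 3 / 14
  lip₂ : ∀ a b l, ‖χ₂ a l - χ₂ b l‖ ≤ C * wt l ^ 5 * |a - b|
  lipl : ∀ ξ l s, |s| ≤ 1 → ‖χ ξ (l + s) - χ ξ l‖ ≤ C * wt l ^ 3 * |s|

namespace Nonlinearity

variable {χ χ₁ χ₂ : ℝ → ℝ → ℂ} {C : ℝ}

lemma lip (H : Nonlinearity χ χ₁ χ₂ C) (a b l : ℝ) : ‖χ a l - χ b l‖ ≤ 3 / 14 * |a - b| :=
  Convex.norm_image_sub_le_of_norm_hasDerivWithin_le (fun x _ => (H.deriv x l).hasDerivWithinAt)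
    (fun x _ => H.small x l) convex_univ (Set.mem_univ b) (Set.mem_univ a)

lemma lip' (H : Nonlinearity χ χ₁ χ₂ C) (a b l : ℝ) : ‖χ a l - χ b l‖ ≤ C * wt l ^ 3 * |a - b| :=
  Convex.norm_image_sub_le_of_norm_hasDerivWithin_le (fun x _ => (H.deriv x l).hasDerivWithinAt)
    (fun x _ => H.bound₁ x l) convex_univ (Set.mem_univ b) (Set.mem_univ a)

lemma lip₁ (H : Nonlinearity χ χ₁ χ₂ C) (a b l : ℝ) :
    ‖χ₁ a l - χ₁ b l‖ ≤ C * wt l ^ 4 * |a - b| :=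
  Convex.norm_image_sub_le_of_norm_hasDerivWithin_le (fun x _ => (H.deriv₁ x l).hasDerivWithinAt)
    (fun x _ => H.bound₂ x l) convex_univ (Set.mem_univ b) (Set.mem_univ a)

lemma wt_sq_le_wt (l : ℝ) : wt l ^ 2 ≤ wt l := by
  have h0 := wt_pos l
  have h1 := wt_le_one l
  nlinarith

lemma memLp_comp (H : Nonlinearity χ χ₁ χ₂ C) {φ : ℝ → ℝ} (hφ : AEMeasurable φ) :
    MemLp (fun l => χ (φ l) l) 2 := by
  refine ((memLp_wt (.inl rfl)).const_mul C).mono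
    (H.meas.comp_aemeasurable (hφ.prodMk aemeasurable_id)).aestronglyMeasurable
    (.of_forall fun l => ?_)
  rw [Real.norm_of_nonneg (mul_nonneg H.nonneg (wt_pos l).le)]
  exact (H.bound _ l).trans (mul_le_mul_of_nonneg_left (wt_sq_le_wt l) H.nonneg)

lemma aemeasurable_phase_add (p : ℝ × ℝ × ℝ) (u : L2) : AEMeasurable fun l => phase p l + u l :=
  (continuous_phase p).aemeasurable.add (Lp.aestronglyMeasurable u).aemeasurable

lemma exists_solution (H : Nonlinearity χ χ₁ χ₂ C) (p : ℝ × ℝ × ℝ) :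
    ∃ u : L2, SolvesLinear u fun l => χ (phase p l + u l) l :=
  exists_solvesLinear (f := fun u l => χ (phase p l + u l) l)
    (fun u => H.memLp_comp (aemeasurable_phase_add p u)) fun u v l => by
      simpa using H.lip (phase p l + u l) (phase p l + v l) l

/-- The solution `ω` of the nonlinear equation. -/
noncomputable def omega (H : Nonlinearity χ χ₁ χ₂ C) (p : ℝ × ℝ × ℝ) : L2 :=
  (H.exists_solution p).choose

lemma omega_solves (H : Nonlinearity χ χ₁ χ₂ C) (p : ℝ × ℝ × ℝ) :
    SolvesLinear (H.omega p) fun l => χ (phase p l + H.omega p l) l :=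
  (H.exists_solution p).choose_spec

lemma eLpNorm_const_mul_wt_le {p : ℝ≥0∞} {c : ℝ} (hc : 0 ≤ c) :
    eLpNorm (fun l => c * wt l) p = ENNReal.ofReal c * eLpNorm wt p := by
  have := eLpNorm_const_smul c wt p volume
  rw [Real.enorm_eq_ofReal hc] at this
  exact this

lemma eq_omega (H : Nonlinearity χ χ₁ χ₂ C) {p : ℝ × ℝ × ℝ} {u : L2}
    (hu : SolvesLinear u fun l => χ (phase p l + u l) l) : u = H.omega p := by
  have h1 := (hu.sub (H.omega_solves p)).eLpNorm_two_le (r := 0) aestronglyMeasurable_zero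
    (.of_forall fun l => by simpa using H.lip (phase p l + u l) (phase p l + H.omega p l) l)
  simp only [eLpNorm_zero, mul_zero] at h1
  have h2 : ‖u - H.omega p‖ = 0 := by
    rw [norm_eq_eLpNorm_sub, nonpos_iff_eq_zero.1 h1, ENNReal.toReal_zero]
  exact sub_eq_zero.1 (norm_eq_zero.1 h2)

/-- The `L²`-norm of the weight. -/
noncomputable def wtNorm : ℝ := (eLpNorm wt 2 volume).toReal

lemma wtNorm_nonneg : 0 ≤ wtNorm := ENNReal.toReal_nonneg

lemma toReal_eLpNorm_le_of_le_wt {φ : ℝ → ℝ} {c : ℝ} (hc : 0 ≤ c)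
    (h : eLpNorm φ 2 ≤ 14 * eLpNorm (fun l => c * wt l) 2) :
    (eLpNorm φ 2).toReal ≤ 14 * c * wtNorm := by
  rw [eLpNorm_const_mul_wt_le hc] at h
  have h1 := ENNReal.toReal_mono (ENNReal.mul_ne_top (by simp)
    (ENNReal.mul_ne_top ENNReal.ofReal_ne_top (memLp_wt (.inl rfl)).2.ne)) h
  rwa [ENNReal.toReal_mul, ENNReal.toReal_mul, ENNReal.toReal_ofReal hc, ENNReal.toReal_ofNat,
    ← mul_assoc] at h1

lemma norm_omega_le (H : Nonlinearity χ χ₁ χ₂ C) (p : ℝ × ℝ × ℝ) :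
    ‖H.omega p‖ ≤ 14 * C * wtNorm := by
  rw [Lp.norm_def]
  refine toReal_eLpNorm_le_of_le_wt H.nonneg ((H.omega_solves p).eLpNorm_two_le
    (continuous_wt.aestronglyMeasurable.const_mul C) (.of_forall fun l => ?_))
  rw [abs_of_nonneg (mul_nonneg H.nonneg (wt_pos l).le)]
  have h1 := (H.bound (phase p l + H.omega p l) l).trans
    (mul_le_mul_of_nonneg_left (wt_sq_le_wt l) H.nonneg)
  have := abs_nonneg (H.omega p l)
  linarith

lemma norm_omega_sub_le (H : Nonlinearity χ χ₁ χ₂ C) (p q : ℝ × ℝ × ℝ) :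
    ‖H.omega p - H.omega q‖ ≤ 14 * (C * psize (p - q)) * wtNorm := by
  have h0 : 0 ≤ C * psize (p - q) := mul_nonneg H.nonneg (psize_nonneg _)
  rw [norm_eq_eLpNorm_sub]
  refine toReal_eLpNorm_le_of_le_wt h0 (((H.omega_solves p).sub (H.omega_solves q)).eLpNorm_two_le
    (continuous_wt.aestronglyMeasurable.const_mul _) (.of_forall fun l => ?_))
  have hw := wt_pos l
  rw [abs_of_nonneg (mul_nonneg h0 hw.le)]
  have h1 := H.lip (phase p l + H.omega p l) (phase p l + H.omega q l) l
  have h2 := H.lip' (phase p l + H.omega q l) (phase q l + H.omega q l) l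
  rw [add_sub_add_left_eq_sub] at h1
  rw [add_sub_add_right_eq_sub, ← phase_sub] at h2
  refine (norm_sub_le_norm_sub_add_norm_sub _ (χ (phase p l + H.omega q l) l) _).trans
    (add_le_add h1 (h2.trans ?_))
  calc C * wt l ^ 3 * |phase (p - q) l| = C * (|phase (p - q) l| * wt l ^ 2) * wt l := by ring
    _ ≤ C * psize (p - q) * wt l := by
        have := abs_phase_mul_le (p - q) l
        have := H.nonneg
        gcongr

lemma norm_chi_translate_sub_le (H : Nonlinearity χ χ₁ χ₂ C) (p : ℝ × ℝ × ℝ) (u : ℝ → ℝ)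
    {s : ℝ} (hs : |s| ≤ 1) (l : ℝ) :
    ‖χ (phase p (l + s) + u (l + s)) (l + s) - χ (phase p l + u l) l‖
      ≤ 3 / 14 * |u (l + s) - u l| + |C * (1 + 16 * psize p) * |s| * wt l| := by
  have hw := wt_pos l
  have hC := H.nonneg
  have hp := psize_nonneg p
  rw [abs_of_nonneg (show 0 ≤ C * (1 + 16 * psize p) * |s| * wt l by positivity)]
  have h1 := H.lip (phase p (l + s) + u (l + s)) (phase p (l + s) + u l) (l + s)
  have h2 := H.lip' (phase p (l + s) + u l) (phase p l + u l) (l + s)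
  have h3 := H.lipl (phase p l + u l) l s hs
  rw [add_sub_add_left_eq_sub] at h1
  rw [add_sub_add_right_eq_sub] at h2
  have h4 : C * wt (l + s) ^ 3 * |phase p (l + s) - phase p l| ≤ C * (16 * psize p) * |s| * wt l := by
    have h5 := wt_add_le (l := l) hs
    have h6 := abs_phase_translate_le p (l := l) hs
    have hw' := wt_pos (l + s)
    calc C * wt (l + s) ^ 3 * |phase p (l + s) - phase p l|
        ≤ C * (2 * wt l) ^ 3 * |phase p (l + s) - phase p l| := by gcongr
      _ = 8 * C * wt l ^ 2 * (|phase p (l + s) - phase p l| * wt l) := by ring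
      _ ≤ 8 * C * wt l * (2 * psize p * |s|) := by
          gcongr
          exact wt_sq_le_wt l
      _ = _ := by ring
  have h7 : C * wt l ^ 3 * |s| ≤ C * |s| * wt l := by
    have : wt l ^ 3 ≤ wt l := by
      calc wt l ^ 3 = wt l ^ 2 * wt l := by ring
        _ ≤ 1 * wt l := by gcongr; exact pow_le_one₀ hw.le (wt_le_one l)
        _ = wt l := one_mul _
    calc C * wt l ^ 3 * |s| ≤ C * wt l * |s| := by gcongr
      _ = _ := by ring
  have h8 := norm_sub_le_norm_sub_add_norm_sub (χ (phase p (l + s) + u (l + s)) (l + s))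
    (χ (phase p (l + s) + u l) (l + s)) (χ (phase p l + u l) l)
  have h9 := norm_sub_le_norm_sub_add_norm_sub (χ (phase p (l + s) + u l) (l + s))
    (χ (phase p l + u l) (l + s)) (χ (phase p l + u l) l)
  linarith

/-- The Lipschitz constant of the `L²`-modulus of continuity of `ω`. -/
noncomputable def modConst (C : ℝ) (p : ℝ × ℝ × ℝ) : ℝ := 14 * (C * (1 + 16 * psize p)) * wtNorm

lemma l2Lipschitz_omega (H : Nonlinearity χ χ₁ χ₂ C) (p : ℝ × ℝ × ℝ) :
    L2Lipschitz (modConst C p) (H.omega p) := by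
  intro s hs
  have hC := H.nonneg
  have hp := psize_nonneg p
  have h0 : 0 ≤ C * (1 + 16 * psize p) * |s| := by positivity
  have e : ‖translate s (H.omega p) - H.omega p‖
      = (eLpNorm (fun l => H.omega p (l + s) - H.omega p l) 2).toReal := by
    rw [norm_eq_eLpNorm_sub]
    congr 1
    refine eLpNorm_congr_ae ?_
    filter_upwards [coeFn_translate s (H.omega p)] with l hl
    rw [hl]
  rw [e]
  refine (toReal_eLpNorm_le_of_le_wt h0 ((((H.omega_solves p).translate s).sub
    (H.omega_solves p)).eLpNorm_two_le (continuous_wt.aestronglyMeasurable.const_mul _)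
    (.of_forall fun l => ?_))).trans (le_of_eq ?_)
  · exact H.norm_chi_translate_sub_le p (H.omega p) hs l
  · rw [modConst]; ring

end Nonlinearity

end Pavlov

namespace Pavlov

namespace Nonlinearity

variable {χ χ₁ χ₂ : ℝ → ℝ → ℂ} {C : ℝ}

/-- The imaginary part of the nonlinearity as an element of `L²`. -/
noncomputable def imChi (H : Nonlinearity χ χ₁ χ₂ C) (p : ℝ × ℝ × ℝ) (u : L2) : L2 :=
  imL ((H.memLp_comp (aemeasurable_phase_add p u)).toLp _)

lemma coeFn_imChi (H : Nonlinearity χ χ₁ χ₂ C) (p : ℝ × ℝ × ℝ) (u : L2) :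
    H.imChi p u =ᵐ[volume] fun l => (χ (phase p l + u l) l).im := by
  filter_upwards [coeFn_imL ((H.memLp_comp (aemeasurable_phase_add p u)).toLp _),
    (H.memLp_comp (aemeasurable_phase_add p u)).coeFn_toLp] with l h1 h2
  rw [imChi, h1, h2]

lemma solvesLinear_iff (H : Nonlinearity χ χ₁ χ₂ C) (p : ℝ × ℝ × ℝ) (u : L2) :
    SolvesLinear u (fun l => χ (phase p l + u l) l) ↔
      ∀ᵐ l, u l = -((χ (phase p l + u l) l).re + hilbert (H.imChi p u) l) := by
  have hm := H.memLp_comp (aemeasurable_phase_add p u)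
  have key : (fun l => -((χ (phase p l + u l) l).re + hilbert (H.imChi p u) l))
      =ᵐ[volume] (-reHilbert (hm.toLp _) : L2) := by
    filter_upwards [Lp.coeFn_neg (reHilbert (hm.toLp _)),
      Lp.coeFn_add (reL (hm.toLp _)) (hilbert (imL (hm.toLp _))), coeFn_reL (hm.toLp _),
      hm.coeFn_toLp] with l h1 h2 h3 h4
    rw [h1, Pi.neg_apply, reHilbert_apply, h2, Pi.add_apply, h3, h4, imChi]
  constructor
  · rintro ⟨a, b, e⟩
    rw [Lp.toLp_coeFn] at e
    have h : (u : ℝ → ℝ) =ᵐ[volume] (-reHilbert (hm.toLp _) : L2) := by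
      conv_lhs => rw [e]
    exact h.trans key.symm
  · intro h
    refine ⟨Lp.memLp u, hm, ?_⟩
    rw [Lp.toLp_coeFn]
    exact Lp.ext (EventuallyEq.trans h key)

lemma l2Lipschitz_imChi (H : Nonlinearity χ χ₁ χ₂ C) (p : ℝ × ℝ × ℝ) :
    L2Lipschitz (2 * modConst C p) (H.imChi p (H.omega p)) := by
  intro s hs
  have hC := H.nonneg
  have hp := psize_nonneg p
  have hw0 := wtNorm_nonneg
  set ω := H.omega p with hω
  have h0 : 0 ≤ C * (1 + 16 * psize p) * |s| := by positivity
  set W : L2 := ((memLp_wt (.inl rfl)).const_mul (C * (1 + 16 * psize p) * |s|)).toLp _ with hW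
  have h1 : ‖translate s (H.imChi p ω) - H.imChi p ω‖ ≤ ‖translate s ω - ω‖ + ‖W‖ := by
    have h2 : ‖translate s (H.imChi p ω) - H.imChi p ω‖
        ≤ ‖(3 / 14 : ℝ) • |translate s ω - ω| + |W|‖ := by
      refine Lp.norm_le_norm_of_ae_le ?_
      have hq := (measurePreserving_add s).quasiMeasurePreserving
      filter_upwards [Lp.coeFn_sub (translate s (H.imChi p ω)) (H.imChi p ω),
        coeFn_translate s (H.imChi p ω), H.coeFn_imChi p ω, hq.ae_eq_comp (H.coeFn_imChi p ω),
        Lp.coeFn_add ((3 / 14 : ℝ) • |translate s ω - ω|) |W|,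
        Lp.coeFn_smul (3 / 14 : ℝ) |translate s ω - ω|, Lp.coeFn_abs (translate s ω - ω),
        Lp.coeFn_abs W, Lp.coeFn_sub (translate s ω) ω, coeFn_translate s ω,
        ((memLp_wt (p := 2) (.inl rfl)).const_mul (C * (1 + 16 * psize p) * |s|)).coeFn_toLp]
        with l e1 e2 e3 e4 e5 e6 e7 e8 e9 e10 e11
      simp only [Function.comp_apply] at e4
      rw [e1, Pi.sub_apply, e2, e3, e4, e5, Pi.add_apply, e6, Pi.smul_apply, e7, e8, e9,
        Pi.sub_apply, e10, hW, e11, ← Complex.sub_im]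
      have h3 := H.norm_chi_translate_sub_le p ω hs l
      refine (Complex.abs_im_le_norm _).trans (h3.trans ?_)
      exact le_abs_self _
    refine h2.trans ((norm_add_le _ _).trans ?_)
    rw [norm_smul, norm_abs_eq_norm, norm_abs_eq_norm]
    have := norm_nonneg (translate s ω - ω)
    norm_num
    linarith
  have h2 : ‖W‖ ≤ modConst C p * |s| := by
    rw [hW, Lp.norm_toLp, eLpNorm_const_mul_wt_le h0, ENNReal.toReal_mul, ENNReal.toReal_ofReal h0,
      modConst, ← wtNorm]
    have : 0 ≤ C * (1 + 16 * psize p) * |s| * wtNorm := by positivity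
    linarith
  have h3 := H.l2Lipschitz_omega p s hs
  linarith

lemma solvesIST_omega (H : Nonlinearity χ χ₁ χ₂ C) (x y t : ℝ) :
    SolvesIST χ x y t (psi x y t (H.omega (x, y, t))) := by
  set p := (x, y, t)
  have h1 := (H.solvesLinear_iff p (H.omega p)).1 (H.omega_solves p)
  have hpv := exists_principalValue (H.l2Lipschitz_imChi p)
  filter_upwards [h1, hpv, principalValue_eq_hilbert (H.imChi p (H.omega p))] with l h1 ⟨q, hq⟩ h3
  refine ⟨q, hq.congr (H.coeFn_imChi p (H.omega p)), ?_⟩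
  rw [h3 q hq, ← mul_assoc, one_div_mul_cancel Real.pi_ne_zero, one_mul]
  have e : psi x y t (H.omega p) l = x - l * y - l ^ 2 * t + H.omega p l := rfl
  have e2 : phase p l + H.omega p l = psi x y t (H.omega p) l := rfl
  rw [e2] at h1
  linarith

lemma eq_omega_of_solvesIST (H : Nonlinearity χ χ₁ χ₂ C) {x y t : ℝ} {w : L2}
    (hw : SolvesIST χ x y t (psi x y t w)) : w = H.omega (x, y, t) := by
  set p := (x, y, t)
  refine H.eq_omega ((H.solvesLinear_iff p w).2 ?_)
  filter_upwards [hw, principalValue_eq_hilbert (H.imChi p w)] with l ⟨q, hq, h1⟩ h3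
  have h4 := h3 q (hq.congr (H.coeFn_imChi p w).symm)
  rw [h4, ← mul_assoc, one_div_mul_cancel Real.pi_ne_zero, one_mul] at h1
  have e : psi x y t w l = x - l * y - l ^ 2 * t + w l := rfl
  have e2 : phase p l + w l = psi x y t w l := rfl
  rw [e2]
  linarith

lemma psi_omega_eq_of_stationary (H : Nonlinearity χ χ₁ χ₂ C) {x y : ℝ} {φ : ℝ → ℝ}
    (hφ : MemLp (fun l => φ l - (x - l * y)) 2 volume) (h : SolvesStationaryIST χ x y φ) :
    psi x y 0 (H.omega (x, y, 0)) =ᵐ[volume] φ := by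
  have e : psi x y 0 (hφ.toLp _) =ᵐ[volume] φ := by
    filter_upwards [hφ.coeFn_toLp] with l hl
    rw [psi, hl]
    ring
  have e2 : (fun ζ => (χ (φ ζ) ζ).im) =ᵐ[volume] fun ζ => (χ (psi x y 0 (hφ.toLp _) ζ) ζ).im := by
    filter_upwards [e] with l hl
    rw [hl]
  have h1 : SolvesIST χ x y 0 (psi x y 0 (hφ.toLp _)) := by
    filter_upwards [h, e] with l ⟨q, hq, h2⟩ h3
    refine ⟨q, hq.congr e2, ?_⟩
    rw [h3, h2]
    ring
  rw [← H.eq_omega_of_solvesIST h1]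
  exact e

lemma tendsto_modConst (C : ℝ) (q : ℝ × ℝ × ℝ) : Tendsto (modConst C) (𝓝 q) (𝓝 (modConst C q)) := by
  have : Continuous (modConst C) := by
    unfold modConst
    have := continuous_psize
    fun_prop
  exact this.tendsto q

lemma L2Lipschitz_sub {C₁ C₂ : ℝ} {f g : L2} (hf : L2Lipschitz C₁ f) (hg : L2Lipschitz C₂ g) :
    L2Lipschitz (C₁ + C₂) (f - g) := by
  intro s hs
  rw [map_sub, sub_sub_sub_comm, add_mul]
  exact norm_sub_le_of_le (hf s hs) (hg s hs)

/-- A bound for the uniform distance between two solutions. -/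
noncomputable def supDist (H : Nonlinearity χ χ₁ χ₂ C) (p q : ℝ × ℝ × ℝ) : ℝ :=
  Real.sqrt (2 * (modConst C p + modConst C q) * ‖H.omega p - H.omega q‖)

lemma ae_abs_omega_sub_le (H : Nonlinearity χ χ₁ χ₂ C) (p q : ℝ × ℝ × ℝ) :
    ∀ᵐ l, |H.omega p l - H.omega q l| ≤ H.supDist p q := by
  have h := (L2Lipschitz_sub (H.l2Lipschitz_omega p) (H.l2Lipschitz_omega q)).ae_sq_le
  filter_upwards [h, Lp.coeFn_sub (H.omega p) (H.omega q)] with l h1 h2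
  rw [h2, Pi.sub_apply] at h1
  exact Real.abs_le_sqrt h1

lemma tendsto_omega (H : Nonlinearity χ χ₁ χ₂ C) (q : ℝ × ℝ × ℝ) :
    Tendsto H.omega (𝓝 q) (𝓝 (H.omega q)) := by
  rw [tendsto_iff_norm_sub_tendsto_zero]
  have h1 : Tendsto (fun p => 14 * (C * psize (p - q)) * wtNorm) (𝓝 q) (𝓝 0) := by
    have : Continuous fun p => 14 * (C * psize (p - q)) * wtNorm := by
      have := continuous_psize
      fun_prop
    have h := this.tendsto q
    simpa [psize] using h
  exact squeeze_zero (fun _ => norm_nonneg _) (fun p => H.norm_omega_sub_le p q) h1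

lemma tendsto_supDist (H : Nonlinearity χ χ₁ χ₂ C) (q : ℝ × ℝ × ℝ) :
    Tendsto (fun p => H.supDist p q) (𝓝 q) (𝓝 0) := by
  have h1 := tendsto_iff_norm_sub_tendsto_zero.1 (H.tendsto_omega q)
  have h2 := ((((tendsto_modConst C q).add_const (modConst C q)).const_mul 2).mul h1).sqrt
  simpa [supDist] using h2

lemma memLp_omega_four (H : Nonlinearity χ χ₁ χ₂ C) (p : ℝ × ℝ × ℝ) : MemLp (H.omega p) 4 := by
  have hm := Lp.aestronglyMeasurable (H.omega p)
  have h2 := integrable_sq (H.omega p)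
  rw [← integrable_norm_rpow_iff hm (by simp) (by simp)]
  refine (h2.const_mul (2 * modConst C p * ‖H.omega p‖)).mono'
    (hm.norm.aemeasurable.pow_const _).aestronglyMeasurable ?_
  filter_upwards [(H.l2Lipschitz_omega p).ae_sq_le] with l hl
  have e : ‖H.omega p l‖ ^ (4 : ℝ≥0∞).toReal = H.omega p l ^ 2 * H.omega p l ^ 2 := by
    rw [ENNReal.toReal_ofNat, Real.norm_eq_abs]
    have : (4 : ℝ) = ((4 : ℕ) : ℝ) := by norm_num
    rw [this, Real.rpow_natCast, ← sq_abs (H.omega p l)]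
    ring
  rw [e, Real.norm_of_nonneg (by positivity)]
  gcongr

end Nonlinearity

lemma contL2_of_tendsto {F : ℝ × ℝ × ℝ → L2} (hF : Continuous F) :
    ContL2 fun x y t => F (x, y, t) := hF.continuousOn

namespace Nonlinearity

variable {χ χ₁ χ₂ : ℝ → ℝ → ℂ} {C : ℝ}

lemma contLInfty_omega (H : Nonlinearity χ χ₁ χ₂ C) :
    ContLInfty fun x y t => H.omega (x, y, t) := by
  refine ⟨fun x y t _ => (H.l2Lipschitz_omega _).memLp_top, fun q _ => ?_⟩
  have h1 : Tendsto (fun p => ENNReal.ofReal (H.supDist p q)) (𝓝[Dom] q) (𝓝 0) := by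
    have := ENNReal.tendsto_ofReal ((H.tendsto_supDist q).mono_left
      (nhdsWithin_le_nhds (s := Dom)))
    simpa using this
  refine tendsto_of_tendsto_of_tendsto_of_le_of_le tendsto_const_nhds h1 (fun _ => zero_le)
    fun p => ?_
  rw [eLpNorm_exponent_top]
  refine eLpNormEssSup_le_of_ae_bound (C := H.supDist p q) ?_
  filter_upwards [H.ae_abs_omega_sub_le p q, Lp.coeFn_sub (H.omega p) (H.omega q)] with l h1 h2
  have h3 : (H.omega (p.1, p.2.1, p.2.2) - H.omega (q.1, q.2.1, q.2.2) : L2) l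
      = H.omega p l - H.omega q l := h2
  rw [h3]
  exact h1

end Nonlinearity

end Pavlov

namespace Pavlov

lemma tendsto_eLpNorm_add {ι : Type*} {L : Filter ι} {p : ℝ≥0∞} (hp : 1 ≤ p) {r₁ r₂ : ι → ℝ → ℝ}
    (hm₁ : ∀ i, AEStronglyMeasurable (r₁ i) volume) (hm₂ : ∀ i, AEStronglyMeasurable (r₂ i) volume)
    (h₁ : Tendsto (fun i => eLpNorm (r₁ i) p) L (𝓝 0))
    (h₂ : Tendsto (fun i => eLpNorm (r₂ i) p) L (𝓝 0)) :
    Tendsto (fun i => eLpNorm (fun l => r₁ i l + r₂ i l) p) L (𝓝 0) := by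
  have h := h₁.add h₂
  rw [add_zero] at h
  exact tendsto_of_tendsto_of_tendsto_of_le_of_le tendsto_const_nhds h (fun _ => zero_le)
    fun i => eLpNorm_add_le (hm₁ i) (hm₂ i) hp

lemma tendsto_eLpNorm_const_mul {ι : Type*} {L : Filter ι} {p : ℝ≥0∞} {r : ι → ℝ → ℝ} (c : ℝ)
    (h : Tendsto (fun i => eLpNorm (r i) p) L (𝓝 0)) :
    Tendsto (fun i => eLpNorm (fun l => c * r i l) p) L (𝓝 0) := by
  have h1 := ENNReal.Tendsto.const_mul (a := ‖c‖ₑ) h (.inr (by simp))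
  rw [mul_zero] at h1
  exact h1.congr fun i => (eLpNorm_const_smul c (r i) p volume).symm

lemma tendsto_eLpNorm_of_le {ι : Type*} {L : Filter ι} {p : ℝ≥0∞} {r R : ι → ℝ → ℝ}
    (h : Tendsto (fun i => eLpNorm (R i) p) L (𝓝 0))
    (hle : ∀ᶠ i in L, ∀ᵐ l, |r i l| ≤ |R i l|) :
    Tendsto (fun i => eLpNorm (r i) p) L (𝓝 0) :=
  tendsto_of_tendsto_of_tendsto_of_le_of_le' tendsto_const_nhds h (.of_forall fun _ => zero_le)
    (hle.mono fun _ hi => eLpNorm_mono_ae hi)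

namespace SolvesLinear

lemma tendsto_eLpNorm {ι : Type*} {L : Filter ι} {p : ℝ≥0∞} (hp : p = 2 ∨ p = 4)
    {φ : ι → ℝ → ℝ} {f : ι → ℝ → ℂ} {r : ι → ℝ → ℝ}
    (h : ∀ᶠ i in L, SolvesLinear (φ i) (f i)) (hr : ∀ i, AEStronglyMeasurable (r i) volume)
    (hf : ∀ᶠ i in L, ∀ᵐ l, ‖f i l‖ ≤ 3 / 14 * |φ i l| + |r i l|)
    (hfin : ∀ᶠ i in L, eLpNorm (φ i) p ≠ ∞)
    (hlim : Tendsto (fun i => eLpNorm (r i) p) L (𝓝 0)) :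
    Tendsto (fun i => eLpNorm (φ i) p) L (𝓝 0) := by
  have h1 := ENNReal.Tendsto.const_mul (a := 14) hlim (.inr (by simp))
  rw [mul_zero] at h1
  refine tendsto_of_tendsto_of_tendsto_of_le_of_le' tendsto_const_nhds h1
    (.of_forall fun _ => zero_le) ?_
  filter_upwards [h, hf, hfin] with i h2 h3 h4
  exact h2.eLpNorm_le hp (hr i) h3 h4

end SolvesLinear

lemma measurable_L2 (u : L2) : Measurable u := (Lp.stronglyMeasurable u).measurable

namespace Nonlinearity

variable {χ χ₁ χ₂ : ℝ → ℝ → ℂ} {C : ℝ}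

/-- The phase function `ψ = x - l y - l² t + ω`. -/
noncomputable def fullPhase (H : Nonlinearity χ χ₁ χ₂ C) (p : ℝ × ℝ × ℝ) (l : ℝ) : ℝ :=
  phase p l + H.omega p l

lemma measurable_fullPhase (H : Nonlinearity χ χ₁ χ₂ C) (p : ℝ × ℝ × ℝ) :
    Measurable (H.fullPhase p) :=
  (continuous_phase p).measurable.add (measurable_L2 _)

lemma measurable_comp₁ (H : Nonlinearity χ χ₁ χ₂ C) {φ : ℝ → ℝ} (hφ : Measurable φ) :
    Measurable fun l => χ₁ (φ l) l := H.meas₁.comp (hφ.prodMk measurable_id)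

lemma measurable_comp₂ (H : Nonlinearity χ χ₁ χ₂ C) {φ : ℝ → ℝ} (hφ : Measurable φ) :
    Measurable fun l => χ₂ (φ l) l := H.meas₂.comp (hφ.prodMk measurable_id)

lemma wt_pow_mul_phase_le (e : ℝ × ℝ × ℝ) (l : ℝ) : wt l ^ 3 * |phase e l| ≤ psize e * wt l := by
  have hw := wt_pos l
  have h2 := abs_phase_mul_le e l
  calc wt l ^ 3 * |phase e l| = (|phase e l| * wt l ^ 2) * wt l := by ring
    _ ≤ psize e * wt l := by gcongr

lemma memLp_wt_phase_add {p : ℝ≥0∞} (hp : p = 2 ∨ p = 4) (e : ℝ × ℝ × ℝ) {u : ℝ → ℝ}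
    (hu : MemLp u p) : MemLp (fun l => wt l ^ 3 * (phase e l + u l)) p := by
  have h1 : MemLp (fun l => psize e * wt l + ‖u l‖) p := ((memLp_wt hp).const_mul _).add hu.norm
  refine h1.mono ?_ (.of_forall fun l => ?_)
  · exact ((continuous_wt.pow 3).aestronglyMeasurable).mul
      ((continuous_phase e).aestronglyMeasurable.add hu.1)
  · have hw := wt_pos l
    have hp := psize_nonneg e
    rw [norm_mul, Real.norm_of_nonneg (show 0 ≤ wt l ^ 3 by positivity),
      Real.norm_of_nonneg (show 0 ≤ psize e * wt l + ‖u l‖ by positivity)]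
    have h2 := wt_pow_mul_phase_le e l
    have h3 : wt l ^ 3 ≤ 1 := pow_le_one₀ hw.le (wt_le_one l)
    calc wt l ^ 3 * ‖phase e l + u l‖ ≤ wt l ^ 3 * (|phase e l| + ‖u l‖) := by
          gcongr; exact norm_add_le _ _
      _ = wt l ^ 3 * |phase e l| + wt l ^ 3 * ‖u l‖ := by ring
      _ ≤ psize e * wt l + 1 * ‖u l‖ := by gcongr
      _ = _ := by ring

lemma exists_derivative (H : Nonlinearity χ χ₁ χ₂ C) (p e : ℝ × ℝ × ℝ) :
    ∃ u : L2, SolvesLinear u fun l => χ₁ (H.fullPhase p l) l * ((phase e l + u l : ℝ) : ℂ) := by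
  refine exists_solvesLinear
    (f := fun u l => χ₁ (H.fullPhase p l) l * ((phase e l + u l : ℝ) : ℂ)) (fun u => ?_)
    fun u v l => ?_
  · refine ((memLp_wt_phase_add (.inl rfl) e (Lp.memLp u)).const_mul C).mono ?_
      (.of_forall fun l => ?_)
    · have h1 := H.measurable_comp₁ (H.measurable_fullPhase p)
      have h2 := measurable_L2 u
      have h3 := (continuous_phase e).measurable
      exact (h1.mul (Complex.measurable_ofReal.comp (h3.add h2))).aestronglyMeasurable
    · have hw := wt_pos l
      rw [norm_mul, norm_mul, norm_mul (wt l ^ 3), Complex.norm_real, Real.norm_of_nonneg H.nonneg,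
        ← mul_assoc, Real.norm_of_nonneg (show 0 ≤ wt l ^ 3 by positivity)]
      exact mul_le_mul_of_nonneg_right (H.bound₁ _ l) (norm_nonneg _)
  · rw [← mul_sub, norm_mul, ← Complex.ofReal_sub, add_sub_add_left_eq_sub, Complex.norm_real]
    gcongr
    · exact H.small _ l
    · exact le_rfl

/-- The directional derivative of `ω` in the direction `e`. -/
noncomputable def omegaD (H : Nonlinearity χ χ₁ χ₂ C) (e p : ℝ × ℝ × ℝ) : L2 :=
  (H.exists_derivative p e).choose

lemma omegaD_solves (H : Nonlinearity χ χ₁ χ₂ C) (e p : ℝ × ℝ × ℝ) :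
    SolvesLinear (H.omegaD e p)
      fun l => χ₁ (H.fullPhase p l) l * ((phase e l + H.omegaD e p l : ℝ) : ℂ) :=
  (H.exists_derivative p e).choose_spec

/-- The difference quotient of `ω`. -/
noncomputable def quot (H : Nonlinearity χ χ₁ χ₂ C) (e p : ℝ × ℝ × ℝ) (s l : ℝ) : ℝ :=
  s⁻¹ * (H.omega (p + s • e) l - H.omega p l)

lemma measurable_quot (H : Nonlinearity χ χ₁ χ₂ C) (e p : ℝ × ℝ × ℝ) (s : ℝ) :
    Measurable (H.quot e p s) :=
  ((measurable_L2 _).sub (measurable_L2 _)).const_mul _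

lemma fullPhase_add_smul (H : Nonlinearity χ χ₁ χ₂ C) (e p : ℝ × ℝ × ℝ) {s : ℝ} (hs : s ≠ 0)
    (l : ℝ) :
    H.fullPhase (p + s • e) l = H.fullPhase p l + s * (phase e l + H.quot e p s l) := by
  rw [fullPhase, fullPhase, quot, phase_add_smul, mul_add, ← mul_assoc, mul_inv_cancel₀ hs]
  ring

lemma quot_solves (H : Nonlinearity χ χ₁ χ₂ C) (e p : ℝ × ℝ × ℝ) (s : ℝ) :
    SolvesLinear (H.quot e p s) fun l =>
      ((s⁻¹ : ℝ) : ℂ) * (χ (H.fullPhase (p + s • e) l) l - χ (H.fullPhase p l) l) :=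
  ((H.omega_solves (p + s • e)).sub (H.omega_solves p)).const_mul s⁻¹

lemma memLp_quot (H : Nonlinearity χ χ₁ χ₂ C) {q : ℝ≥0∞} (hq : q = 2 ∨ q = 4)
    (e p : ℝ × ℝ × ℝ) (s : ℝ) : MemLp (H.quot e p s) q := by
  have h : ∀ p, MemLp (H.omega p) q := fun p => by
    rcases hq with rfl | rfl
    · exact Lp.memLp _
    · exact H.memLp_omega_four p
  exact ((h _).sub (h _)).const_mul _

lemma eLpNorm_quot_le (H : Nonlinearity χ χ₁ χ₂ C) {q : ℝ≥0∞} (hq : q = 2 ∨ q = 4)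
    (e p : ℝ × ℝ × ℝ) {s : ℝ} (hs : s ≠ 0) :
    eLpNorm (H.quot e p s) q ≤ 14 * eLpNorm (fun l => C * psize e * wt l) q := by
  refine (H.quot_solves e p s).eLpNorm_le hq (continuous_wt.aestronglyMeasurable.const_mul _)
    (.of_forall fun l => ?_) (H.memLp_quot hq e p s).2.ne
  have hw := wt_pos l
  have hC := H.nonneg
  have hp := psize_nonneg e
  have hs' := abs_pos.2 hs
  rw [abs_of_nonneg (show 0 ≤ C * psize e * wt l by positivity), norm_mul, Complex.norm_real,
    norm_inv, Real.norm_eq_abs, inv_mul_le_iff₀ hs', H.fullPhase_add_smul e p hs]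
  set ψ := H.fullPhase p l
  set g := phase e l
  set D := H.quot e p s l
  have h1 := H.lip (ψ + s * (g + D)) (ψ + s * g) l
  have h2 := H.lip' (ψ + s * g) ψ l
  have h3 := norm_sub_le_norm_sub_add_norm_sub (χ (ψ + s * (g + D)) l) (χ (ψ + s * g) l) (χ ψ l)
  have e1 : ψ + s * (g + D) - (ψ + s * g) = s * D := by ring
  have e2 : ψ + s * g - ψ = s * g := by ring
  rw [e1, abs_mul] at h1
  rw [e2, abs_mul] at h2
  have h4 : C * wt l ^ 3 * (|s| * |g|) ≤ |s| * (C * psize e * wt l) := by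
    calc C * wt l ^ 3 * (|s| * |g|) = |s| * C * (wt l ^ 3 * |g|) := by ring
      _ ≤ |s| * C * (psize e * wt l) :=
          mul_le_mul_of_nonneg_left (wt_pow_mul_phase_le e l) (by positivity)
      _ = _ := by ring
  linarith

/-- The remainder in the first order expansion of a function of `ξ`. -/
noncomputable def taylorRem (Φ Φ' : ℝ → ℝ → ℂ) (ψ ρ : ℝ → ℝ) (s l : ℝ) : ℝ :=
  ‖((s⁻¹ : ℝ) : ℂ) * (Φ (ψ l + s * ρ l) l - Φ (ψ l) l) - Φ' (ψ l) l * (ρ l : ℂ)‖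

lemma tendsto_taylorRem {Φ Φ' : ℝ → ℝ → ℂ} (hd : ∀ ξ l, HasDerivAt (fun s => Φ s l) (Φ' ξ l) ξ)
    (ψ ρ : ℝ → ℝ) (l : ℝ) : Tendsto (fun s => taylorRem Φ Φ' ψ ρ s l) (𝓝[≠] 0) (𝓝 0) := by
  have h1 : HasDerivAt (fun s : ℝ => ψ l + s * ρ l) (ρ l) 0 := by
    simpa using ((hasDerivAt_id (0 : ℝ)).mul_const (ρ l)).const_add (ψ l)
  have h0 : HasDerivAt (fun s => Φ s l) (Φ' (ψ l) l) (ψ l + 0 * ρ l) := by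
    simpa using hd (ψ l) l
  have h2 := h0.scomp (0 : ℝ) h1
  have h3 := (hasDerivAt_iff_tendsto_slope.1 h2).sub_const (ρ l • Φ' (ψ l) l)
  rw [sub_self] at h3
  have h4 := h3.norm
  rw [norm_zero] at h4
  refine h4.congr fun s => ?_
  rw [taylorRem, slope_def_module]
  simp only [Function.comp_apply, zero_mul, add_zero, sub_zero]
  rw [Complex.real_smul, Complex.real_smul, mul_comm (Φ' (ψ l) l)]

lemma taylorRem_le {Φ Φ' : ℝ → ℝ → ℂ} {B : ℝ → ℝ} (hb : ∀ ξ l, ‖Φ' ξ l‖ ≤ B l)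
    (hlip : ∀ a b l, ‖Φ a l - Φ b l‖ ≤ B l * |a - b|) (ψ ρ : ℝ → ℝ) {s : ℝ} (hs : s ≠ 0) (l : ℝ) :
    taylorRem Φ Φ' ψ ρ s l ≤ 2 * (B l * |ρ l|) := by
  have hs' := abs_pos.2 hs
  have h1 := hlip (ψ l + s * ρ l) (ψ l) l
  rw [add_sub_cancel_left, abs_mul] at h1
  have h2 : ‖((s⁻¹ : ℝ) : ℂ) * (Φ (ψ l + s * ρ l) l - Φ (ψ l) l)‖ ≤ B l * |ρ l| := by
    rw [norm_mul, Complex.norm_real, norm_inv, Real.norm_eq_abs, inv_mul_le_iff₀ hs']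
    linarith
  have h3 : ‖Φ' (ψ l) l * (ρ l : ℂ)‖ ≤ B l * |ρ l| := by
    rw [norm_mul, Complex.norm_real, Real.norm_eq_abs]
    gcongr
    exact hb _ l
  rw [taylorRem]
  linarith [norm_sub_le_of_le h2 h3]

lemma measurable_taylorRem {Φ Φ' : ℝ → ℝ → ℂ} (h : Measurable fun q : ℝ × ℝ => Φ q.1 q.2)
    (h' : Measurable fun q : ℝ × ℝ => Φ' q.1 q.2) {ψ ρ : ℝ → ℝ} (hψ : Measurable ψ)
    (hρ : Measurable ρ) (s : ℝ) : Measurable (taylorRem Φ Φ' ψ ρ s) := by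
  have h1 : Measurable fun l => Φ (ψ l + s * ρ l) l :=
    h.comp ((hψ.add (hρ.const_mul s)).prodMk measurable_id)
  have h2 : Measurable fun l => Φ (ψ l) l := h.comp (hψ.prodMk measurable_id)
  have h3 : Measurable fun l => Φ' (ψ l) l := h'.comp (hψ.prodMk measurable_id)
  exact (((h1.sub h2).const_mul _).sub (h3.mul (Complex.measurable_ofReal.comp hρ))).norm

lemma tendsto_eLpNorm_quot_sub (H : Nonlinearity χ χ₁ χ₂ C) {q : ℝ≥0∞} (hq : q = 2 ∨ q = 4)
    (e p : ℝ × ℝ × ℝ) (hu : MemLp (H.omegaD e p) q) :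
    Tendsto (fun s => eLpNorm (fun l => H.quot e p s l - H.omegaD e p l) q) (𝓝[≠] 0) (𝓝 0) := by
  set u := H.omegaD e p with hudef
  set ρ : ℝ → ℝ := fun l => phase e l + u l with hρ
  have hρm : Measurable ρ := (continuous_phase e).measurable.add (measurable_L2 u)
  have hm : ∀ s, Measurable (taylorRem χ χ₁ (H.fullPhase p) ρ s) :=
    measurable_taylorRem H.meas H.meas₁ (H.measurable_fullPhase p) hρm
  have hs : ∀ᶠ s : ℝ in 𝓝[≠] 0, s ≠ 0 := self_mem_nhdsWithin
  refine SolvesLinear.tendsto_eLpNorm hq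
    (.of_forall fun s => (H.quot_solves e p s).sub (H.omegaD_solves e p))
    (r := fun s => taylorRem χ χ₁ (H.fullPhase p) ρ s) (fun s => (hm s).aestronglyMeasurable) ?_ ?_ ?_
  · filter_upwards [hs] with s hs
    refine .of_forall fun l => ?_
    have h1 := H.lip (H.fullPhase (p + s • e) l) (H.fullPhase p l + s * ρ l) l
    have e1 : H.fullPhase (p + s • e) l - (H.fullPhase p l + s * ρ l)
        = s * (H.quot e p s l - u l) := by
      rw [H.fullPhase_add_smul e p hs, hρ]; ring
    rw [e1, abs_mul] at h1
    have e2 : ((s⁻¹ : ℝ) : ℂ) * (χ (H.fullPhase (p + s • e) l) l - χ (H.fullPhase p l) l)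
        - χ₁ (H.fullPhase p l) l * ((phase e l + u l : ℝ) : ℂ)
        = ((s⁻¹ : ℝ) : ℂ) * (χ (H.fullPhase (p + s • e) l) l - χ (H.fullPhase p l + s * ρ l) l)
          + (((s⁻¹ : ℝ) : ℂ) * (χ (H.fullPhase p l + s * ρ l) l - χ (H.fullPhase p l) l)
            - χ₁ (H.fullPhase p l) l * (ρ l : ℂ)) := by
      rw [hρ]; ring
    rw [e2]
    refine norm_add_le_of_le ?_ (le_abs_self _)
    rw [norm_mul, Complex.norm_real, norm_inv, Real.norm_eq_abs, inv_mul_le_iff₀ (abs_pos.2 hs)]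
    linarith
  · exact .of_forall fun s => ((H.memLp_quot hq e p s).sub hu).2.ne
  · refine tendsto_eLpNorm_of_dominated hq (.of_forall fun s => (hm s).aestronglyMeasurable)
      ((memLp_wt_phase_add hq e hu).const_mul (2 * C)) ?_
      (.of_forall fun l => tendsto_taylorRem H.deriv _ _ l)
    filter_upwards [hs] with s hs
    refine .of_forall fun l => ?_
    have h1 := taylorRem_le (B := fun l => C * wt l ^ 3) H.bound₁ H.lip' (H.fullPhase p) ρ hs l
    have hw := wt_pos l
    have hC := H.nonneg
    have h2 : |taylorRem χ χ₁ (H.fullPhase p) ρ s l| = taylorRem χ χ₁ (H.fullPhase p) ρ s l :=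
      abs_of_nonneg (norm_nonneg _)
    rw [h2, abs_mul (2 * C), abs_mul (wt l ^ 3),
      abs_of_nonneg (show 0 ≤ wt l ^ 3 by positivity), abs_of_nonneg (show 0 ≤ 2 * C by positivity)]
    refine h1.trans (le_of_eq ?_)
    rw [hρ]
    ring

lemma eLpNorm_omegaD_le_wt (H : Nonlinearity χ χ₁ χ₂ C) {q : ℝ≥0∞} (hq : q = 2 ∨ q = 4)
    (e p : ℝ × ℝ × ℝ) :
    eLpNorm (H.omegaD e p) q ≤ 14 * eLpNorm (fun l => C * psize e * wt l) q := by
  have h1 := (H.tendsto_eLpNorm_quot_sub (.inl rfl) e p (Lp.memLp _)).comp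
    (tendsto_seq_punctured.mono_right (nhdsWithin_mono _ fun x (hx : 0 < x) => hx.ne'))
  obtain ⟨ns, -, hns⟩ := (tendstoInMeasure_of_tendsto_eLpNorm (g := (H.omegaD e p : ℝ → ℝ))
    (f := fun n : ℕ => H.quot e p (1 / ((n : ℝ) + 1)))
    two_ne_zero (fun n => (H.measurable_quot e p _).aestronglyMeasurable)
    (Lp.aestronglyMeasurable _) h1).exists_seq_tendsto_ae
  refine (Lp.eLpNorm_lim_le_liminf_eLpNorm
    (fun i => (H.measurable_quot e p _).aestronglyMeasurable) _ hns).trans ?_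
  exact liminf_le_of_le (by isBoundedDefault) fun b hb => by
    obtain ⟨n, hn⟩ := hb.exists
    exact hn.trans (H.eLpNorm_quot_le hq e p (by positivity))

/-- A uniform bound for the norms of `∂ₑ ω`. -/
noncomputable def derivBound (C : ℝ) (e : ℝ × ℝ × ℝ) (q : ℝ≥0∞) : ℝ≥0∞ :=
  14 * eLpNorm (fun l => C * psize e * wt l) q

lemma derivBound_ne_top (C : ℝ) (e : ℝ × ℝ × ℝ) {q : ℝ≥0∞} (hq : q = 2 ∨ q = 4) :
    derivBound C e q ≠ ∞ :=
  ENNReal.mul_ne_top (by simp) ((memLp_wt hq).const_mul _).2.ne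

lemma eLpNorm_omegaD_le (H : Nonlinearity χ χ₁ χ₂ C) {q : ℝ≥0∞} (hq : q = 2 ∨ q = 4)
    (e p : ℝ × ℝ × ℝ) : eLpNorm (H.omegaD e p) q ≤ derivBound C e q :=
  H.eLpNorm_omegaD_le_wt hq e p

lemma memLp_omegaD (H : Nonlinearity χ χ₁ χ₂ C) {q : ℝ≥0∞} (hq : q = 2 ∨ q = 4)
    (e p : ℝ × ℝ × ℝ) : MemLp (H.omegaD e p) q :=
  ⟨Lp.aestronglyMeasurable _,
    (H.eLpNorm_omegaD_le hq e p).trans_lt (derivBound_ne_top C e hq).lt_top⟩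

end Nonlinearity

end Pavlov

namespace Pavlov

lemma tendsto_L2_of_eLpNorm {ι : Type*} {L : Filter ι} {F : ι → L2} {G : L2}
    (h : Tendsto (fun i => eLpNorm (fun l => F i l - G l) 2) L (𝓝 0)) : Tendsto F L (𝓝 G) := by
  rw [tendsto_iff_edist_tendsto_0]
  refine h.congr fun i => ?_
  rw [Lp.edist_def]
  rfl

lemma hasDerivAt_of_eLpNorm {F : ℝ → L2} {G : L2}
    (h : Tendsto (fun s => eLpNorm (fun l => s⁻¹ * (F s l - F 0 l) - G l) 2) (𝓝[≠] 0) (𝓝 0)) :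
    HasDerivAt F G 0 := by
  rw [hasDerivAt_iff_tendsto_slope]
  refine tendsto_L2_of_eLpNorm (h.congr fun s => eLpNorm_congr_ae ?_)
  filter_upwards [Lp.coeFn_smul s⁻¹ (F s - F 0), Lp.coeFn_sub (F s) (F 0)] with l h1 h2
  have e : slope F 0 s = s⁻¹ • (F s - F 0) := by rw [slope_def_module, sub_zero]
  rw [e, h1, Pi.smul_apply, h2, Pi.sub_apply, smul_eq_mul]

lemma eLpNorm_mul_le_four (u v : ℝ → ℝ) (hu : AEStronglyMeasurable u volume)
    (hv : AEStronglyMeasurable v volume) :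
    eLpNorm (fun l => u l * v l) 2 ≤ eLpNorm u 4 * eLpNorm v 4 := by
  have : ENNReal.HolderTriple 4 4 2 := ⟨by
    rw [← two_mul, show (4 : ℝ≥0∞) = 2 * 2 by norm_num, ENNReal.mul_inv (by simp) (by simp),
      ← mul_assoc, ENNReal.mul_inv_cancel (by simp) (by simp), one_mul]⟩
  have h := eLpNorm_smul_le_mul_eLpNorm (p := 4) (q := 4) (r := 2) hv hu
  rwa [show u • v = fun l => u l * v l from funext fun l => rfl] at h

/-- A condition on two directions under which the second derivative of `ω` exists. -/
def PairBound (a b : ℝ × ℝ × ℝ) (K : ℝ) : Prop :=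
  0 ≤ K ∧ ∀ l, wt l ^ 3 * (|phase b l| * |phase a l|) ≤ K

/-- The dominating function of the source term in the equation of the second derivatives. -/
noncomputable def pairMaj (a b : ℝ × ℝ × ℝ) (K : ℝ) (u v : ℝ → ℝ) (l : ℝ) : ℝ :=
  K * wt l + psize a * |u l| + (psize b * |v l| + |u l * v l|)

lemma wt_pow_four_mul_phase_le (e : ℝ × ℝ × ℝ) (l : ℝ) : wt l ^ 4 * |phase e l| ≤ psize e := by
  have hw := wt_pos l
  calc wt l ^ 4 * |phase e l| = wt l ^ 2 * (|phase e l| * wt l ^ 2) := by ring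
    _ ≤ 1 * psize e := by
        gcongr
        · exact pow_le_one₀ hw.le (wt_le_one l)
        · exact abs_phase_mul_le e l
    _ = psize e := one_mul _

lemma wt_pow_four_le_one (l : ℝ) : wt l ^ 4 ≤ 1 := pow_le_one₀ (wt_pos l).le (wt_le_one l)

lemma pairMaj_nonneg {a b : ℝ × ℝ × ℝ} {K : ℝ} (hK : 0 ≤ K) (u v : ℝ → ℝ) (l : ℝ) :
    0 ≤ pairMaj a b K u v l := by
  have hw := wt_pos l
  have ha := psize_nonneg a
  have hb := psize_nonneg b
  unfold pairMaj
  positivity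

lemma wt_pow_four_mul_le_pairMaj {a b : ℝ × ℝ × ℝ} {K : ℝ} (hK : PairBound a b K) (u v : ℝ → ℝ)
    (l : ℝ) : wt l ^ 4 * |(phase b l + u l) * (phase a l + v l)| ≤ pairMaj a b K u v l := by
  have hw := wt_pos l
  have ha := wt_pow_four_mul_phase_le a l
  have hb := wt_pow_four_mul_phase_le b l
  have h1 := wt_pow_four_le_one l
  have hab := mul_le_mul_of_nonneg_right (hK.2 l) hw.le
  have h2 : |(phase b l + u l) * (phase a l + v l)|
      ≤ (|phase b l| + |u l|) * (|phase a l| + |v l|) := by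
    rw [abs_mul]
    gcongr <;> exact abs_add_le _ _
  calc wt l ^ 4 * |(phase b l + u l) * (phase a l + v l)|
      ≤ wt l ^ 4 * ((|phase b l| + |u l|) * (|phase a l| + |v l|)) := by gcongr
    _ = wt l ^ 3 * (|phase b l| * |phase a l|) * wt l + (wt l ^ 4 * |phase a l|) * |u l|
        + ((wt l ^ 4 * |phase b l|) * |v l| + wt l ^ 4 * (|u l| * |v l|)) := by ring
    _ ≤ K * wt l + psize a * |u l| + (psize b * |v l| + 1 * (|u l| * |v l|)) := by gcongr
    _ = _ := by rw [pairMaj, one_mul, abs_mul]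

lemma eLpNorm_const_mul_abs_le {c : ℝ} (u : ℝ → ℝ) (p : ℝ≥0∞) :
    eLpNorm (fun l => c * |u l|) p ≤ ‖c‖ₑ * eLpNorm u p := by
  have h := eLpNorm_const_smul c (fun l => ‖u l‖) p (volume : Measure ℝ)
  rw [eLpNorm_norm] at h
  exact h.le

/-- The bound of the `L²`-norm of `pairMaj`. -/
noncomputable def pairMajNorm (a b : ℝ × ℝ × ℝ) (K : ℝ) (Nu Nv Nu4 Nv4 : ℝ≥0∞) : ℝ≥0∞ :=
  ‖K‖ₑ * eLpNorm wt 2 + ‖psize a‖ₑ * Nu + (‖psize b‖ₑ * Nv + Nu4 * Nv4)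

lemma eLpNorm_pairMaj_le (a b : ℝ × ℝ × ℝ) (K : ℝ) {u v : ℝ → ℝ} (hu : Measurable u)
    (hv : Measurable v) : eLpNorm (pairMaj a b K u v) 2
      ≤ pairMajNorm a b K (eLpNorm u 2) (eLpNorm v 2) (eLpNorm u 4) (eLpNorm v 4) := by
  have hw := continuous_wt.measurable
  have m1 : Measurable fun l => K * wt l := by fun_prop
  have m2 : Measurable fun l => psize a * |u l| := by fun_prop
  have m3 : Measurable fun l => psize b * |v l| := by fun_prop
  have m4 : Measurable fun l => |u l * v l| := by fun_prop
  have h4 : eLpNorm (fun l => |u l * v l|) 2 ≤ eLpNorm u 4 * eLpNorm v 4 := by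
    have := eLpNorm_norm (p := 2) (μ := volume) fun l => u l * v l
    exact this.le.trans (eLpNorm_mul_le_four u v hu.aestronglyMeasurable hv.aestronglyMeasurable)
  have h1 : eLpNorm (fun l => K * wt l) 2 ≤ ‖K‖ₑ * eLpNorm wt 2 :=
    (eLpNorm_const_smul K wt 2 volume).le
  refine (eLpNorm_add_le (m1.add m2).aestronglyMeasurable (m3.add m4).aestronglyMeasurable
    one_le_two).trans (add_le_add ?_ ?_)
  · exact (eLpNorm_add_le m1.aestronglyMeasurable m2.aestronglyMeasurable one_le_two).trans
      (add_le_add h1 (eLpNorm_const_mul_abs_le u 2))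
  · exact (eLpNorm_add_le m3.aestronglyMeasurable m4.aestronglyMeasurable one_le_two).trans
      (add_le_add (eLpNorm_const_mul_abs_le v 2) h4)

namespace Nonlinearity

variable {χ χ₁ χ₂ : ℝ → ℝ → ℂ} {C : ℝ}

/-- Differences of coefficients along the solution tend to zero, when tested against functions of
controlled growth. -/
lemma tendsto_coeff_sub (H : Nonlinearity χ χ₁ χ₂ C) {q : ℝ≥0∞} (hq : q = 2 ∨ q = 4)
    {Ψ : ℝ → ℝ → ℂ} {k : ℕ} (hb : ∀ ξ l, ‖Ψ ξ l‖ ≤ C * wt l ^ k)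
    (hl : ∀ a b l, ‖Ψ a l - Ψ b l‖ ≤ C * wt l ^ (k + 1) * |a - b|) {ρ : ℝ → ℝ} (hρm : Measurable ρ)
    (hρ : MemLp (fun l => wt l ^ k * ρ l) q) (p₀ : ℝ × ℝ × ℝ) :
    Tendsto (fun p => eLpNorm (fun l => ‖Ψ (H.fullPhase p l) l - Ψ (H.fullPhase p₀ l) l‖ * ρ l) q)
      (𝓝 p₀) (𝓝 0) := by
  have hC := H.nonneg
  have hwm := continuous_wt.measurable
  let M : ℝ → ℝ → ℝ := fun ε l =>
    min (2 * C * wt l ^ k) (C * wt l ^ (k + 1) * ((wt l ^ 2)⁻¹ * |ε|)) * ρ l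
  have hM0 : ∀ ε l, 0 ≤ min (2 * C * wt l ^ k) (C * wt l ^ (k + 1) * ((wt l ^ 2)⁻¹ * |ε|)) := by
    intro ε l
    have hw := wt_pos l
    exact le_min (by positivity) (by positivity)
  have hMlim : Tendsto (fun ε => eLpNorm (M ε) q) (𝓝 0) (𝓝 0) := by
    refine tendsto_eLpNorm_of_dominated hq (.of_forall fun ε => ?_) (hρ.const_mul (2 * C))
      (.of_forall fun ε => .of_forall fun l => ?_) (.of_forall fun l => ?_)
    · exact Measurable.aestronglyMeasurable (by fun_prop)
    · have hw := wt_pos l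
      rw [← mul_assoc, abs_mul, abs_mul (2 * C * wt l ^ k), abs_of_nonneg (hM0 ε l),
        abs_of_nonneg (show 0 ≤ 2 * C * wt l ^ k by positivity)]
      gcongr
      exact min_le_left _ _
    · have hw := wt_pos l
      have hc : Continuous fun ε => M ε l := by fun_prop
      have := hc.tendsto 0
      have e : M 0 l = 0 := by
        simp only [M, abs_zero, mul_zero]
        rw [min_eq_right (by positivity), zero_mul]
      rwa [e] at this
  have hε : Tendsto (fun p => psize (p - p₀) + H.supDist p p₀) (𝓝 p₀) (𝓝 0) := by
    have h1 : Tendsto (fun p => psize (p - p₀)) (𝓝 p₀) (𝓝 0) := by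
      have : Continuous fun p => psize (p - p₀) := continuous_psize.comp (by fun_prop)
      simpa [psize] using this.tendsto p₀
    simpa using h1.add (H.tendsto_supDist p₀)
  refine tendsto_eLpNorm_of_le (hMlim.comp hε) (.of_forall fun p => ?_)
  filter_upwards [H.ae_abs_omega_sub_le p p₀] with l h1
  have hw := wt_pos l
  have hs : 0 ≤ H.supDist p p₀ := Real.sqrt_nonneg _
  have hps := psize_nonneg (p - p₀)
  simp only [M]
  rw [abs_mul, abs_mul, abs_norm, abs_of_nonneg (hM0 _ l)]
  refine mul_le_mul_of_nonneg_right (le_min ?_ ((hl _ _ l).trans ?_)) (abs_nonneg _)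
  · have := norm_sub_le_of_le (hb (H.fullPhase p l) l) (hb (H.fullPhase p₀ l) l)
    linarith
  · refine mul_le_mul_of_nonneg_left ?_ (by positivity)
    rw [abs_of_nonneg (by positivity : 0 ≤ psize (p - p₀) + H.supDist p p₀), le_inv_mul_iff₀
      (by positivity)]
    have e : H.fullPhase p l - H.fullPhase p₀ l
        = phase (p - p₀) l + (H.omega p l - H.omega p₀ l) := by
      rw [fullPhase, fullPhase, phase_sub]; ring
    have h2 := abs_phase_mul_le (p - p₀) l
    have h3 : wt l ^ 2 ≤ 1 := pow_le_one₀ hw.le (wt_le_one l)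
    calc wt l ^ 2 * |H.fullPhase p l - H.fullPhase p₀ l|
        ≤ wt l ^ 2 * (|phase (p - p₀) l| + |H.omega p l - H.omega p₀ l|) := by
          rw [e]; gcongr; exact abs_add_le _ _
      _ = |phase (p - p₀) l| * wt l ^ 2 + wt l ^ 2 * |H.omega p l - H.omega p₀ l| := by ring
      _ ≤ psize (p - p₀) + 1 * H.supDist p p₀ := by gcongr
      _ = _ := by rw [one_mul]

lemma tendsto_eLpNorm_omegaD_sub (H : Nonlinearity χ χ₁ χ₂ C) {q : ℝ≥0∞} (hq : q = 2 ∨ q = 4)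
    (e p₀ : ℝ × ℝ × ℝ) :
    Tendsto (fun p => eLpNorm (fun l => H.omegaD e p l - H.omegaD e p₀ l) q) (𝓝 p₀) (𝓝 0) := by
  set ρ : ℝ → ℝ := fun l => phase e l + H.omegaD e p₀ l with hρ
  have hρm : Measurable ρ := (continuous_phase e).measurable.add (measurable_L2 _)
  have hm := fun p => H.measurable_comp₁ (H.measurable_fullPhase p)
  refine SolvesLinear.tendsto_eLpNorm hq
    (.of_forall fun p => (H.omegaD_solves e p).sub (H.omegaD_solves e p₀))
    (fun p => (((hm p).sub (hm p₀)).norm.mul hρm).aestronglyMeasurable)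
    (.of_forall fun p => .of_forall fun l => ?_)
    (.of_forall fun p => ((H.memLp_omegaD hq e p).sub (H.memLp_omegaD hq e p₀)).2.ne)
    (H.tendsto_coeff_sub hq H.bound₁ H.lip₁ hρm
      (memLp_wt_phase_add hq e (H.memLp_omegaD hq e p₀)) p₀)
  have e1 : χ₁ (H.fullPhase p l) l * ((phase e l + H.omegaD e p l : ℝ) : ℂ)
      - χ₁ (H.fullPhase p₀ l) l * ((phase e l + H.omegaD e p₀ l : ℝ) : ℂ)
      = χ₁ (H.fullPhase p l) l * ((H.omegaD e p l - H.omegaD e p₀ l : ℝ) : ℂ)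
        + (χ₁ (H.fullPhase p l) l - χ₁ (H.fullPhase p₀ l) l) * (ρ l : ℂ) := by
    rw [hρ]; push_cast; ring
  rw [e1]
  refine norm_add_le_of_le ?_ ?_
  · rw [norm_mul, Complex.norm_real, Real.norm_eq_abs]
    gcongr
    exact H.small _ l
  · simp only [Pi.mul_apply, Pi.sub_apply]
    rw [norm_mul, Complex.norm_real, Real.norm_eq_abs, abs_mul, abs_norm]

lemma continuous_omegaD (H : Nonlinearity χ χ₁ χ₂ C) (e : ℝ × ℝ × ℝ) : Continuous (H.omegaD e) :=
  continuous_iff_continuousAt.2 fun p =>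
    tendsto_L2_of_eLpNorm (H.tendsto_eLpNorm_omegaD_sub (.inl rfl) e p)

lemma hasDerivAt_omega (H : Nonlinearity χ χ₁ χ₂ C) (e p : ℝ × ℝ × ℝ) :
    HasDerivAt (fun s : ℝ => H.omega (p + s • e)) (H.omegaD e p) 0 := by
  refine hasDerivAt_of_eLpNorm ?_
  simpa [quot] using H.tendsto_eLpNorm_quot_sub (.inl rfl) e p (Lp.memLp _)

lemma toReal_le_of_eLpNorm_le {u : L2} {B : ℝ≥0∞} (hB : B ≠ ∞) (h : eLpNorm u 2 ≤ B) :
    ‖u‖ ≤ B.toReal := by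
  rw [Lp.norm_def]
  exact ENNReal.toReal_mono hB h

lemma norm_omegaD_le (H : Nonlinearity χ χ₁ χ₂ C) (e p : ℝ × ℝ × ℝ) :
    ‖H.omegaD e p‖ ≤ (derivBound C e 2).toReal :=
  toReal_le_of_eLpNorm_le (derivBound_ne_top C e (.inl rfl)) (H.eLpNorm_omegaD_le (.inl rfl) e p)

section Second

variable {a b : ℝ × ℝ × ℝ} {K : ℝ}

/-- The product of the first order variations of the phase. -/
noncomputable def varProd (H : Nonlinearity χ χ₁ χ₂ C) (a b p : ℝ × ℝ × ℝ) (l : ℝ) : ℝ :=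
  (phase b l + H.omegaD b p l) * (phase a l + H.omegaD a p l)

lemma measurable_varProd (H : Nonlinearity χ χ₁ χ₂ C) (a b p : ℝ × ℝ × ℝ) :
    Measurable (H.varProd a b p) :=
  ((continuous_phase b).measurable.add (measurable_L2 _)).mul
    ((continuous_phase a).measurable.add (measurable_L2 _))

/-- A uniform bound for the source term in the equation of the second derivatives. -/
noncomputable def sourceBound (C : ℝ) (a b : ℝ × ℝ × ℝ) (K : ℝ) : ℝ≥0∞ :=
  pairMajNorm a b K (derivBound C b 2) (derivBound C a 2) (derivBound C b 4) (derivBound C a 4)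

lemma sourceBound_ne_top (C : ℝ) (a b : ℝ × ℝ × ℝ) (K : ℝ) : sourceBound C a b K ≠ ∞ := by
  have h := fun e => derivBound_ne_top C e (q := 2) (.inl rfl)
  have h' := fun e => derivBound_ne_top C e (q := 4) (.inr rfl)
  have hw := (memLp_wt (p := 2) (.inl rfl)).2.ne
  simp only [sourceBound, pairMajNorm, ne_eq, ENNReal.add_eq_top, ENNReal.mul_eq_top, not_or]
  simp [h, h', hw]

lemma eLpNorm_wt_varProd_le (H : Nonlinearity χ χ₁ χ₂ C) (hK : PairBound a b K)
    (p : ℝ × ℝ × ℝ) : eLpNorm (fun l => wt l ^ 4 * H.varProd a b p l) 2 ≤ sourceBound C a b K := by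
  have h1 : eLpNorm (fun l => wt l ^ 4 * H.varProd a b p l) 2
      ≤ eLpNorm (pairMaj a b K (H.omegaD b p) (H.omegaD a p)) 2 := by
    refine eLpNorm_mono fun l => ?_
    have hw := wt_pos l
    rw [norm_mul, Real.norm_of_nonneg (show 0 ≤ wt l ^ 4 by positivity),
      Real.norm_of_nonneg (pairMaj_nonneg hK.1 _ _ l)]
    exact wt_pow_four_mul_le_pairMaj hK _ _ l
  refine (h1.trans (eLpNorm_pairMaj_le a b K (measurable_L2 _) (measurable_L2 _))).trans ?_
  rw [sourceBound, pairMajNorm, pairMajNorm]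
  gcongr <;> first | exact H.eLpNorm_omegaD_le (.inl rfl) _ _ | exact H.eLpNorm_omegaD_le (.inr rfl) _ _

lemma memLp_wt_varProd (H : Nonlinearity χ χ₁ χ₂ C) (hK : PairBound a b K) (p : ℝ × ℝ × ℝ) :
    MemLp (fun l => wt l ^ 4 * H.varProd a b p l) 2 :=
  ⟨((continuous_wt.measurable.pow_const 4).mul (H.measurable_varProd a b p)).aestronglyMeasurable,
    (H.eLpNorm_wt_varProd_le hK p).trans_lt (sourceBound_ne_top C a b K).lt_top⟩

lemma exists_second_derivative (H : Nonlinearity χ χ₁ χ₂ C) (hK : PairBound a b K)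
    (p : ℝ × ℝ × ℝ) : ∃ v : L2, SolvesLinear v fun l =>
      χ₁ (H.fullPhase p l) l * (v l : ℂ) + χ₂ (H.fullPhase p l) l * (H.varProd a b p l : ℂ) := by
  have m1 := H.measurable_comp₁ (H.measurable_fullPhase p)
  have m2 := H.measurable_comp₂ (H.measurable_fullPhase p)
  refine exists_solvesLinear (f := fun v l => χ₁ (H.fullPhase p l) l * (v l : ℂ)
    + χ₂ (H.fullPhase p l) l * (H.varProd a b p l : ℂ)) (fun v => ?_) fun u v l => ?_
  · refine MemLp.add (f := fun l => χ₁ (H.fullPhase p l) l * (v l : ℂ))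
      (g := fun l => χ₂ (H.fullPhase p l) l * (H.varProd a b p l : ℂ)) ?_ ?_
    · refine ((Lp.memLp v).const_mul (3 / 14)).mono
        (m1.mul (Complex.measurable_ofReal.comp (measurable_L2 v))).aestronglyMeasurable
        (.of_forall fun l => ?_)
      rw [norm_mul, norm_mul, Complex.norm_real,
        Real.norm_of_nonneg (show (0 : ℝ) ≤ 3 / 14 by norm_num)]
      exact mul_le_mul_of_nonneg_right (H.small _ l) (norm_nonneg _)
    · refine ((H.memLp_wt_varProd hK p).const_mul C).mono
        (m2.mul (Complex.measurable_ofReal.comp (H.measurable_varProd a b p))).aestronglyMeasurable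
        (.of_forall fun l => ?_)
      have hw := wt_pos l
      rw [norm_mul, norm_mul, norm_mul (wt l ^ 4), Complex.norm_real, Real.norm_of_nonneg H.nonneg,
        ← mul_assoc, Real.norm_of_nonneg (show 0 ≤ wt l ^ 4 by positivity)]
      exact mul_le_mul_of_nonneg_right (H.bound₂ _ l) (norm_nonneg _)
  · rw [add_sub_add_right_eq_sub, ← mul_sub, norm_mul, ← Complex.ofReal_sub, Complex.norm_real]
    exact mul_le_mul_of_nonneg_right (H.small _ l) (norm_nonneg _)

/-- The second directional derivative of `ω` in the directions `a`, `b`. -/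
noncomputable def omegaDD (H : Nonlinearity χ χ₁ χ₂ C) (hK : PairBound a b K)
    (p : ℝ × ℝ × ℝ) : L2 := (H.exists_second_derivative hK p).choose

lemma omegaDD_solves (H : Nonlinearity χ χ₁ χ₂ C) (hK : PairBound a b K) (p : ℝ × ℝ × ℝ) :
    SolvesLinear (H.omegaDD hK p) fun l => χ₁ (H.fullPhase p l) l * (H.omegaDD hK p l : ℂ)
      + χ₂ (H.fullPhase p l) l * (H.varProd a b p l : ℂ) :=
  (H.exists_second_derivative hK p).choose_spec

lemma norm_omegaDD_le (H : Nonlinearity χ χ₁ χ₂ C) (hK : PairBound a b K) (p : ℝ × ℝ × ℝ) :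
    ‖H.omegaDD hK p‖ ≤ (14 * (‖C‖ₑ * sourceBound C a b K)).toReal := by
  refine toReal_le_of_eLpNorm_le (ENNReal.mul_ne_top (by simp)
    (ENNReal.mul_ne_top (by simp) (sourceBound_ne_top C a b K))) ?_
  have hm := (H.memLp_wt_varProd hK p).const_mul C
  refine ((H.omegaDD_solves hK p).eLpNorm_two_le hm.1 (.of_forall fun l => ?_)).trans ?_
  · have hw := wt_pos l
    refine norm_add_le_of_le ?_ ?_
    · rw [norm_mul, Complex.norm_real]
      exact mul_le_mul_of_nonneg_right (H.small _ l) (norm_nonneg _)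
    · rw [norm_mul, Complex.norm_real, ← mul_assoc, abs_mul,
        abs_of_nonneg (mul_nonneg H.nonneg (pow_nonneg hw.le 4))]
      exact mul_le_mul_of_nonneg_right (H.bound₂ _ l) (norm_nonneg _)
  · gcongr
    refine (eLpNorm_const_smul C (fun l => wt l ^ 4 * H.varProd a b p l) 2 volume).le.trans ?_
    gcongr
    exact H.eLpNorm_wt_varProd_le hK p

end Second

end Nonlinearity

end Pavlov

namespace Pavlov

lemma memLp_wt_pow_mul_abs {k : ℕ} {u : ℝ → ℝ} {q : ℝ≥0∞} (hu : MemLp (fun l => wt l ^ k * u l) q) :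
    MemLp (fun l => wt l ^ k * |u l|) q := by
  refine hu.norm.congr_norm ?_ (.of_forall fun l => ?_)
  · have h := hu.1.norm
    refine h.congr (.of_forall fun l => ?_)
    have hw := wt_pos l
    simp only
    rw [norm_mul, Real.norm_of_nonneg (show 0 ≤ wt l ^ k by positivity), Real.norm_eq_abs]
  · have hw := wt_pos l
    simp only [norm_mul, Real.norm_eq_abs, abs_abs]

lemma memLp_wt_pow_mul (k : ℕ) (u : L2) : MemLp (fun l => wt l ^ k * u l) 2 := by
  refine (Lp.memLp u).mono
    ((continuous_wt.pow k).aestronglyMeasurable.mul (Lp.aestronglyMeasurable u))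
    (.of_forall fun l => ?_)
  have hw := wt_pos l
  rw [norm_mul, Real.norm_of_nonneg (show 0 ≤ wt l ^ k by positivity)]
  exact mul_le_of_le_one_left (norm_nonneg _) (pow_le_one₀ hw.le (wt_le_one l))

/-- The dominating function of a variation `d` times a first order variation `phase e + u`. -/
noncomputable def crossMaj (e : ℝ × ℝ × ℝ) (u d : ℝ → ℝ) (l : ℝ) : ℝ :=
  psize e * |d l| + |d l * u l|

lemma measurable_crossMaj (e : ℝ × ℝ × ℝ) {u d : ℝ → ℝ} (hu : Measurable u) (hd : Measurable d) :
    Measurable (crossMaj e u d) := by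
  unfold crossMaj
  fun_prop

lemma wt_pow_four_mul_le_crossMaj (e : ℝ × ℝ × ℝ) (u d : ℝ → ℝ) (l : ℝ) :
    wt l ^ 4 * (|d l| * |phase e l + u l|) ≤ crossMaj e u d l := by
  have hw := wt_pos l
  have he := wt_pow_four_mul_phase_le e l
  have h1 := wt_pow_four_le_one l
  calc wt l ^ 4 * (|d l| * |phase e l + u l|)
      ≤ wt l ^ 4 * (|d l| * (|phase e l| + |u l|)) := by gcongr; exact abs_add_le _ _
    _ = wt l ^ 4 * |phase e l| * |d l| + wt l ^ 4 * (|d l| * |u l|) := by ring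
    _ ≤ psize e * |d l| + 1 * (|d l| * |u l|) := by gcongr
    _ = _ := by rw [crossMaj, one_mul, abs_mul]

lemma tendsto_crossMaj {ι : Type*} {L : Filter ι} (e : ℝ × ℝ × ℝ) {u d : ι → ℝ → ℝ}
    (hu : ∀ i, Measurable (u i)) (hd : ∀ i, Measurable (d i)) {B : ℝ≥0∞} (hB : B ≠ ∞)
    (huB : ∀ i, eLpNorm (u i) 4 ≤ B) (h₂ : Tendsto (fun i => eLpNorm (d i) 2) L (𝓝 0))
    (h₄ : Tendsto (fun i => eLpNorm (d i) 4) L (𝓝 0)) :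
    Tendsto (fun i => eLpNorm (crossMaj e (u i) (d i)) 2) L (𝓝 0) := by
  refine tendsto_eLpNorm_add one_le_two (fun i => ((hd i).norm.const_mul _).aestronglyMeasurable)
    (fun i => ((hd i).mul (hu i)).norm.aestronglyMeasurable) ?_ ?_
  · refine tendsto_eLpNorm_const_mul _ (h₂.congr fun i => ?_)
    exact (eLpNorm_norm (d i)).symm
  · have h := ENNReal.Tendsto.mul_const (b := B) h₄ (.inr hB)
    rw [zero_mul] at h
    refine tendsto_of_tendsto_of_tendsto_of_le_of_le tendsto_const_nhds h (fun _ => zero_le)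
      fun i => ?_
    refine (eLpNorm_norm fun l => d i l * u i l).le.trans ?_
    refine (eLpNorm_mul_le_four _ _ (hd i).aestronglyMeasurable (hu i).aestronglyMeasurable).trans ?_
    exact mul_le_mul_right (huB i) _

namespace Nonlinearity

variable {χ χ₁ χ₂ : ℝ → ℝ → ℂ} {C : ℝ} {a b : ℝ × ℝ × ℝ} {K : ℝ}

lemma continuous_omegaDD (H : Nonlinearity χ χ₁ χ₂ C) (hK : PairBound a b K) :
    Continuous (H.omegaDD hK) := by
  refine continuous_iff_continuousAt.2 fun q => tendsto_L2_of_eLpNorm ?_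
  have hC := H.nonneg
  set v := H.omegaDD hK q
  have hm₁ := fun p => H.measurable_comp₁ (H.measurable_fullPhase p)
  have hm₂ := fun p => H.measurable_comp₂ (H.measurable_fullPhase p)
  have hu := fun e p => measurable_L2 (H.omegaD e p)
  have hW := H.measurable_varProd a b q
  let r₁ : ℝ × ℝ × ℝ → ℝ → ℝ := fun p l =>
    ‖χ₁ (H.fullPhase p l) l - χ₁ (H.fullPhase q l) l‖ * |v l|
  let r₂ : ℝ × ℝ × ℝ → ℝ → ℝ := fun p l =>
    ‖χ₂ (H.fullPhase p l) l - χ₂ (H.fullPhase q l) l‖ * |H.varProd a b q l|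
  let δ : ℝ × ℝ × ℝ → ℝ × ℝ × ℝ → ℝ → ℝ := fun e p l => H.omegaD e p l - H.omegaD e q l
  let r₃ : ℝ × ℝ × ℝ → ℝ → ℝ := fun p l => C * crossMaj a (H.omegaD a p) (δ b p) l
  let r₄ : ℝ × ℝ × ℝ → ℝ → ℝ := fun p l => C * crossMaj b (H.omegaD b q) (δ a p) l
  have hδ : ∀ e p, Measurable (δ e p) := fun e p => (hu e p).sub (hu e q)
  have m₁ : ∀ p, Measurable (r₁ p) := fun p =>
    ((hm₁ p).sub (hm₁ q)).norm.mul (measurable_L2 v).norm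
  have m₂ : ∀ p, Measurable (r₂ p) := fun p => ((hm₂ p).sub (hm₂ q)).norm.mul hW.norm
  have m₃ : ∀ p, Measurable (r₃ p) := fun p =>
    (measurable_crossMaj a (hu a p) (hδ b p)).const_mul C
  have m₄ : ∀ p, Measurable (r₄ p) := fun p =>
    (measurable_crossMaj b (hu b q) (hδ a p)).const_mul C
  have hδ2 := fun e => H.tendsto_eLpNorm_omegaD_sub (.inl rfl) e q
  have hδ4 := fun e => H.tendsto_eLpNorm_omegaD_sub (.inr rfl) e q
  have l₁ : Tendsto (fun p => eLpNorm (r₁ p) 2) (𝓝 q) (𝓝 0) :=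
    H.tendsto_coeff_sub (.inl rfl) H.bound₁ H.lip₁ (measurable_L2 v).norm
      (memLp_wt_pow_mul_abs (memLp_wt_pow_mul 3 v)) q
  have l₂ : Tendsto (fun p => eLpNorm (r₂ p) 2) (𝓝 q) (𝓝 0) :=
    H.tendsto_coeff_sub (.inl rfl) H.bound₂ H.lip₂ hW.norm
      (memLp_wt_pow_mul_abs (H.memLp_wt_varProd hK q)) q
  have l₃ : Tendsto (fun p => eLpNorm (r₃ p) 2) (𝓝 q) (𝓝 0) :=
    tendsto_eLpNorm_const_mul C (tendsto_crossMaj a (hu a) (hδ b) (derivBound_ne_top C a (.inr rfl))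
      (H.eLpNorm_omegaD_le (.inr rfl) a) (hδ2 b) (hδ4 b))
  have l₄ : Tendsto (fun p => eLpNorm (r₄ p) 2) (𝓝 q) (𝓝 0) :=
    tendsto_eLpNorm_const_mul C (tendsto_crossMaj b (fun _ => hu b q) (hδ a)
      (derivBound_ne_top C b (.inr rfl)) (fun _ => H.eLpNorm_omegaD_le (.inr rfl) b q)
      (hδ2 a) (hδ4 a))
  refine SolvesLinear.tendsto_eLpNorm (.inl rfl) (r := fun p l => r₁ p l + r₂ p l + (r₃ p l + r₄ p l))
    (.of_forall fun p => (H.omegaDD_solves hK p).sub (H.omegaDD_solves hK q))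
    (fun p => (((m₁ p).add (m₂ p)).add ((m₃ p).add (m₄ p))).aestronglyMeasurable)
    (.of_forall fun p => .of_forall fun l => ?_)
    (.of_forall fun p => ((Lp.memLp (H.omegaDD hK p)).sub (Lp.memLp v)).2.ne)
    (tendsto_eLpNorm_add one_le_two (fun p => ((m₁ p).add (m₂ p)).aestronglyMeasurable)
      (fun p => ((m₃ p).add (m₄ p)).aestronglyMeasurable)
      (tendsto_eLpNorm_add one_le_two (fun p => (m₁ p).aestronglyMeasurable)
        (fun p => (m₂ p).aestronglyMeasurable) l₁ l₂)
      (tendsto_eLpNorm_add one_le_two (fun p => (m₃ p).aestronglyMeasurable)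
        (fun p => (m₄ p).aestronglyMeasurable) l₃ l₄))
  have e1 : χ₁ (H.fullPhase p l) l * (H.omegaDD hK p l : ℂ)
        + χ₂ (H.fullPhase p l) l * (H.varProd a b p l : ℂ)
      - (χ₁ (H.fullPhase q l) l * (v l : ℂ) + χ₂ (H.fullPhase q l) l * (H.varProd a b q l : ℂ))
      = χ₁ (H.fullPhase p l) l * ((H.omegaDD hK p l - v l : ℝ) : ℂ)
        + ((χ₁ (H.fullPhase p l) l - χ₁ (H.fullPhase q l) l) * (v l : ℂ)
          + (χ₂ (H.fullPhase p l) l - χ₂ (H.fullPhase q l) l) * (H.varProd a b q l : ℂ)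
          + (χ₂ (H.fullPhase p l) l * ((δ b p l * (phase a l + H.omegaD a p l) : ℝ) : ℂ)
            + χ₂ (H.fullPhase p l) l * ((δ a p l * (phase b l + H.omegaD b q l) : ℝ) : ℂ))) := by
    simp only [δ, varProd]; push_cast; ring
  rw [e1]
  have hcross : ∀ (e : ℝ × ℝ × ℝ) (u d : ℝ → ℝ), ‖χ₂ (H.fullPhase p l) l
      * ((d l * (phase e l + u l) : ℝ) : ℂ)‖ ≤ C * crossMaj e u d l := by
    intro e u d
    rw [norm_mul, Complex.norm_real, Real.norm_eq_abs, abs_mul]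
    refine (mul_le_mul_of_nonneg_right (H.bound₂ _ l) (by positivity)).trans ?_
    rw [mul_assoc]
    exact mul_le_mul_of_nonneg_left (wt_pow_four_mul_le_crossMaj e u d l) hC
  refine norm_add_le_of_le ?_ ((norm_add_le_of_le (norm_add_le_of_le ?_ ?_)
    (norm_add_le_of_le (hcross _ _ _) (hcross _ _ _))).trans (le_abs_self _))
  · rw [norm_mul, Complex.norm_real]
    exact mul_le_mul_of_nonneg_right (H.small _ l) (norm_nonneg _)
  · rw [norm_mul, Complex.norm_real, Real.norm_eq_abs]
  · rw [norm_mul, Complex.norm_real, Real.norm_eq_abs]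

/-- The difference quotient of `∂ₐ ω` in the direction `b`. -/
noncomputable def quotD (H : Nonlinearity χ χ₁ χ₂ C) (a b p : ℝ × ℝ × ℝ) (s l : ℝ) : ℝ :=
  s⁻¹ * (H.omegaD a (p + s • b) l - H.omegaD a p l)

lemma quotD_solves (H : Nonlinearity χ χ₁ χ₂ C) (a b p : ℝ × ℝ × ℝ) (s : ℝ) :
    SolvesLinear (H.quotD a b p s) fun l => ((s⁻¹ : ℝ) : ℂ) *
      (χ₁ (H.fullPhase (p + s • b) l) l * ((phase a l + H.omegaD a (p + s • b) l : ℝ) : ℂ)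
        - χ₁ (H.fullPhase p l) l * ((phase a l + H.omegaD a p l : ℝ) : ℂ)) :=
  ((H.omegaD_solves a (p + s • b)).sub (H.omegaD_solves a p)).const_mul s⁻¹

lemma tendsto_eLpNorm_taylorRem_mul (H : Nonlinearity χ χ₁ χ₂ C) (hK : PairBound a b K)
    (p : ℝ × ℝ × ℝ) : Tendsto (fun s => eLpNorm (fun l =>
      taylorRem χ₁ χ₂ (H.fullPhase p) (fun l => phase b l + H.omegaD b p l) s l
        * |phase a l + H.omegaD a p l|) 2) (𝓝[≠] 0) (𝓝 0) := by
  have hρb : Measurable fun l => phase b l + H.omegaD b p l :=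
    (continuous_phase b).measurable.add (measurable_L2 _)
  have hρa : Measurable fun l => phase a l + H.omegaD a p l :=
    (continuous_phase a).measurable.add (measurable_L2 _)
  have hm := measurable_taylorRem H.meas₁ H.meas₂ (H.measurable_fullPhase p) hρb
  have hs : ∀ᶠ s : ℝ in 𝓝[≠] 0, s ≠ 0 := self_mem_nhdsWithin
  refine tendsto_eLpNorm_of_dominated (.inl rfl)
    (.of_forall fun s => ((hm s).mul hρa.norm).aestronglyMeasurable)
    ((H.memLp_wt_varProd hK p).const_mul (2 * C)) ?_ (.of_forall fun l => ?_)
  · filter_upwards [hs] with s hs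
    refine .of_forall fun l => ?_
    have h1 := taylorRem_le (B := fun l => C * wt l ^ 4) H.bound₂ H.lip₁ (H.fullPhase p)
      (fun l => phase b l + H.omegaD b p l) hs l
    have hw := wt_pos l
    have hC := H.nonneg
    rw [abs_mul, abs_abs, abs_of_nonneg (show 0 ≤ taylorRem χ₁ χ₂ (H.fullPhase p)
      (fun l => phase b l + H.omegaD b p l) s l from norm_nonneg _)]
    refine (mul_le_mul_of_nonneg_right h1 (abs_nonneg _)).trans (le_of_eq ?_)
    rw [abs_mul (2 * C), abs_mul (wt l ^ 4), varProd, abs_mul (phase b l + _),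
      abs_of_nonneg (show 0 ≤ wt l ^ 4 by positivity), abs_of_nonneg (show 0 ≤ 2 * C by positivity)]
    ring
  · have := (tendsto_taylorRem H.deriv₁ (H.fullPhase p)
      (fun l => phase b l + H.omegaD b p l) l).mul_const |phase a l + H.omegaD a p l|
    rwa [zero_mul] at this

lemma tendsto_add_smul (p e : ℝ × ℝ × ℝ) : Tendsto (fun s : ℝ => p + s • e) (𝓝[≠] 0) (𝓝 p) := by
  have h : Continuous fun s : ℝ => p + s • e := by fun_prop
  have := h.tendsto 0
  rw [zero_smul, add_zero] at this
  exact this.mono_left nhdsWithin_le_nhds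

lemma hasDerivAt_omegaD (H : Nonlinearity χ χ₁ χ₂ C) (hK : PairBound a b K) (p : ℝ × ℝ × ℝ) :
    HasDerivAt (fun s : ℝ => H.omegaD a (p + s • b)) (H.omegaDD hK p) 0 := by
  refine hasDerivAt_of_eLpNorm ?_
  simp only [zero_smul, add_zero]
  have hC := H.nonneg
  set v := H.omegaDD hK p
  have hs : ∀ᶠ s : ℝ in 𝓝[≠] 0, s ≠ 0 := self_mem_nhdsWithin
  have hm₁ := fun p => H.measurable_comp₁ (H.measurable_fullPhase p)
  have hu := fun e => measurable_L2 (H.omegaD e p)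
  let δ : ℝ → ℝ → ℝ := fun s l => H.quot b p s l - H.omegaD b p l
  let ρ : ℝ → ℝ := fun l => phase b l + H.omegaD b p l
  let r₁ : ℝ → ℝ → ℝ := fun s l =>
    ‖χ₁ (H.fullPhase (p + s • b) l) l - χ₁ (H.fullPhase p l) l‖ * |v l|
  let r₂ : ℝ → ℝ → ℝ := fun s l => C * crossMaj a (H.omegaD a p) (δ s) l
  let r₃ : ℝ → ℝ → ℝ := fun s l =>
    taylorRem χ₁ χ₂ (H.fullPhase p) ρ s l * |phase a l + H.omegaD a p l|
  have hδ : ∀ s, Measurable (δ s) := fun s => (H.measurable_quot b p s).sub (hu b)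
  have hρ : ∀ e, Measurable fun l => phase e l + H.omegaD e p l := fun e =>
    (continuous_phase e).measurable.add (hu e)
  have m₁ : ∀ s, Measurable (r₁ s) := fun s =>
    ((hm₁ (p + s • b)).sub (hm₁ p)).norm.mul (measurable_L2 v).norm
  have m₂ : ∀ s, Measurable (r₂ s) := fun s => (measurable_crossMaj a (hu a) (hδ s)).const_mul C
  have m₃ : ∀ s, Measurable (r₃ s) := fun s =>
    (measurable_taylorRem H.meas₁ H.meas₂ (H.measurable_fullPhase p) (hρ b) s).mul (hρ a).norm
  have l₁ : Tendsto (fun s => eLpNorm (r₁ s) 2) (𝓝[≠] 0) (𝓝 0) :=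
    (H.tendsto_coeff_sub (.inl rfl) H.bound₁ H.lip₁ (measurable_L2 v).norm
      (memLp_wt_pow_mul_abs (memLp_wt_pow_mul 3 v)) p).comp (tendsto_add_smul p b)
  have l₂ : Tendsto (fun s => eLpNorm (r₂ s) 2) (𝓝[≠] 0) (𝓝 0) :=
    tendsto_eLpNorm_const_mul C (tendsto_crossMaj a (fun _ => hu a) hδ
      (derivBound_ne_top C a (.inr rfl)) (fun _ => H.eLpNorm_omegaD_le (.inr rfl) a p)
      (H.tendsto_eLpNorm_quot_sub (.inl rfl) b p (H.memLp_omegaD (.inl rfl) b p))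
      (H.tendsto_eLpNorm_quot_sub (.inr rfl) b p (H.memLp_omegaD (.inr rfl) b p)))
  have l₃ : Tendsto (fun s => eLpNorm (r₃ s) 2) (𝓝[≠] 0) (𝓝 0) :=
    H.tendsto_eLpNorm_taylorRem_mul hK p
  refine SolvesLinear.tendsto_eLpNorm (.inl rfl) (r := fun s l => r₁ s l + (r₂ s l + r₃ s l))
    (.of_forall fun s => (H.quotD_solves a b p s).sub (H.omegaDD_solves hK p))
    (fun s => ((m₁ s).add ((m₂ s).add (m₃ s))).aestronglyMeasurable) ?_
    (.of_forall fun s => ((((Lp.memLp (H.omegaD a (p + s • b))).sub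
      (Lp.memLp (H.omegaD a p))).const_mul s⁻¹).sub (Lp.memLp v)).2.ne)
    (tendsto_eLpNorm_add one_le_two (fun s => (m₁ s).aestronglyMeasurable)
      (fun s => ((m₂ s).add (m₃ s)).aestronglyMeasurable) l₁
      (tendsto_eLpNorm_add one_le_two (fun s => (m₂ s).aestronglyMeasurable)
        (fun s => (m₃ s).aestronglyMeasurable) l₂ l₃))
  filter_upwards [hs] with s hs
  refine .of_forall fun l => ?_
  have hw := wt_pos l
  have h1 := H.lip₁ (H.fullPhase (p + s • b) l) (H.fullPhase p l + s * ρ l) l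
  have e0 : H.fullPhase (p + s • b) l - (H.fullPhase p l + s * ρ l) = s * δ s l := by
    rw [H.fullPhase_add_smul b p hs]; simp only [ρ, δ]; ring
  rw [e0, abs_mul] at h1
  have e1 : ((s⁻¹ : ℝ) : ℂ) *
      (χ₁ (H.fullPhase (p + s • b) l) l * ((phase a l + H.omegaD a (p + s • b) l : ℝ) : ℂ)
        - χ₁ (H.fullPhase p l) l * ((phase a l + H.omegaD a p l : ℝ) : ℂ))
      - (χ₁ (H.fullPhase p l) l * (v l : ℂ) + χ₂ (H.fullPhase p l) l * (H.varProd a b p l : ℂ))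
      = χ₁ (H.fullPhase (p + s • b) l) l * ((H.quotD a b p s l - v l : ℝ) : ℂ)
        + ((χ₁ (H.fullPhase (p + s • b) l) l - χ₁ (H.fullPhase p l) l) * (v l : ℂ)
          + (((s⁻¹ : ℝ) : ℂ) * (χ₁ (H.fullPhase (p + s • b) l) l
              - χ₁ (H.fullPhase p l + s * ρ l) l) * ((phase a l + H.omegaD a p l : ℝ) : ℂ)
            + (((s⁻¹ : ℝ) : ℂ) * (χ₁ (H.fullPhase p l + s * ρ l) l - χ₁ (H.fullPhase p l) l)
              - χ₂ (H.fullPhase p l) l * (ρ l : ℂ)) * ((phase a l + H.omegaD a p l : ℝ) : ℂ))) := by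
    simp only [ρ, varProd, quotD]; push_cast; ring
  rw [e1]
  refine norm_add_le_of_le ?_ ((norm_add_le_of_le ?_ (norm_add_le_of_le ?_ ?_)).trans
    (le_abs_self _))
  · rw [norm_mul, Complex.norm_real]
    exact mul_le_mul_of_nonneg_right (H.small _ l) (norm_nonneg _)
  · rw [norm_mul, Complex.norm_real, Real.norm_eq_abs]
  · have h2 : ‖((s⁻¹ : ℝ) : ℂ) * (χ₁ (H.fullPhase (p + s • b) l) l
        - χ₁ (H.fullPhase p l + s * ρ l) l)‖ ≤ C * wt l ^ 4 * |δ s l| := by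
      rw [norm_mul, Complex.norm_real, norm_inv, Real.norm_eq_abs, inv_mul_le_iff₀ (abs_pos.2 hs)]
      linarith
    rw [norm_mul _ ((_ : ℝ) : ℂ), Complex.norm_real, Real.norm_eq_abs]
    refine (mul_le_mul_of_nonneg_right h2 (abs_nonneg _)).trans ?_
    rw [mul_assoc, mul_assoc]
    exact mul_le_mul_of_nonneg_left (wt_pow_four_mul_le_crossMaj a _ _ l) hC
  · rw [norm_mul, Complex.norm_real, Real.norm_eq_abs]
    rfl

end Nonlinearity

end Pavlov

namespace Pavlov

lemma tan_pi_div_eight_le : Real.tan (Real.pi / 8) ≤ 3 / 7 := by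
  have hpi := Real.pi_pos
  have h0 : 0 < Real.tan (Real.pi / 8) :=
    Real.tan_pos_of_pos_of_lt_pi_div_two (by positivity) (by linarith)
  have h1 : Real.tan (Real.pi / 8) < 1 := by
    rw [← Real.tan_pi_div_four]
    exact Real.tan_lt_tan_of_lt_of_lt_pi_div_two (by linarith) (by linarith) (by linarith)
  have h2 : Real.tan (2 * (Real.pi / 8))
      = 2 * Real.tan (Real.pi / 8) / (1 - Real.tan (Real.pi / 8) ^ 2) := Real.tan_two_mul
  rw [show 2 * (Real.pi / 8) = Real.pi / 4 by ring, Real.tan_pi_div_four] at h2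
  have h3 : 0 < 1 - Real.tan (Real.pi / 8) ^ 2 := by nlinarith
  rw [eq_div_iff h3.ne'] at h2
  nlinarith

lemma div_one_add_pow_le {C : ℝ} (hC : 0 ≤ C) {k : ℕ} (hk : k ≤ 5) (l : ℝ) :
    C / (1 + |l| ^ k) ≤ 32 * C * wt l ^ k := by
  have h0 : 0 ≤ |l| := abs_nonneg l
  have h1 : (1 + |l|) ^ k ≤ 2 ^ (k - 1) * (1 ^ k + |l| ^ k) := add_pow_le zero_le_one h0 k
  have h2 : (2 : ℝ) ^ (k - 1) ≤ 2 ^ 5 := pow_le_pow_right₀ one_le_two (by omega)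
  rw [one_pow] at h1
  have h3 : (1 + |l|) ^ k ≤ 32 * (1 + |l| ^ k) :=
    h1.trans (mul_le_mul_of_nonneg_right (h2.trans (by norm_num)) (by positivity))
  rw [wt, inv_pow, ← div_eq_mul_inv, div_le_div_iff₀ (by positivity) (by positivity)]
  calc C * (1 + |l|) ^ k ≤ C * (32 * (1 + |l| ^ k)) := by gcongr
    _ = _ := by ring

lemma dXi_zero (χ : ℝ → ℝ → ℂ) (ξ l : ℝ) : dXi 0 χ ξ l = χ ξ l := by
  rw [dXi, iteratedDeriv_zero]

lemma DiffXi.hasDerivAt {n : ℕ} {χ : ℝ → ℝ → ℂ} (h : DiffXi n χ) {k : ℕ} (hk : k < n) (ξ l : ℝ) :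
    HasDerivAt (fun s => dXi k χ s l) (dXi (k + 1) χ ξ l) ξ := by
  have h1 := (h k hk l ξ).hasDerivAt
  rwa [show deriv (fun s => dXi k χ s l) ξ = dXi (k + 1) χ ξ l by
    simp only [dXi, iteratedDeriv_succ]] at h1

lemma measurable_deriv_fst {Φ Φ' : ℝ → ℝ → ℂ} (hΦ : Continuous fun q : ℝ × ℝ => Φ q.1 q.2)
    (h : ∀ ξ l, HasDerivAt (fun s => Φ s l) (Φ' ξ l) ξ) :
    Measurable fun q : ℝ × ℝ => Φ' q.1 q.2 := by
  have h1 : Continuous (Function.uncurry fun l ξ => Φ ξ l) := hΦ.comp continuous_swap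
  have h2 := (measurable_deriv_with_param h1).comp measurable_swap
  have e : (fun q : ℝ × ℝ => Φ' q.1 q.2)
      = (fun p : ℝ × ℝ => deriv (fun ξ => Φ ξ p.1) p.2) ∘ Prod.swap :=
    funext fun q => (h q.1 q.2).deriv.symm
  rwa [e]

lemma norm_sub_le_of_dLam {χ : ℝ → ℝ → ℂ} {C : ℝ} (hC : 0 ≤ C) (hd : DiffLam χ)
    (hb : ∀ ξ l, ‖dLam χ ξ l‖ ≤ C * wt l ^ 3) (ξ l s : ℝ) (hs : |s| ≤ 1) :
    ‖χ ξ (l + s) - χ ξ l‖ ≤ 8 * C * wt l ^ 3 * |s| := by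
  have hw := wt_pos l
  have h := (convex_closedBall l |s|).norm_image_sub_le_of_norm_hasDerivWithin_le
    (f := fun m => χ ξ m) (f' := fun m => dLam χ ξ m) (C := 8 * C * wt l ^ 3)
    (fun m _ => ((hd ξ m).hasDerivAt).hasDerivWithinAt) (fun m hm => ?_)
    (Metric.mem_closedBall_self (abs_nonneg s)) (y := l + s) (by simp)
  · simpa using h
  · rw [Metric.mem_closedBall, Real.dist_eq] at hm
    have h1 := wt_add_le (l := l) (hm.trans hs)
    rw [add_sub_cancel] at h1
    have hm0 := wt_pos m
    calc ‖dLam χ ξ m‖ ≤ C * wt m ^ 3 := hb ξ m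
      _ ≤ C * (2 * wt l) ^ 3 := by gcongr
      _ = _ := by ring

lemma norm_sub_le_of_hasDerivAt {f f' : ℝ → ℂ} {B : ℝ} (h : ∀ x, HasDerivAt f (f' x) x)
    (hb : ∀ x, ‖f' x‖ ≤ B) (a b : ℝ) : ‖f a - f b‖ ≤ B * |a - b| :=
  Convex.norm_image_sub_le_of_norm_hasDerivWithin_le (fun x _ => (h x).hasDerivWithinAt)
    (fun x _ => hb x) convex_univ (Set.mem_univ b) (Set.mem_univ a)

lemma exists_nonlinearity {χ : ℝ → ℝ → ℂ}
    (hχ : Continuous fun q : ℝ × ℝ => χ q.1 q.2)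
    (hχ' : Continuous fun q : ℝ × ℝ => dXi 1 χ q.1 q.2)
    (hre : ∀ ξ l : ℝ, |(dXi 1 χ ξ l).re| ≤ 1 / 4 * Real.tan (Real.pi / 8))
    (him : ∀ ξ l : ℝ, |(dXi 1 χ ξ l).im| ≤ 1 / 4 * Real.tan (Real.pi / 8))
    (hdiff : DiffXi 3 χ)
    (hdecay₁ : ∃ C : ℝ, ∀ n ≤ 3, ∀ ξ l : ℝ, ‖dXi n χ ξ l‖ ≤ C / (1 + |l| ^ (2 + n)))
    (hdiffl : DiffLam χ)
    (hdecay₂ : ∃ C : ℝ, ∀ ξ l : ℝ, ‖dLam χ ξ l‖ ≤ C / (1 + |l| ^ 3)) :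
    ∃ C, Nonlinearity χ (dXi 1 χ) (dXi 2 χ) C := by
  obtain ⟨C₁, h₁⟩ := hdecay₁
  obtain ⟨C₂, h₂⟩ := hdecay₂
  set A := max C₁ (max C₂ 0)
  have hA : 0 ≤ A := (le_max_right _ _).trans (le_max_right _ _)
  have hb₁ : ∀ n ≤ 3, ∀ ξ l : ℝ, ‖dXi n χ ξ l‖ ≤ 32 * A * wt l ^ (2 + n) := fun n hn ξ l =>
    (h₁ n hn ξ l).trans ((div_le_div_of_nonneg_right (le_max_left _ _) (by positivity)).trans
      (div_one_add_pow_le hA (by omega) l))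
  have hb₂ : ∀ ξ l : ℝ, ‖dLam χ ξ l‖ ≤ 32 * A * wt l ^ 3 := fun ξ l =>
    (h₂ ξ l).trans ((div_le_div_of_nonneg_right ((le_max_left _ _).trans (le_max_right _ _))
      (by positivity)).trans (div_one_add_pow_le hA (by omega) l))
  have hle : ∀ n ≤ 3, ∀ ξ l : ℝ, ‖dXi n χ ξ l‖ ≤ 256 * A * wt l ^ (2 + n) := fun n hn ξ l => by
    have hw := wt_pos l
    exact (hb₁ n hn ξ l).trans (mul_le_mul_of_nonneg_right (by linarith) (by positivity))
  have hd0 : ∀ ξ l, HasDerivAt (fun s => χ s l) (dXi 1 χ ξ l) ξ := fun ξ l => by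
    simpa only [dXi_zero, zero_add] using hdiff.hasDerivAt (k := 0) (by norm_num) ξ l
  have hd1 : ∀ ξ l, HasDerivAt (fun s => dXi 1 χ s l) (dXi 2 χ ξ l) ξ :=
    hdiff.hasDerivAt (k := 1) (by norm_num)
  have hd2 : ∀ ξ l, HasDerivAt (fun s => dXi 2 χ s l) (dXi 3 χ ξ l) ξ :=
    hdiff.hasDerivAt (k := 2) (by norm_num)
  refine ⟨256 * A, ?_⟩
  constructor
  · positivity
  · exact hχ.measurable
  · exact hχ'.measurable
  · exact measurable_deriv_fst hχ' hd1
  · exact hd0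
  · exact hd1
  · exact fun ξ l => by simpa only [dXi_zero] using hle 0 (by norm_num) ξ l
  · exact fun ξ l => by simpa only [Nat.reduceAdd] using hle 1 (by norm_num) ξ l
  · exact fun ξ l => by simpa only [Nat.reduceAdd] using hle 2 (by norm_num) ξ l
  · intro ξ l
    have h := Complex.norm_le_abs_re_add_abs_im (dXi 1 χ ξ l)
    linarith [hre ξ l, him ξ l, tan_pi_div_eight_le]
  · intro a b l
    have h3 : ∀ x, ‖dXi 3 χ x l‖ ≤ 256 * A * wt l ^ 5 := fun x => by
      simpa only [Nat.reduceAdd] using hle 3 le_rfl x l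
    exact norm_sub_le_of_hasDerivAt (fun x => hd2 x l) h3 a b
  · intro ξ l s hs
    have h := norm_sub_le_of_dLam (by positivity) hdiffl hb₂ ξ l s hs
    linarith

lemma hasDerivAt_line {F : ℝ × ℝ × ℝ → L2} {G : L2} {p e : ℝ × ℝ × ℝ}
    (h : HasDerivAt (fun s : ℝ => F (p + s • e)) G 0) (c : ℝ) :
    HasDerivAt (fun s : ℝ => F (p + (s - c) • e)) G c := by
  have h' : HasDerivAt (fun s : ℝ => F (p + s • e)) G (c - c) := by rwa [sub_self]
  exact h'.comp_sub_const c c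

lemma hasDx_of_line {F G : ℝ × ℝ × ℝ → L2}
    (h : ∀ p, HasDerivAt (fun s : ℝ => F (p + s • ((1, 0, 0) : ℝ × ℝ × ℝ))) (G p) 0) :
    HasDx (fun x y t => F (x, y, t)) fun x y t => G (x, y, t) := fun x y t _ => by
  simpa using hasDerivAt_line (h (x, y, t)) x

lemma hasDy_of_line {F G : ℝ × ℝ × ℝ → L2}
    (h : ∀ p, HasDerivAt (fun s : ℝ => F (p + s • ((0, 1, 0) : ℝ × ℝ × ℝ))) (G p) 0) :
    HasDy (fun x y t => F (x, y, t)) fun x y t => G (x, y, t) := fun x y t _ => by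
  simpa using hasDerivAt_line (h (x, y, t)) y

lemma hasDt_of_line {F G : ℝ × ℝ × ℝ → L2}
    (h : ∀ p, HasDerivAt (fun s : ℝ => F (p + s • ((0, 0, 1) : ℝ × ℝ × ℝ))) (G p) 0) :
    HasDt (fun x y t => F (x, y, t)) fun x y t => G (x, y, t) := fun x y t _ => by
  have := hasDerivAt_line (h (x, y, t)) t
  simp only [Prod.smul_mk, smul_eq_mul, mul_zero, mul_one, Prod.mk_add_mk, add_zero,
    add_sub_cancel] at this
  exact this.hasDerivWithinAt

lemma bddL2_of_norm_le {F : ℝ × ℝ × ℝ → L2} {M : ℝ} (h : ∀ p, ‖F p‖ ≤ M) :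
    BddL2 fun x y t => F (x, y, t) := ⟨M, fun _ _ _ _ => h _⟩

lemma pairBound_of_le {a b : ℝ × ℝ × ℝ} (h : ∀ l, |phase b l| * |phase a l| ≤ (1 + |l|) ^ 3) :
    PairBound a b 1 := by
  refine ⟨zero_le_one, fun l => ?_⟩
  have h0 : 0 < (1 + |l|) ^ 3 := by positivity
  rw [wt, inv_pow, inv_mul_le_iff₀ h0, mul_one]
  exact h l

lemma pairBound_xx : PairBound (1, 0, 0) (1, 0, 0) 1 := pairBound_of_le fun l => by
  have h0 := abs_nonneg l
  simp only [phase, mul_zero, sub_zero, abs_one, mul_one]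
  exact one_le_pow₀ (by linarith)

lemma sq_le_one_add_pow_three {x : ℝ} (hx : 0 ≤ x) : x ^ 2 ≤ (1 + x) ^ 3 := by
  nlinarith [pow_nonneg hx 3, pow_nonneg hx 2]

lemma pairBound_yy : PairBound (0, 1, 0) (0, 1, 0) 1 := pairBound_of_le fun l => by
  simp only [phase, mul_zero, sub_zero, mul_one, zero_sub, abs_neg, ← sq]
  exact sq_le_one_add_pow_three (abs_nonneg l)

lemma pairBound_yx : PairBound (0, 1, 0) (1, 0, 0) 1 := pairBound_of_le fun l => by
  have h0 := abs_nonneg l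
  simp only [phase, mul_zero, sub_zero, mul_one, zero_sub, abs_neg, abs_one, one_mul]
  exact (by linarith : |l| ≤ 1 + |l|).trans (le_self_pow₀ (by linarith) (by norm_num))

lemma pairBound_xt : PairBound (1, 0, 0) (0, 0, 1) 1 := pairBound_of_le fun l => by
  simp only [phase, mul_zero, sub_zero, mul_one, zero_sub, abs_neg, abs_one, abs_pow]
  exact sq_le_one_add_pow_three (abs_nonneg l)

end Pavlov

theorem theoremT (χ : ℝ → ℝ → ℂ)
    -- `χ` and `∂_ξ χ` exist and are continuous
    (hχ : Continuous fun q : ℝ × ℝ => χ q.1 q.2)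
    (hχ' : Continuous fun q : ℝ × ℝ => Pavlov.dXi 1 χ q.1 q.2)
    -- smallness of `∂_ξ χ`
    (hre : ∀ ξ l : ℝ, |(Pavlov.dXi 1 χ ξ l).re| ≤ 1 / 4 * Real.tan (Real.pi / 8))
    (him : ∀ ξ l : ℝ, |(Pavlov.dXi 1 χ ξ l).im| ≤ 1 / 4 * Real.tan (Real.pi / 8))
    -- decay of `χ`
    (hdecay : ∃ C : ℝ, ∀ ξ l : ℝ, ‖χ ξ l‖ ≤ C / (1 + |l|))
    -- existence and decay of `∂_ξ^n χ`, `n ≤ 3`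
    (hdiff : Pavlov.DiffXi 3 χ)
    (hdecay₁ : ∃ C : ℝ, ∀ n ≤ 3, ∀ ξ l : ℝ, ‖Pavlov.dXi n χ ξ l‖ ≤ C / (1 + |l| ^ (2 + n)))
    -- existence and decay of `∂_ξ^n ∂_λ χ`, `n ≤ 1`
    (hdiffl : Pavlov.DiffLam χ)
    (hdiffl₁ : Pavlov.DiffXi 1 (Pavlov.dLam χ))
    (hdecay₂ : ∃ C : ℝ, ∀ n ≤ 1, ∀ ξ l : ℝ,
      ‖Pavlov.dXi n (Pavlov.dLam χ) ξ l‖ ≤ C / (1 + |l| ^ (3 + n))) :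
    ∃ ω : ℝ → ℝ → ℝ → Pavlov.L2,
      -- for `t ≥ 0`, `ψ = x - λ y - λ² t + ω` is the unique solution with `ω ∈ L²(dλ)`
      (∀ x y t : ℝ, 0 ≤ t →
        Pavlov.SolvesIST χ x y t (Pavlov.psi x y t (ω x y t)) ∧
        ∀ w : Pavlov.L2, Pavlov.SolvesIST χ x y t (Pavlov.psi x y t w) → w = ω x y t) ∧
      -- the solution lies in `H¹`, is continuous in `L² ∩ L^∞` and bounded in `L²`
      (∀ x y t : ℝ, 0 ≤ t → Pavlov.MemH1 (ω x y t)) ∧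
      Pavlov.ContL2 ω ∧ Pavlov.ContLInfty ω ∧ Pavlov.BddL2 ω ∧
      -- the derivatives exist in `L²`, are continuous and uniformly bounded
      (∃ ωx ωy ωt ωxx ωyy ωxy ωtx : ℝ → ℝ → ℝ → Pavlov.L2,
        (Pavlov.HasDx ω ωx ∧ Pavlov.ContL2 ωx ∧ Pavlov.BddL2 ωx) ∧
        (Pavlov.HasDy ω ωy ∧ Pavlov.ContL2 ωy ∧ Pavlov.BddL2 ωy) ∧
        (Pavlov.HasDt ω ωt ∧ Pavlov.ContL2 ωt ∧ Pavlov.BddL2 ωt) ∧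
        (Pavlov.HasDx ωx ωxx ∧ Pavlov.ContL2 ωxx ∧ Pavlov.BddL2 ωxx) ∧
        (Pavlov.HasDy ωy ωyy ∧ Pavlov.ContL2 ωyy ∧ Pavlov.BddL2 ωyy) ∧
        (Pavlov.HasDx ωy ωxy ∧ Pavlov.ContL2 ωxy ∧ Pavlov.BddL2 ωxy) ∧
        (Pavlov.HasDt ωx ωtx ∧ Pavlov.ContL2 ωtx ∧ Pavlov.BddL2 ωtx)) ∧
      -- at `t = 0` the solution is the solution `φ` of the stationary equation
      (∀ x y : ℝ, ∀ φ : ℝ → ℝ, MemLp (fun l => φ l - (x - l * y)) 2 volume →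
        Pavlov.SolvesStationaryIST χ x y φ →
        Pavlov.psi x y 0 (ω x y 0) =ᵐ[volume] φ) := by
  obtain ⟨C, H⟩ := Pavlov.exists_nonlinearity hχ hχ' hre him hdiff hdecay₁ hdiffl
    (hdecay₂.imp fun C h ξ l => by
      simpa only [Pavlov.dXi_zero, add_zero] using h 0 (Nat.zero_le 1) ξ l)
  have first : ∀ e, Pavlov.ContL2 (fun x y t => H.omegaD e (x, y, t)) ∧
      Pavlov.BddL2 fun x y t => H.omegaD e (x, y, t) := fun e =>
    ⟨Pavlov.contL2_of_tendsto (H.continuous_omegaD e), Pavlov.bddL2_of_norm_le (H.norm_omegaD_le e)⟩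
  have second : ∀ (a b : ℝ × ℝ × ℝ) (hK : Pavlov.PairBound a b 1),
      Pavlov.ContL2 (fun x y t => H.omegaDD hK (x, y, t)) ∧
      Pavlov.BddL2 fun x y t => H.omegaDD hK (x, y, t) := fun a b hK =>
    ⟨Pavlov.contL2_of_tendsto (H.continuous_omegaDD hK),
      Pavlov.bddL2_of_norm_le (H.norm_omegaDD_le hK)⟩
  refine ⟨fun x y t => H.omega (x, y, t),
    fun x y t _ => ⟨H.solvesIST_omega x y t, fun w hw => H.eq_omega_of_solvesIST hw⟩,
    fun x y t _ => (H.l2Lipschitz_omega (x, y, t)).memH1,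
    Pavlov.contL2_of_tendsto (continuous_iff_continuousAt.2 H.tendsto_omega),
    H.contLInfty_omega, Pavlov.bddL2_of_norm_le H.norm_omega_le,
    ⟨fun x y t => H.omegaD (1, 0, 0) (x, y, t), fun x y t => H.omegaD (0, 1, 0) (x, y, t),
      fun x y t => H.omegaD (0, 0, 1) (x, y, t),
      fun x y t => H.omegaDD Pavlov.pairBound_xx (x, y, t),
      fun x y t => H.omegaDD Pavlov.pairBound_yy (x, y, t),
      fun x y t => H.omegaDD Pavlov.pairBound_yx (x, y, t),
      fun x y t => H.omegaDD Pavlov.pairBound_xt (x, y, t),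
      ⟨Pavlov.hasDx_of_line (H.hasDerivAt_omega _), first _⟩,
      ⟨Pavlov.hasDy_of_line (H.hasDerivAt_omega _), first _⟩,
      ⟨Pavlov.hasDt_of_line (H.hasDerivAt_omega _), first _⟩,
      ⟨Pavlov.hasDx_of_line (H.hasDerivAt_omegaD _), second _ _ _⟩,
      ⟨Pavlov.hasDy_of_line (H.hasDerivAt_omegaD _), second _ _ _⟩,
      ⟨Pavlov.hasDx_of_line (H.hasDerivAt_omegaD _), second _ _ _⟩,
      ⟨Pavlov.hasDt_of_line (H.hasDerivAt_omegaD _), second _ _ _⟩⟩,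
    fun x y φ hφ h => H.psi_omega_eq_of_stationary hφ h⟩
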